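/- **Wavelets.** Let $\mathbb S^2\subset\mathbb R^3$ be the unit sphere with surface measure $\omega$, geodesic distance $d(x,y)=\arccos\langle x,y\rangle$, $d(x,S)=\inf_{s\in S}d(x,s)$, and spherical caps $C(z,\phi)=\{x\in\mathbb S^2: d(x,z)<\phi\}$, $\phi\in(0,\pi)$. In spherical coordinates $(\theta,\varphi)$ let $Y_n^k=(-1)^k\sqrt{\frac{2n+1}{4\pi}\frac{(n-k)!}{(n+k)!}}\,P_n^k(\cos\theta)e^{ik\varphi}$, $|k|\le n$, where $P_n$ is the Legendre polynomial, $P_n^k(x)=(1-x^2)^{k/2}P_n^{(k)}(x)$ for $k\ge 0$ and $P_n^{k}=(-1)^k\frac{(n+k)!}{(n-k)!}P_n^{-k}$ for $k<0$. For integers $K,N\ge 1$ and a window $\kappa:[0,\infty)\to\mathbb R$ with $\emptyset\ne\operatorname{supp}\kappa\subset[1/2,2]$ let $$\Psi_K^N=\sum_{n=0}^\infty\sum_{k=-n}^n\sqrt{\tfrac{2n+1}{8\pi^2}}\;\kappa(n/N)\,\zeta^K_{n,k}\,Y_n^k,$$ where $\zeta^K_{n,k}=\eta\nu\sqrt{2^{-p}\binom{p}{(p-k)/2}}$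 if $|k|\le K-1$ and $\zeta^K_{n,k}=0$ otherwise; here $\eta=1$ if $K-1$ is even and $\eta=i$ if it is odd; $\nu=1$ if $K+k$ is odd and $\nu=0$ if it is even; $p=\min(K-1,n-1)$ if $K+n$ is even and $p=\min(K-1,n)$ if it is odd. For $x\in\mathbb S^2$ and a unit tangent vector $r\perp x$, let $\mathcal D(x,r)f(y)=f(R^{-1}y)$, where $R\in SO(3)$ is the rotation with $Re_3=x$, $Re_1=r$. Write $\langle f,g\rangle=\int_{\mathbb S^2}f\,\overline g\,d\omega$. **The edge.** Let $A\subset\mathbb S^2$ be a set whose boundary $\partial A$ is the image of a closed unit-speed curve $v:[0,L]\to\mathbb S^2$, $0<L<\infty$, injective except for $v(0)=v(L)$, and let $[a,b]\subset[0,L]$, $a<b$, be such that $v\in C^3([a,b])$. For $p\in[a,b]$ put $v_{p,s}=\frac{v(p)+s\,v(p)\times v'(p)}{\|v(p)+s\,v(p)\times v'(p)\|}$. Assume that $A$ lies to the left of the curve along $[a,b]$ and its complement to the right: for every $p\in[a,b]$, $v_{p,s}\in A$ for all sufficiently small $s>0$, and for every $p\in(a,b)$, $v_{p,-s}\notin A$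 for all sufficiently small $s>0$. Let $\phi^\ast=\inf_{t\in[a,b]}\arcsin(\|v''(t)\|^{-1})$ and assume that for all $t_1,t_2\in[a,b]$ $$\|v(t_1)-v(t_2)\|\le\frac{1-\cos\phi^\ast}{2},\qquad \|v'(t_1)-v'(t_2)\|\le\frac14-\frac{(1+\cos\phi^\ast)^2}{16}.$$ Let $\delta\in(0,1]$ with $a+\delta\le b-\delta$, $[a,b]_\delta=[a+\delta,b-\delta]$, and $$d_\delta=\min\Bigl(\tfrac{\delta}{5}\sin(\phi^\ast/2),\ \inf_{t\in[a,b]_\delta,\ s\in[0,L]\setminus(a,b)}d(v(t),v(s))\Bigr).$$ Let $\mathcal N$ be the set of all $x\in\mathbb S^2$ with $d(x,\partial A)=d(x,v([a,b]_\delta))\le\phi^\ast/4$, and for $x\in\mathcal N$ let $p_x\in[a,b]_\delta$ be the point with $d(x,\partial A)=d(x,v(p_x))$. For $p=p_x$ there is exactly one spherical cap $C_p$ with the following two properties: its bounding circle has an arc-length parameterization $u$ on $[-\pi\|v''(p)\|^{-1},\pi\|v''(p)\|^{-1}]$ with $u(0)=v(p)$, $u'(0)=v'(p)$, $u''(0)=v''(p)$;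 and for every $\epsilon'>0$ there is a point $y\in A\cap C_p$ with $y\perp v'(p)$ and $d(y,v(p))<\epsilon'$. **Claim.** Let $\varepsilon\in[3/5,1)$, let $q\in\mathbb N$ with $q\ge K-3+\frac{2}{1-\varepsilon}$, and let $\kappa\in C^{3q-1}([0,\infty))$, or $\kappa\in C^{q}([0,\infty))$ if $K=1$. Then there is a constant $c>0$ depending only on $\kappa,\phi^\ast,K,\varepsilon$ such that, for all $A,v,L,a,b,\delta$ as above with the given value of $\phi^\ast$, $$\bigl|\langle \mathbf 1_A-\mathbf 1_{C_{p_x}},\ \mathcal D(x,r)\Psi_K^N\rangle\bigr|\le c\,\Bigl(\sup_{t\in[a,b]}\|v'''(t)\|+1\Bigr)N^{2-4\varepsilon}$$ for all $x\in\mathcal N$, all unit tangent vectors $r\perp x$ and all integers $N\ge1$ with $N^{-\varepsilon}<d_\delta/2$. -/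

import Mathlib

open Set Filter Topology MeasureTheory
open scoped Matrix

noncomputable section

namespace SphereEdge

/-- Euclidean three-space. -/
abbrev E3 : Type := EuclideanSpace ℝ (Fin 3)

/-- The unit sphere. -/
abbrev S2 : Type := Metric.sphere (0 : E3) 1

/-- The surface measure of the sphere (total mass `4 * π`). -/
def surf : Measure S2 := (volume : Measure E3).toSphere

/-- Geodesic distance of two points of the sphere. -/
def geoDist (x y : E3) : ℝ := Real.arccos (inner ℝ x y)

/-- Geodesic distance of a point to a (nonempty) set. -/
def geoDistSet (x : E3) (S : Set E3) : ℝ := sInf (geoDist x '' S)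

/-- The open spherical cap with center `z` and opening angle `φ`. -/
def cap (z : S2) (φ : ℝ) : Set S2 := {y | geoDist y z < φ}

/-- The circle bounding `cap z φ`. -/
def capCircle (z : S2) (φ : ℝ) : Set E3 := {y | y ∈ Metric.sphere (0 : E3) 1 ∧ geoDist y z = φ}

/-- The topological boundary in the sphere of `A`, as a set of points of three-space. -/
def bdry (A : Set S2) : Set E3 := Subtype.val '' frontier A

/-- The cross product. For a unit vector `x` and `w ⊥ x` it is the image of `w` under the
counterclockwise rotation by `π / 2` around the axis `x`. -/
def cross (x w : E3) : E3 := WithLp.toLp 2 (crossProduct x.ofLp w.ofLp)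

/-- The rotation matrix `R(x, r)` for a unit tangent vector `r` at the point `x`
(its columns are `r`, `x × r`, `x`). -/
def rotMatrix (x r : E3) : Matrix (Fin 3) (Fin 3) ℝ :=
  (Matrix.of ![r.ofLp, (cross x r).ofLp, x.ofLp])ᵀ

/-- `R(x, r)` is the rotation that maps the third basis vector to `x` and the first to `r`. -/
theorem rotMatrix_spec (x r : E3) (hx : ‖x‖ = 1) (hr : ‖r‖ = 1) (hxr : inner ℝ x r = 0) :
    rotMatrix x r ∈ Matrix.specialOrthogonalGroup (Fin 3) ℝ ∧
      rotMatrix x r *ᵥ ![0, 0, 1] = x.ofLp ∧ rotMatrix x r *ᵥ ![1, 0, 0] = r.ofLp := by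
  obtain ⟨x, rfl⟩ : ∃ w : Fin 3 → ℝ, x = WithLp.toLp 2 w := ⟨x.ofLp, rfl⟩
  obtain ⟨r, rfl⟩ : ∃ w : Fin 3 → ℝ, r = WithLp.toLp 2 w := ⟨r.ofLp, rfl⟩
  have h1 : x 0 ^ 2 + x 1 ^ 2 + x 2 ^ 2 = 1 := by
    have := EuclideanSpace.norm_sq_eq (WithLp.toLp 2 x)
    rw [hx] at this
    simp [Fin.sum_univ_three] at this
    linarith
  have h2 : r 0 ^ 2 + r 1 ^ 2 + r 2 ^ 2 = 1 := by
    have := EuclideanSpace.norm_sq_eq (WithLp.toLp 2 r)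
    rw [hr] at this
    simp [Fin.sum_univ_three] at this
    linarith
  have h3 : x 0 * r 0 + x 1 * r 1 + x 2 * r 2 = 0 := by
    simp [PiLp.inner_apply, Fin.sum_univ_three] at hxr
    linarith
  refine ⟨?_, ?_, ?_⟩
  · rw [Matrix.mem_specialOrthogonalGroup_iff, Matrix.mem_orthogonalGroup_iff']
    constructor
    · ext i j
      fin_cases i <;> fin_cases j <;>
        simp [rotMatrix, cross, Matrix.mul_apply, Fin.sum_univ_three, crossProduct] <;>
        grind
    · simp [rotMatrix, cross, Matrix.det_fin_three, crossProduct]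
      grind
  · ext i
    fin_cases i <;> simp [rotMatrix, Matrix.mulVec, dotProduct, Fin.sum_univ_three]
  · ext i
    fin_cases i <;> simp [rotMatrix, Matrix.mulVec, dotProduct, Fin.sum_univ_three]

/-- The rotation operator `D(x, r)`, acting on functions by composition with `R(x, r)⁻¹`. -/
def rotOp (x r : E3) (f : E3 → ℂ) (y : E3) : ℂ :=
  f (WithLp.toLp 2 ((rotMatrix x r)⁻¹ *ᵥ y.ofLp))

/-- The Legendre polynomial of degree `n`, by the Rodrigues formula. -/
def legendreP (n : ℕ) : Polynomial ℝ :=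
  Polynomial.C (1 / (2 ^ n * (n.factorial : ℝ))) *
    (Polynomial.derivative^[n] ((Polynomial.X ^ 2 - 1) ^ n))

/-- The associated Legendre function of degree `n` and order `k ≥ 0`. -/
def assocLegendreNat (n k : ℕ) (x : ℝ) : ℝ :=
  √(1 - x ^ 2) ^ k * (Polynomial.derivative^[k] (legendreP n)).eval x

/-- The associated Legendre function of degree `n` and order `k` with `|k| ≤ n`. -/
def assocLegendre (n : ℕ) (k : ℤ) (x : ℝ) : ℝ :=
  if 0 ≤ k then assocLegendreNat n k.toNat x
  else (-1) ^ k * ((((n : ℤ) + k).toNat.factorial : ℝ) / (((n : ℤ) - k).toNat.factorial : ℝ)) *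
    assocLegendreNat n (-k).toNat x

/-- The spherical harmonic of degree `n` and order `k`, `|k| ≤ n`, in spherical coordinates. -/
def sphHarm (n : ℕ) (k : ℤ) (θ φ : ℝ) : ℂ :=
  (-1) ^ k *
    (√((2 * n + 1) / (4 * Real.pi) *
      ((((n : ℤ) - k).toNat.factorial : ℝ) / (((n : ℤ) + k).toNat.factorial : ℝ))) : ℝ) *
    (assocLegendre n k (Real.cos θ) : ℝ) * Complex.exp (Complex.I * k * φ)

/-- The number `p` in the definition of the directionality component. -/
def dirP (K n : ℕ) : ℕ := if Even (K + n) then min (K - 1) (n - 1) else min (K - 1) n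

/-- The directionality component `ζ`; the factors `η` and `ν` are the two inner case distinctions.
When `K + k` is odd and `|k| ≤ n`, the number `(p - k) / 2` is a nonnegative integer. -/
def dirComp (K n : ℕ) (k : ℤ) : ℂ :=
  if |k| ≤ (K : ℤ) - 1 then
    (if Even (K - 1) then 1 else Complex.I) * (if Odd ((K : ℤ) + k) then 1 else 0) *
      (√(1 / 2 ^ dirP K n * ((dirP K n).choose (((dirP K n : ℤ) - k) / 2).toNat : ℝ)) : ℝ)
  else 0

/-- The directional wavelet in spherical coordinates. -/
def waveletPolar (κ : ℝ → ℝ) (K N : ℕ) (θ φ : ℝ) : ℂ :=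
  ∑' n : ℕ, ∑ k ∈ Finset.Icc (-(n : ℤ)) n,
    (√((2 * n + 1) / (8 * Real.pi ^ 2)) : ℝ) * (κ ((n : ℝ) / N) : ℝ) * dirComp K n k *
      sphHarm n k θ φ

/-- The directional wavelet as a function of the point `y` of the sphere with colatitude
`arccos y₃` and longitude `arg (y₁ + i y₂)`. -/
def wavelet (κ : ℝ → ℝ) (K N : ℕ) (y : E3) : ℂ :=
  waveletPolar κ K N (Real.arccos (y 2)) (Complex.arg ⟨y 0, y 1⟩)

/-- The `k`-th derivative at `t ∈ [a, b]` of a curve that is smooth on `[a, b]`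
(one-sided at the end points). -/
def curveDeriv (v : ℝ → E3) (a b : ℝ) (k : ℕ) (t : ℝ) : E3 :=
  iteratedDerivWithin k v (Icc a b) t

/-- The infimum `φ*` over `[a, b]` of `arcsin (1 / curvature)`. -/
def phiStar (v : ℝ → E3) (a b : ℝ) : ℝ :=
  sInf ((fun t => Real.arcsin ‖curveDeriv v a b 2 t‖⁻¹) '' Icc a b)

/-- The supremum over `[a, b]` of the norm of the third derivative. -/
def supThird (v : ℝ → E3) (a b : ℝ) : ℝ :=
  sSup ((fun t => ‖curveDeriv v a b 3 t‖) '' Icc a b)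

/-- The quantity `d_δ`. -/
def dDelta (v : ℝ → E3) (L a b δ : ℝ) : ℝ :=
  min (δ / 5 * Real.sin (phiStar v a b / 2))
    (sInf (image2 (fun t s => geoDist (v t) (v s)) (Icc (a + δ) (b - δ)) (Icc 0 L \ Ioo a b)))

/-- The neighborhood of the curve segment `v([a + δ, b - δ])`. -/
def edgeNhd (A : Set S2) (v : ℝ → E3) (a b δ : ℝ) : Set S2 :=
  {x | geoDistSet x (bdry A) = geoDistSet x (v '' Icc (a + δ) (b - δ)) ∧
    geoDistSet x (bdry A) ≤ phiStar v a b / 4}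

/-- The point of the sphere in direction `v(p) + s R(π/2) v'(p)`, i.e. to the left of the curve
for `s > 0` and to the right of it for `s < 0`. -/
def sidePoint (v : ℝ → E3) (a b p s : ℝ) : E3 :=
  let w := v p + s • cross (v p) (curveDeriv v a b 1 p)
  ‖w‖⁻¹ • w

/-- The setting: `A` is a subset of the sphere whose boundary is a closed simple unit-speed curve
`v` of length `L` that is `C³` on `[a, b]`, with `A` to the left of `v([a, b])` and its complement
to the right, and `[a, b]`, `δ` are sufficiently small. -/
structure EdgeSetting (A : Set S2) (v : ℝ → E3) (L a b δ : ℝ) : Prop where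
  L_pos : 0 < L
  bdry_eq : bdry A = v '' Icc 0 L
  closed : v 0 = v L
  inj : InjOn v (Ico 0 L)
  unit_speed : HasUnitSpeedOn v (Icc 0 L)
  a_nonneg : 0 ≤ a
  a_lt_b : a < b
  b_le : b ≤ L
  smooth : ContDiffOn ℝ 3 v (Icc a b)
  left_mem : ∀ p ∈ Icc a b, ∀ᶠ s in 𝓝[>] (0 : ℝ), sidePoint v a b p s ∈ Subtype.val '' A
  right_notMem : ∀ p ∈ Ioo a b, ∀ᶠ s in 𝓝[<] (0 : ℝ), sidePoint v a b p s ∉ Subtype.val '' A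
  pos_close : ∀ t₁ ∈ Icc a b, ∀ t₂ ∈ Icc a b,
    ‖v t₁ - v t₂‖ ≤ (1 - Real.cos (phiStar v a b)) / 2
  dir_close : ∀ t₁ ∈ Icc a b, ∀ t₂ ∈ Icc a b,
    ‖curveDeriv v a b 1 t₁ - curveDeriv v a b 1 t₂‖ ≤
      1 / 4 - (1 + Real.cos (phiStar v a b)) ^ 2 / 16
  δ_pos : 0 < δ
  δ_le_one : δ ≤ 1
  δ_small : a + δ ≤ b - δ

/-- `C` is the positively oriented osculating cap of the boundary curve at `v(p)`: its bounding
circle has an arc-length parameterization `u` on `[-ℓ, ℓ]`, `ℓ = π / ‖v''(p)‖`, that agrees with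
`v` at `p` up to second order, and `C` lies on the same side of the curve as `A`. -/
def IsOscCap (A : Set S2) (v : ℝ → E3) (a b p : ℝ) (C : Set S2) : Prop :=
  ∃ (z : S2) (φ : ℝ), φ ∈ Ioo 0 Real.pi ∧ C = cap z φ ∧
    (∃ (u : ℝ → E3) (ℓ : ℝ), ℓ = Real.pi * ‖curveDeriv v a b 2 p‖⁻¹ ∧
      ContDiffOn ℝ 2 u (Icc (-ℓ) ℓ) ∧
      (∀ t ∈ Icc (-ℓ) ℓ, ‖curveDeriv u (-ℓ) ℓ 1 t‖ = 1) ∧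
      u (-ℓ) = u ℓ ∧ InjOn u (Ico (-ℓ) ℓ) ∧ u '' Icc (-ℓ) ℓ = capCircle z φ ∧
      u 0 = v p ∧ curveDeriv u (-ℓ) ℓ 1 0 = curveDeriv v a b 1 p ∧
      curveDeriv u (-ℓ) ℓ 2 0 = curveDeriv v a b 2 p) ∧
    ∀ ε > 0, ∃ y ∈ A ∩ C, inner ℝ (y : E3) (curveDeriv v a b 1 p) = 0 ∧ geoDist y (v p) < ε

/-- The integrand `(1_A - 1_C) * conj (D(x, r) Ψ)` of the frame coefficient. -/
def coeffIntegrand (A C : Set S2) (κ : ℝ → ℝ) (K N : ℕ) (x r : E3) (y : S2) : ℂ :=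
  (A.indicator (fun _ => (1 : ℂ)) y - C.indicator (fun _ => (1 : ℂ)) y) *
    (starRingEnd ℂ) (rotOp x r (wavelet κ K N) y)

end SphereEdge

end

open SphereEdge

/-! The wavelet lives at distance about `1 / N` from `x`, and near `x` the sets `A` and `C_p` differ
only in a sliver between a curve and a circle that has contact of second order with it.

Localization (`exists_norm_waveletPolar_le`). With `θ` the distance from the centre and `m = q + 1 -
K`, both `‖Ψ‖` and `(N θ) ^ m ‖Ψ‖` are at most `C N ^ 2`. For each order `k` the sum over the
degrees is an expansion in associated Legendre functions, normalized so that Cauchy's estimate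
bounds them by `1`. The three-term recurrence turns multiplication by `1 - cos θ`, which is
comparable to `θ ^ 2`, into a second difference of the coefficients plus terms of the same size.
Each such step gains `N ^ (-2)` and costs two derivatives of `κ`. Even exponents come out directly.
An odd exponent is dominated by its even neighbours at the price of one derivative, which is
affordable for `K ≥ 2` because then `m + 1 ≤ q`. For `K = 1`, where `m = q`, only `k = 0` occurs,
and one Abel summation against the Christoffel-Darboux kernel gives the odd exponents without loss.

Geometry (`mem_iff_mem_cap_or`). Let `ρ = N ^ (-ε) / 10`. If `x` has distance at least `ρ` from the
boundary, the open `ρ`-ball about `x` is connected, misses the boundary, and lies on one side of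
both `A` and `C_p`. Otherwise the ball lies within `2 ρ` of `v(p)`. By Taylor's formula the curve
stays within height `M (3 ρ) ^ 3`, `M = sup ‖v'''‖`, of the plane of the osculating circle, so `A`
and `C_p` agree off a band of that height and of length `O(ρ)`.

Measure. The band has area `O(M ρ ^ 4)` by `surf_band_le`, the constant depending on `φ*` through `1
- cos φ*`. It contributes `O(M N ^ 2 ρ ^ 4) = O(M N ^ (2 - 4 ε))`. Outside the `ρ`-ball the decay
contributes `N ^ 2 N ^ (-m) ρ ^ (2 - m)` by `lintegral_geoDist_inv_pow_le`, and this is also `O(N ^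
(2 - 4 ε))` because the condition on `q` says exactly that `2 ε ≤ (1 - ε) m`.

The cap enters through `OscData`, an explicit form of `IsOscCap` (centre on the normal great circle,
`cot φ` equal to the geodesic curvature). The equivalence of the two also gives existence and
uniqueness of the cap. -/

namespace SphereEdge

/-! ### Legendre polynomials: recurrences and uniform bounds -/

open Polynomial in
/-- The polynomial `(X² - 1)ⁿ / (2ⁿ n!)`, whose `n`-th derivative is the Legendre polynomial. -/
noncomputable def rodriguesPoly (n : ℕ) : ℝ[X] :=
  Polynomial.C (1 / (2 ^ n * (n.factorial : ℝ))) * ((Polynomial.X ^ 2 - 1) ^ n)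

/-- The `k`-th derivative of the `n`-th Legendre polynomial. -/
noncomputable def legendreDeriv (n k : ℕ) (x : ℝ) : ℝ :=
  (Polynomial.derivative^[k] (legendreP n)).eval x

lemma iterate_derivative_legendreP (n k : ℕ) :
    Polynomial.derivative^[k] (legendreP n) = Polynomial.derivative^[n + k] (rodriguesPoly n) := by
  rw [legendreP, rodriguesPoly, ← Polynomial.iterate_derivative_C_mul,
    ← Function.iterate_add_apply, add_comm]

lemma derivative_rodriguesPoly (n : ℕ) :
    Polynomial.derivative (rodriguesPoly (n + 1)) = Polynomial.X * rodriguesPoly n := by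
  have h : (Polynomial.C (1 / (2 ^ (n + 1) * ((n + 1).factorial : ℝ)))) * (2 * ((n : ℝ) + 1 : ℝ) • (1 : Polynomial ℝ))
      = Polynomial.C (1 / (2 ^ n * (n.factorial : ℝ))) := by
    have h2 : (2 * ((n : ℝ) + 1 : ℝ) • (1 : Polynomial ℝ)) = Polynomial.C (2 * ((n : ℝ) + 1)) := by
      rw [Polynomial.smul_eq_C_mul, mul_one, Polynomial.C_mul]; rfl
    rw [h2, ← Polynomial.C_mul]
    congr 1
    rw [Nat.factorial_succ]
    push_cast
    field_simp
    ring
  rw [rodriguesPoly, rodriguesPoly, Polynomial.derivative_C_mul, Polynomial.derivative_pow, ← h,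
    Polynomial.smul_eq_C_mul]
  simp
  ring

/-- Product rule together with `(X² - 1) F_n = 2 (n + 1) F_{n+1}`. Differentiating this identity
further yields the recurrences for all derivatives of Legendre polynomials at once. -/
lemma derivative_derivative_rodriguesPoly (n : ℕ) :
    Polynomial.derivative (Polynomial.derivative (rodriguesPoly (n + 2))) =
      Polynomial.C (2 * (n : ℝ) + 3) * rodriguesPoly (n + 1) + rodriguesPoly n := by
  have h : (Polynomial.X ^ 2 - 1) * rodriguesPoly n =
      Polynomial.C (2 * ((n : ℝ) + 1)) * rodriguesPoly (n + 1) := by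
    have : 1 / (2 ^ n * (n.factorial : ℝ)) =
        2 * ((n : ℝ) + 1) * (1 / (2 ^ (n + 1) * ((n + 1).factorial : ℝ))) := by
      rw [Nat.factorial_succ]
      push_cast
      field_simp
      ring
    rw [rodriguesPoly, rodriguesPoly, this, Polynomial.C_mul]
    ring
  rw [derivative_rodriguesPoly, Polynomial.derivative_mul, derivative_rodriguesPoly,
    Polynomial.derivative_X]
  have h3 : Polynomial.C (2 * (n : ℝ) + 3) = Polynomial.C (2 * ((n : ℝ) + 1)) + 1 := by
    rw [← Polynomial.C_1, ← Polynomial.C_add]; congr 1; ring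
  rw [h3, add_mul, ← h]
  ring

lemma iterate_derivative_X_mul (p : Polynomial ℝ) (k : ℕ) :
    Polynomial.derivative^[k + 1] (Polynomial.X * p) =
      Polynomial.X * Polynomial.derivative^[k + 1] p +
        ((k + 1 : ℕ) : Polynomial ℝ) * Polynomial.derivative^[k] p := by
  induction k with
  | zero => simp [Polynomial.derivative_mul]; ring
  | succ k ih =>
    rw [Function.iterate_succ_apply', ih]
    simp only [Polynomial.derivative_add, Polynomial.derivative_mul, Polynomial.derivative_X,
      Polynomial.derivative_natCast, ← Function.iterate_succ_apply' (f := Polynomial.derivative)]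
    push_cast
    ring

lemma legendreDeriv_succ_succ_sub (n k : ℕ) (x : ℝ) :
    legendreDeriv (n + 2) (k + 1) x - legendreDeriv n (k + 1) x =
      (2 * n + 3) * legendreDeriv (n + 1) k x := by
  simp only [legendreDeriv, iterate_derivative_legendreP]
  have h : Polynomial.derivative^[n + 2 + (k + 1)] (rodriguesPoly (n + 2)) =
      Polynomial.derivative^[n + 1 + k] (Polynomial.C (2 * (n : ℝ) + 3) * rodriguesPoly (n + 1) + rodriguesPoly n) := by
    rw [← derivative_derivative_rodriguesPoly, ← Function.iterate_succ_apply,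
      ← Function.iterate_succ_apply]
    congr 2; omega
  rw [h, iterate_map_add, Polynomial.iterate_derivative_C_mul,
    show n + (k + 1) = n + 1 + k by omega]
  simp

/-- The derivative of order `n + 2 + k` of `F_{n+2}` is computed in two ways, from the
second-derivative identity and by the Leibniz rule for `X F_{n+1}`; the derivative of `F_{n+1}` of
order `n + k` is then eliminated. -/
lemma legendreDeriv_recurrence (n k : ℕ) (x : ℝ) :
    ((n : ℝ) + 2 - k) * legendreDeriv (n + 2) k x =
      (2 * n + 3) * x * legendreDeriv (n + 1) k x - (n + 1 + k) * legendreDeriv n k x := by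
  simp only [legendreDeriv, iterate_derivative_legendreP]
  have h1 : Polynomial.derivative^[n + 2 + k] (rodriguesPoly (n + 2)) =
      Polynomial.derivative^[n + k] (Polynomial.C (2 * (n : ℝ) + 3) * rodriguesPoly (n + 1) + rodriguesPoly n) := by
    rw [← derivative_derivative_rodriguesPoly, ← Function.iterate_succ_apply,
      ← Function.iterate_succ_apply]
    congr 2; omega
  have h2 : Polynomial.derivative^[n + 2 + k] (rodriguesPoly (n + 2)) =
      Polynomial.X * Polynomial.derivative^[n + 1 + k] (rodriguesPoly (n + 1)) +
        ((n + k + 1 : ℕ) : Polynomial ℝ) * Polynomial.derivative^[n + k] (rodriguesPoly (n + 1)) := by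
    rw [show n + 2 + k = (n + k + 1) + 1 by omega, Function.iterate_succ_apply,
      derivative_rodriguesPoly, iterate_derivative_X_mul,
      show n + 1 + k = n + k + 1 by omega]
  rw [iterate_map_add, Polynomial.iterate_derivative_C_mul] at h1
  have e1 := congrArg (Polynomial.eval x) h1
  have e2 := congrArg (Polynomial.eval x) h2
  simp only [Polynomial.eval_add, Polynomial.eval_mul, Polynomial.eval_C, Polynomial.eval_X,
    Polynomial.eval_natCast] at e1 e2
  push_cast at e2
  linear_combination (2 * (n : ℝ) + 3) * e2 - (n + 1 + k : ℝ) * e1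

/-- With `z = x + w` and `x² - 1 = -s² = -w w̄`, one has `z² - 1 = w (2 x + 2 i Im w)`, and the
second factor has modulus at most `2 √(x² + s²) = 2`. -/
lemma norm_sq_sub_one_le {x s : ℝ} (hs : 0 < s) (hxs : x ^ 2 + s ^ 2 = 1) {z : ℂ}
    (hz : ‖z - x‖ = s) : ‖z ^ 2 - 1‖ ≤ 2 * s := by
  obtain ⟨w, rfl⟩ : ∃ w : ℂ, z = x + w := ⟨z - x, by ring⟩
  rw [add_sub_cancel_left] at hz
  have hw : w * (starRingEnd ℂ) w = (s : ℂ) ^ 2 := by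
    rw [Complex.mul_conj, Complex.normSq_eq_norm_sq, hz]; push_cast; ring
  have hxs' : (x : ℂ) ^ 2 + (s : ℂ) ^ 2 = 1 := by exact_mod_cast hxs
  have e : ((x : ℂ) + w) ^ 2 - 1 = w * (w - (starRingEnd ℂ) w + 2 * x) := by
    linear_combination hw + hxs'
  rw [e, norm_mul, hz, mul_comm]
  refine mul_le_mul_of_nonneg_right ?_ hs.le
  have h1 : w - (starRingEnd ℂ) w + 2 * x = ⟨2 * x, 2 * w.im⟩ := by
    apply Complex.ext <;> simp; ring
  have h2 : |w.im| ≤ s := hz ▸ Complex.abs_im_le_norm w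
  rw [h1]
  apply le_of_sq_le_sq _ (by norm_num)
  rw [Complex.sq_norm, Complex.normSq_mk]
  nlinarith [sq_abs w.im, abs_nonneg w.im]

/-- Cauchy's estimate for the derivative of order `n + k` of `(z² - 1) ^ n` on the circle of radius
`s` about `x`: the factor `(2 s) ^ n` cancels against `2 ^ n` and `s ^ (n + k)`. -/
lemma abs_pow_mul_legendreDeriv_le (n k : ℕ) {x s : ℝ} (hs : 0 < s) (hxs : x ^ 2 + s ^ 2 = 1) :
    s ^ k * |legendreDeriv n k x| ≤ ((n + k).factorial : ℝ) / n.factorial := by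
  have hc : Differentiable ℂ (fun z : ℂ => (z ^ 2 - 1) ^ n) := by fun_prop
  have hb := Complex.norm_iteratedDeriv_le_of_forall_mem_sphere_norm_le (n + k) (c := (x : ℂ))
    (f := fun z : ℂ => (z ^ 2 - 1) ^ n) (C := (2 * s) ^ n) hs hc.diffContOnCl (by
      intro z hz
      rw [norm_pow]
      exact pow_le_pow_left₀ (norm_nonneg _)
        (norm_sq_sub_one_le hs hxs (by simpa [dist_eq_norm] using hz)) _)
  have e : iteratedDeriv (n + k) (fun z : ℂ => (z ^ 2 - 1) ^ n) x =
      ((2 ^ n * n.factorial * legendreDeriv n k x : ℝ) : ℂ) := by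
    have h1 : (fun z : ℂ => (z ^ 2 - 1) ^ n) =
        fun z => Polynomial.aeval z ((Polynomial.X ^ 2 - 1) ^ n : Polynomial ℝ) := by
      ext z; simp
    have h2 : ∀ (m : ℕ) (P : Polynomial ℝ), iteratedDeriv m (fun z : ℂ => Polynomial.aeval z P) =
        fun z => Polynomial.aeval z (Polynomial.derivative^[m] P) := by
      intro m
      induction m with
      | zero => intro P; simp
      | succ m ih =>
        intro P
        rw [iteratedDeriv_succ']
        have : deriv (fun z : ℂ => Polynomial.aeval z P) =
            fun z => Polynomial.aeval z (Polynomial.derivative P) := by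
          ext z; exact Polynomial.deriv_aeval P
        rw [this, ih, Function.iterate_succ_apply]
    rw [h1, h2, legendreDeriv, iterate_derivative_legendreP, rodriguesPoly,
      Polynomial.iterate_derivative_C_mul]
    have : ∀ Q : Polynomial ℝ, Polynomial.aeval (x : ℂ) Q = ((Q.eval x : ℝ) : ℂ) := by
      intro Q
      have := Polynomial.aeval_algebraMap_apply ℂ x Q
      simpa using this
    beta_reduce
    rw [this, Polynomial.eval_mul, Polynomial.eval_C]
    congr 1
    field_simp
  rw [e, Complex.norm_real, Real.norm_eq_abs, abs_mul, abs_of_nonneg (by positivity)] at hb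
  rw [le_div_iff₀ (by positivity)] at hb ⊢
  have h2 : (0 : ℝ) < (2 * s) ^ n := by positivity
  refine le_of_mul_le_mul_left ?_ h2
  calc (2 * s) ^ n * (s ^ k * |legendreDeriv n k x| * n.factorial)
      = 2 ^ n * n.factorial * |legendreDeriv n k x| * s ^ (n + k) := by
        rw [mul_pow, pow_add]; ring
    _ ≤ _ := hb
    _ = _ := by ring

lemma abs_assocLegendreNat_le (n k : ℕ) {x : ℝ} (hx : x ∈ Icc (-1 : ℝ) 1) :
    |assocLegendreNat n k x| ≤ ((n + k).factorial : ℝ) / n.factorial := by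
  have hin : ∀ y ∈ Ioo (-1 : ℝ) 1, |assocLegendreNat n k y| ≤ ((n + k).factorial : ℝ) / n.factorial := by
    intro y hy
    have hp : 0 < 1 - y ^ 2 := by nlinarith [hy.1, hy.2]
    have := abs_pow_mul_legendreDeriv_le n k (x := y) (s := √(1 - y ^ 2)) (Real.sqrt_pos.2 hp)
      (by rw [Real.sq_sqrt hp.le]; ring)
    rwa [assocLegendreNat, abs_mul, abs_of_nonneg (by positivity)]
  have hcont : Continuous (fun y => |assocLegendreNat n k y|) := by
    unfold assocLegendreNat
    fun_prop
  -- The radius of the Cauchy circle degenerates at `±1`, so the end points are reached by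
  -- continuity.
  have hcl : IsClosed {y | |assocLegendreNat n k y| ≤ ((n + k).factorial : ℝ) / n.factorial} :=
    isClosed_le hcont continuous_const
  have := hcl.closure_subset_iff.2 hin
  rw [closure_Ioo (by norm_num)] at this
  exact this hx

/-! ### Symbol calculus for coefficient sequences -/

/-- Families of sequences `a N` whose `i`-th forward differences, `i ≤ m`, are
`O(N ^ (r - i))` on the range `N ≤ 4 n`, uniformly in `N > N₀`. -/
def IsSymbol (N₀ : ℕ) : ℕ → ℤ → (ℕ → ℕ → ℝ) → Prop
  | 0, r, a => ∃ C : ℝ, ∀ N, N₀ < N → ∀ n, N ≤ 4 * n → |a N n| ≤ C * (N : ℝ) ^ r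
  | m + 1, r, a => (∃ C : ℝ, ∀ N, N₀ < N → ∀ n, N ≤ 4 * n → |a N n| ≤ C * (N : ℝ) ^ r) ∧
      IsSymbol N₀ m (r - 1) (fun N n => a N (n + 1) - a N n)

namespace IsSymbol

variable {N₀ m : ℕ} {r s : ℤ} {a b : ℕ → ℕ → ℝ}

lemma bound (h : IsSymbol N₀ m r a) :
    ∃ C : ℝ, ∀ N, N₀ < N → ∀ n, N ≤ 4 * n → |a N n| ≤ C * (N : ℝ) ^ r := by
  cases m with
  | zero => exact h
  | succ m => exact h.1

lemma bound_nonneg (h : IsSymbol N₀ m r a) :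
    ∃ C : ℝ, 0 ≤ C ∧ ∀ N, N₀ < N → ∀ n, N ≤ 4 * n → |a N n| ≤ C * (N : ℝ) ^ r := by
  obtain ⟨C, hC⟩ := h.bound
  refine ⟨|C|, abs_nonneg _, fun N hN n hn => (hC N hN n hn).trans ?_⟩
  gcongr
  exact le_abs_self C

lemma of_succ (h : IsSymbol N₀ (m + 1) r a) : IsSymbol N₀ m r a := by
  induction m generalizing r a with
  | zero => exact h.1
  | succ m ih => exact ⟨h.1, ih h.2⟩

lemma congr (h : IsSymbol N₀ m r a) (hab : ∀ N, N₀ < N → ∀ n, N ≤ 4 * n → a N n = b N n) :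
    IsSymbol N₀ m r b := by
  have key : ∀ {r : ℤ} {a b : ℕ → ℕ → ℝ},
      (∃ C : ℝ, ∀ N, N₀ < N → ∀ n, N ≤ 4 * n → |a N n| ≤ C * (N : ℝ) ^ r) →
      (∀ N, N₀ < N → ∀ n, N ≤ 4 * n → a N n = b N n) →
      (∃ C : ℝ, ∀ N, N₀ < N → ∀ n, N ≤ 4 * n → |b N n| ≤ C * (N : ℝ) ^ r) := by
    rintro r a b ⟨C, hC⟩ hab
    exact ⟨C, fun N hN n hn => hab N hN n hn ▸ hC N hN n hn⟩
  induction m generalizing r a b with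
  | zero => exact key h hab
  | succ m ih =>
    refine ⟨key h.1 hab, ih h.2 fun N hN n hn => ?_⟩
    rw [hab N hN n hn, hab N hN (n + 1) (by omega)]

lemma mono (hrs : r ≤ s) (h : IsSymbol N₀ m r a) : IsSymbol N₀ m s a := by
  have key : ∀ {r s : ℤ} {a : ℕ → ℕ → ℝ}, r ≤ s →
      (∃ C : ℝ, ∀ N, N₀ < N → ∀ n, N ≤ 4 * n → |a N n| ≤ C * (N : ℝ) ^ r) →
      (∃ C : ℝ, ∀ N, N₀ < N → ∀ n, N ≤ 4 * n → |a N n| ≤ C * (N : ℝ) ^ s) := by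
    rintro r s a hrs ⟨C, hC⟩
    refine ⟨|C|, fun N hN n hn => (hC N hN n hn).trans ?_⟩
    have : (1 : ℝ) ≤ N := by exact_mod_cast (by omega : 1 ≤ N)
    gcongr
    exact le_abs_self C
  induction m generalizing r s a with
  | zero => exact key hrs h
  | succ m ih => exact ⟨key hrs h.1, ih (by omega) h.2⟩

lemma add (ha : IsSymbol N₀ m r a) (hb : IsSymbol N₀ m r b) :
    IsSymbol N₀ m r (fun N n => a N n + b N n) := by
  have key : ∀ {r : ℤ} {a b : ℕ → ℕ → ℝ},
      (∃ C : ℝ, ∀ N, N₀ < N → ∀ n, N ≤ 4 * n → |a N n| ≤ C * (N : ℝ) ^ r) →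
      (∃ C : ℝ, ∀ N, N₀ < N → ∀ n, N ≤ 4 * n → |b N n| ≤ C * (N : ℝ) ^ r) →
      (∃ C : ℝ, ∀ N, N₀ < N → ∀ n, N ≤ 4 * n → |a N n + b N n| ≤ C * (N : ℝ) ^ r) := by
    rintro r a b ⟨C, hC⟩ ⟨D, hD⟩
    refine ⟨C + D, fun N hN n hn => (abs_add_le _ _).trans ?_⟩
    rw [add_mul]
    exact add_le_add (hC N hN n hn) (hD N hN n hn)
  induction m generalizing r a b with
  | zero => exact key ha hb
  | succ m ih =>
    refine ⟨key ha.1 hb.1, (ih ha.2 hb.2).congr fun N _ n _ => by ring⟩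

lemma shift (ha : IsSymbol N₀ m r a) : IsSymbol N₀ m r (fun N n => a N (n + 1)) := by
  have key : ∀ {r : ℤ} {a : ℕ → ℕ → ℝ},
      (∃ C : ℝ, ∀ N, N₀ < N → ∀ n, N ≤ 4 * n → |a N n| ≤ C * (N : ℝ) ^ r) →
      (∃ C : ℝ, ∀ N, N₀ < N → ∀ n, N ≤ 4 * n → |a N (n + 1)| ≤ C * (N : ℝ) ^ r) := by
    rintro r a ⟨C, hC⟩
    exact ⟨C, fun N hN n hn => hC N hN (n + 1) (by omega)⟩
  induction m generalizing r a with
  | zero => exact key ha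
  | succ m ih => exact ⟨key ha.1, ih ha.2⟩

lemma diff (ha : IsSymbol N₀ (m + 1) r a) :
    IsSymbol N₀ m (r - 1) (fun N n => a N (n + 1) - a N n) := ha.2

lemma mul (ha : IsSymbol N₀ m r a) (hb : IsSymbol N₀ m s b) :
    IsSymbol N₀ m (r + s) (fun N n => a N n * b N n) := by
  have key : ∀ {m : ℕ} {r s : ℤ} {a b : ℕ → ℕ → ℝ}, IsSymbol N₀ m r a → IsSymbol N₀ m s b →
      (∃ C : ℝ, ∀ N, N₀ < N → ∀ n, N ≤ 4 * n → |a N n * b N n| ≤ C * (N : ℝ) ^ (r + s)) := by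
    intro m r s a b ha hb
    obtain ⟨C, hC0, hC⟩ := ha.bound_nonneg
    obtain ⟨D, hD0, hD⟩ := hb.bound_nonneg
    refine ⟨C * D, fun N hN n hn => ?_⟩
    have hN' : (N : ℝ) ≠ 0 := by exact_mod_cast (by omega : N ≠ 0)
    rw [abs_mul, zpow_add₀ hN', mul_mul_mul_comm]
    exact mul_le_mul (hC N hN n hn) (hD N hN n hn) (abs_nonneg _) (by positivity)
  induction m generalizing r s a b with
  | zero => exact key ha hb
  | succ m ih =>
    refine ⟨key ha hb, ?_⟩
    have h1 := ih ha.diff hb.of_succ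
    have h2 := ih ha.of_succ.shift hb.diff
    rw [show r - 1 + s = r + s - 1 by ring] at h1
    rw [show r + (s - 1) = r + s - 1 by ring] at h2
    exact (h1.add h2).congr fun N _ n _ => by ring

lemma const (c : ℝ) : IsSymbol N₀ m 0 (fun _ _ => c) := by
  have h0 : ∀ {m : ℕ} {r : ℤ}, IsSymbol N₀ m r (fun _ _ => 0) := by
    intro m
    induction m with
    | zero => intro r; exact ⟨0, by simp⟩
    | succ m ih => intro r; exact ⟨⟨0, by simp⟩, by simpa using ih⟩
  cases m with
  | zero => exact ⟨|c|, by simp⟩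
  | succ m => exact ⟨⟨|c|, by simp⟩, by simpa using h0⟩

lemma const_mul (c : ℝ) (ha : IsSymbol N₀ m r a) : IsSymbol N₀ m r (fun N n => c * a N n) := by
  simpa using (const c).mul ha

/-- Since `n ≥ N / 4` and `c ≥ -N / 8`, the denominator is at least `N / 8`. The difference of the
reciprocals is minus the product of two neighbours, which drives the induction. -/
lemma inv_natCast_add {c : ℝ} (hc : -((N₀ : ℝ) / 8) ≤ c) :
    IsSymbol N₀ m (-1) (fun _ n => ((n : ℝ) + c)⁻¹) := by
  have hpos : ∀ N : ℕ, N₀ < N → ∀ n : ℕ, N ≤ 4 * n → (N : ℝ) / 8 ≤ n + c ∧ (0 : ℝ) < N := by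
    intro N hN n hn
    have h1 : (N₀ : ℝ) < N := by exact_mod_cast hN
    have h2 : (N : ℝ) ≤ 4 * n := by exact_mod_cast hn
    have h3 : (0 : ℝ) ≤ N₀ := by positivity
    constructor <;> linarith
  have key : ∃ C : ℝ, ∀ N, N₀ < N → ∀ n : ℕ, N ≤ 4 * n →
      |((n : ℝ) + c)⁻¹| ≤ C * (N : ℝ) ^ (-1 : ℤ) := by
    refine ⟨8, fun N hN n hn => ?_⟩
    obtain ⟨h1, h2⟩ := hpos N hN n hn
    rw [abs_inv, abs_of_pos (by linarith), zpow_neg_one, inv_le_comm₀ (by linarith) (by positivity),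
      mul_inv, inv_inv]
    linarith
  induction m with
  | zero => exact key
  | succ m ih =>
    refine ⟨key, ?_⟩
    have := (ih.mul ih.shift).const_mul (-1)
    refine this.congr fun N hN n hn => ?_
    obtain ⟨h1, h2⟩ := hpos N hN n hn
    have h3 : (n : ℝ) + c ≠ 0 := by linarith
    have h4 : (n : ℝ) + 1 + c ≠ 0 := by linarith
    push_cast
    field_simp
    ring

lemma inv (ha : IsSymbol N₀ m 0 a) (h1 : ∀ N, N₀ < N → ∀ n, N ≤ 4 * n → 1 ≤ a N n) :
    IsSymbol N₀ m 0 (fun N n => (a N n)⁻¹) := by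
  have key : ∃ C : ℝ, ∀ N, N₀ < N → ∀ n, N ≤ 4 * n → |(a N n)⁻¹| ≤ C * (N : ℝ) ^ (0 : ℤ) := by
    refine ⟨1, fun N hN n hn => ?_⟩
    have := h1 N hN n hn
    rw [abs_inv, abs_of_pos (by linarith)]
    simpa using inv_le_one_of_one_le₀ this
  induction m with
  | zero => exact key
  | succ m ih =>
    refine ⟨key, ?_⟩
    have hi := ih ha.of_succ
    refine (((hi.mul hi.shift).mul ha.diff).const_mul (-1)).congr fun N hN n hn => ?_
    have e1 := h1 N hN n hn
    have e2 := h1 N hN (n + 1) (by omega)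
    have h3 : a N n ≠ 0 := by linarith
    have h4 : a N (n + 1) ≠ 0 := by linarith
    field_simp
    ring

/-- `Δ√a = Δa / (√a + √a⁺)`, with a denominator bounded below by `1`, to which `inv` applies. -/
lemma sqrt (ha : IsSymbol N₀ m 0 a) (h1 : ∀ N, N₀ < N → ∀ n, N ≤ 4 * n → 1 ≤ a N n) :
    IsSymbol N₀ m 0 (fun N n => √(a N n)) := by
  have key : ∃ C : ℝ, ∀ N, N₀ < N → ∀ n, N ≤ 4 * n → |√(a N n)| ≤ C * (N : ℝ) ^ (0 : ℤ) := by
    obtain ⟨C, hC⟩ := ha.bound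
    refine ⟨C, fun N hN n hn => ?_⟩
    refine le_trans ?_ (hC N hN n hn)
    have := h1 N hN n hn
    rw [abs_of_nonneg (Real.sqrt_nonneg _), abs_of_pos (by linarith), Real.sqrt_le_left (by linarith)]
    nlinarith
  induction m with
  | zero => exact key
  | succ m ih =>
    refine ⟨key, ?_⟩
    have hi := ih ha.of_succ
    have hs : ∀ N, N₀ < N → ∀ n, N ≤ 4 * n → 1 ≤ √(a N n) := fun N hN n hn =>
      Real.one_le_sqrt.2 (h1 N hN n hn)
    have hinv := (hi.add hi.shift).inv fun N hN n hn => by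
      have := hs N hN n hn
      have := hs N hN (n + 1) (by omega)
      linarith
    have hm := ha.diff.mul hinv
    rw [add_zero] at hm
    refine hm.congr fun N hN n hn => ?_
    have e1 := hs N hN n hn
    have e2 := hs N hN (n + 1) (by omega)
    have q1 := Real.sq_sqrt (show 0 ≤ a N n by linarith [h1 N hN n hn])
    have q2 := Real.sq_sqrt (show 0 ≤ a N (n + 1) by linarith [h1 N hN (n + 1) (by omega)])
    have h3 : √(a N n) + √(a N (n + 1)) ≠ 0 := by linarith
    field_simp
    rw [← q1, ← q2]
    simp only [Real.sqrt_sq (Real.sqrt_nonneg _)]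
    ring

lemma finset_prod {ι : Type*} (t : Finset ι) {f : ι → ℕ → ℕ → ℝ}
    (h : ∀ i ∈ t, IsSymbol N₀ m 0 (f i)) : IsSymbol N₀ m 0 (fun N n => ∏ i ∈ t, f i N n) := by
  classical
  induction t using Finset.induction_on with
  | empty => simpa using const 1
  | insert i t hi ih =>
    have := (h i (by simp)).mul (ih fun j hj => h j (by simp [hj]))
    rw [add_zero] at this
    exact this.congr fun N _ n _ => by rw [Finset.prod_insert hi]

end IsSymbol

/-- The forward difference of `f_N(n / N)` is again a sample, namely of `f_N(t + 1/N) - f_N(t)`,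
whose derivatives are smaller by `1 / N` by the mean value inequality. The function has to depend on
`N` for this induction to close. -/
lemma isSymbol_of_bounded_deriv (m : ℕ) {N₀ : ℕ} {f : ℕ → ℝ → ℝ} {B : ℝ} {r : ℤ}
    (hf : ∀ N, ContDiff ℝ m (f N))
    (hB : ∀ N, N₀ < N → ∀ i ≤ m, ∀ t, |iteratedDeriv i (f N) t| ≤ B * (N : ℝ) ^ r) :
    IsSymbol N₀ m r (fun N n => f N ((n : ℝ) / N)) := by
  have key : ∃ C : ℝ, ∀ N, N₀ < N → ∀ n : ℕ, N ≤ 4 * n → |f N ((n : ℝ) / N)| ≤ C * (N : ℝ) ^ r :=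
    ⟨B, fun N hN n _ => by simpa using hB N hN 0 (Nat.zero_le _) ((n : ℝ) / N)⟩
  induction m generalizing f r with
  | zero => exact key
  | succ m ih =>
    refine ⟨key, ?_⟩
    have hf' : ∀ N, ContDiff ℝ (m : ℕ) (f N) := fun N => (hf N).of_le (by norm_cast; omega)
    have := ih (f := fun N t => f N (t + 1 / N) - f N t) (r := r - 1) (fun N => by
      have := hf' N
      fun_prop) (by
      intro N hN i hi t
      have hNpos : (0 : ℝ) < N := by exact_mod_cast (by omega : 0 < N)
      have h1 : iteratedDeriv i (fun t => f N (t + 1 / N) - f N t) t =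
          iteratedDeriv i (f N) (t + 1 / N) - iteratedDeriv i (f N) t := by
        have hc1 : ContDiff ℝ i (f N) := (hf N).of_le (by norm_cast; omega)
        have hc2 : ContDiff ℝ i (fun t => f N (t + 1 / N)) := by fun_prop
        have := iteratedDeriv_fun_sub (x := t) hc2.contDiffAt hc1.contDiffAt
        rw [this, iteratedDeriv_comp_add_const]
      have hd : ∀ s ∈ (univ : Set ℝ), HasDerivWithinAt (iteratedDeriv i (f N))
          (iteratedDeriv (i + 1) (f N) s) univ s := by
        intro s _
        have := (hf N).differentiable_iteratedDeriv i (by norm_cast; omega)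
        rw [iteratedDeriv_succ]
        exact (this s).hasDerivAt.hasDerivWithinAt
      have := convex_univ.norm_image_sub_le_of_norm_hasDerivWithin_le hd
        (fun s _ => hB N hN (i + 1) (by omega) s) (mem_univ t) (mem_univ (t + 1 / N))
      rw [h1]
      refine this.trans (le_of_eq ?_)
      rw [add_sub_cancel_left, Real.norm_of_nonneg (by positivity), zpow_sub_one₀ hNpos.ne']
      ring) ⟨B, by
        intro N hN n hn
        have hNpos : (0 : ℝ) < N := by exact_mod_cast (by omega : 0 < N)
        have hd : ∀ s ∈ (univ : Set ℝ), HasDerivWithinAt (f N)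
            (iteratedDeriv 1 (f N) s) univ s := by
          intro s _
          rw [iteratedDeriv_one]
          exact ((hf N).differentiable (by norm_cast) s).hasDerivAt.hasDerivWithinAt
        have := convex_univ.norm_image_sub_le_of_norm_hasDerivWithin_le hd
          (fun s _ => hB N hN 1 (by omega) s) (mem_univ ((n : ℝ) / N)) (mem_univ ((n : ℝ) / N + 1 / N))
        refine this.trans (le_of_eq ?_)
        rw [add_sub_cancel_left, Real.norm_of_nonneg (by positivity), zpow_sub_one₀ hNpos.ne']
        ring⟩
    refine this.congr fun N hN n hn => ?_
    have hNpos : (0 : ℝ) < N := by exact_mod_cast (by omega : 0 < N)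
    push_cast
    rw [add_div]

/-! ### Summation by parts with the three-term recurrence -/

/-- The associated Legendre function divided by its sup bound `(n + k)! / n!`. -/
noncomputable def legendreQ (k n : ℕ) (x : ℝ) : ℝ :=
  (n.factorial : ℝ) / (n + k).factorial * assocLegendreNat n k x

lemma abs_legendreQ_le (k n : ℕ) {x : ℝ} (hx : x ∈ Icc (-1 : ℝ) 1) : |legendreQ k n x| ≤ 1 := by
  have h := abs_assocLegendreNat_le n k hx
  rw [legendreQ, abs_mul, abs_of_nonneg (by positivity)]
  calc (n.factorial : ℝ) / (n + k).factorial * |assocLegendreNat n k x|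
      ≤ (n.factorial : ℝ) / (n + k).factorial * (((n + k).factorial : ℝ) / n.factorial) := by gcongr
    _ = 1 := by field_simp

/-- In this normalization the coefficients of the two neighbours add up to `2 n + 3` except for `k²
/ (n + 2)`, so `1 - x` acts like a second difference with a correction of relative size `n ^ (-2)`.
-/
lemma legendreQ_recurrence (k n : ℕ) (x : ℝ) :
    (2 * (n : ℝ) + 3) * (1 - x) * legendreQ k (n + 1) x =
      (2 * n + 3) * legendreQ k (n + 1) x - (n + 1) * legendreQ k n x -
        ((n + 2) - (k : ℝ) ^ 2 / (n + 2)) * legendreQ k (n + 2) x := by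
  have h := legendreDeriv_recurrence n k x
  have e : ∀ n, assocLegendreNat n k x = √(1 - x ^ 2) ^ k * legendreDeriv n k x := fun _ => rfl
  have f1 : ((n + 1 + k).factorial : ℝ) = (n + 1 + k) * (n + k).factorial := by
    rw [show n + 1 + k = (n + k) + 1 by omega, Nat.factorial_succ]; push_cast; ring
  have f2 : ((n + 2 + k).factorial : ℝ) = (n + 2 + k) * ((n + 1 + k) * (n + k).factorial) := by
    rw [show n + 2 + k = (n + k) + 1 + 1 by omega, Nat.factorial_succ, Nat.factorial_succ]
    push_cast; ring
  have f3 : ((n + 1).factorial : ℝ) = (n + 1) * n.factorial := by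
    rw [Nat.factorial_succ]; push_cast; ring
  have f4 : ((n + 2).factorial : ℝ) = (n + 2) * ((n + 1) * n.factorial) := by
    rw [show n + 2 = n + 1 + 1 by omega, Nat.factorial_succ, Nat.factorial_succ]; push_cast; ring
  simp only [legendreQ, e, f1, f2, f3, f4]
  have h1 : ((n : ℝ) + 1 + k) ≠ 0 := by positivity
  have h2 : ((n : ℝ) + 2 + k) ≠ 0 := by positivity
  field_simp
  linear_combination ((n : ℝ) + 2 + k) * (√(1 - x ^ 2) ^ k) * h

/-- One step of the summation by parts that corresponds to multiplication by `1 - x`. -/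
noncomputable def legendreStep (k i : ℕ) (a : ℕ → ℕ → ℝ) (N n : ℕ) : ℝ :=
  -(1 / 2) * (a N (n + 1 + 1) - a N (n + 1) - (a N (n + 1) - a N n)) +
    (-(1 / 4)) * (((n : ℝ) + (i + 3 / 2))⁻¹ * (a N (n + 1 + 1) - a N (n + 1) + (a N (n + 1) - a N n))) +
    (k : ℝ) ^ 2 / 2 * (((n : ℝ) + (i + 1))⁻¹ * (((n : ℝ) + (i + 3 / 2))⁻¹ * a N n))

/-- Each of the three terms gains two orders: two differences, one difference and one reciprocal, or
two reciprocals. -/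
lemma IsSymbol.legendreStep {N₀ m : ℕ} {r : ℤ} {a : ℕ → ℕ → ℝ} (k i : ℕ)
    (ha : IsSymbol N₀ (m + 2) r a) : IsSymbol N₀ m (r - 2) (legendreStep k i a) := by
  have hc : ∀ c : ℝ, 0 ≤ c → -((N₀ : ℝ) / 8) ≤ c := fun c hc => by
    have : (0 : ℝ) ≤ N₀ := by positivity
    linarith
  have h1 := (ha.diff.diff).const_mul (-(1 / 2))
  have h2 := ((IsSymbol.inv_natCast_add (N₀ := N₀) (m := m) (hc ((i : ℝ) + 3 / 2) (by positivity))).mul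
    (ha.diff.of_succ.shift.add ha.diff.of_succ)).const_mul (-(1 / 4))
  have h3 := ((IsSymbol.inv_natCast_add (N₀ := N₀) (m := m) (hc ((i : ℝ) + 1) (by positivity))).mul
    ((IsSymbol.inv_natCast_add (N₀ := N₀) (m := m) (hc ((i : ℝ) + 3 / 2) (by positivity))).mul
      ha.of_succ.of_succ)).const_mul ((k : ℝ) ^ 2 / 2)
  rw [show r - 1 - 1 = r - 2 by ring] at h1
  rw [show -1 + (r - 1) = r - 2 by ring] at h2
  rw [show -1 + (-1 + r) = r - 2 by ring] at h3
  exact (h1.add h2).add h3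

/-- The family `a N` is supported in `[N / 2 - l, 2 N]`. -/
def SuppIn (l : ℕ) (a : ℕ → ℕ → ℝ) : Prop :=
  ∀ N n, 2 * (n + l) < N ∨ 2 * N < n → a N n = 0

lemma SuppIn.legendreStep {l : ℕ} {a : ℕ → ℕ → ℝ} (ha : SuppIn l a) (k i : ℕ) :
    SuppIn (l + 2) (legendreStep k i a) := by
  intro N n h
  rw [SphereEdge.legendreStep, ha N n (by omega), ha N (n + 1) (by omega), ha N (n + 1 + 1) (by omega)]
  simp

/-- The coefficient `a N n` belongs to degree `n + i`. Raising the offset to `i + 1` lets the new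
coefficient use only the forward values `a N n`, `a N (n + 1)`, `a N (n + 2)`. -/
lemma one_sub_mul_sum_legendreQ (k i : ℕ) (a : ℕ → ℕ → ℝ) (N M : ℕ) (x : ℝ)
    (h0 : a N 0 = 0) (h1 : a N 1 = 0) (hM : ∀ n, M ≤ n → a N n = 0) :
    (1 - x) * ∑ n ∈ Finset.range M, (2 * ((n + i : ℕ) : ℝ) + 1) * a N n * legendreQ k (n + i) x =
      ∑ n ∈ Finset.range M, (2 * ((n + (i + 1) : ℕ) : ℝ) + 1) * legendreStep k i a N n *
        legendreQ k (n + (i + 1)) x := by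
  -- Partial sums telescope up to two boundary terms at the upper end, which vanish once `M` exceeds
  -- the support; `h0` and `h1` remove the lower end.
  have key : ∀ M : ℕ,
      (1 - x) * ∑ n ∈ Finset.range M, (2 * ((n + 1 + i : ℕ) : ℝ) + 1) * a N (n + 1) * legendreQ k (n + 1 + i) x -
      ∑ n ∈ Finset.range M, (2 * ((n + (i + 1) : ℕ) : ℝ) + 1) * legendreStep k i a N n *
        legendreQ k (n + (i + 1)) x =
      ((M : ℝ) + i + 1) * a N (M + 1) * legendreQ k (M + i) x
        - (((M : ℝ) + i + 1) - (k : ℝ) ^ 2 / ((M : ℝ) + i + 1)) * a N M * legendreQ k (M + i + 1) x := by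
    intro M
    induction M with
    | zero => simp [h0, h1]
    | succ M ih =>
      have hr := legendreQ_recurrence k (M + i) x
      have e1 : M + (i + 1) = M + i + 1 := by omega
      have e2 : M + 1 + i = M + i + 1 := by omega
      rw [Finset.sum_range_succ, Finset.sum_range_succ, mul_add, legendreStep]
      have p1 : ((M : ℝ) + i + 1) ≠ 0 := by positivity
      have p3 : ((M : ℝ) + (i + 1)) ≠ 0 := by positivity
      have p4 : ((M : ℝ) + (i + 3 / 2)) ≠ 0 := by positivity
      have p5 : ((M : ℝ) + 1 + i + 1) ≠ 0 := by positivity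
      have p6 : ((M : ℝ) + i + 2) ≠ 0 := by positivity
      simp only [e1, e2] at ih ⊢
      push_cast at hr ih ⊢
      have e3 : ((M : ℝ) + 1 + i + 1) = (M : ℝ) + i + 2 := by ring
      have e5 : (2 * ((M : ℝ) + i + 1) + 1) = 2 * ((M : ℝ) + (i + 3 / 2)) := by ring
      have e6 : ((M : ℝ) + (i + 1)) = (M : ℝ) + i + 1 := by ring
      rw [e3]
      -- Multiplied by `2 μ + 1` with `μ = M + i + 1`, the step is exactly the transposed
      -- recurrence; its definition is this expression sorted by order of decay.
      have hstep : (2 * ((M : ℝ) + i + 1) + 1) *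
          (-(1 / 2) * (a N (M + 1 + 1) - a N (M + 1) - (a N (M + 1) - a N M)) +
            (-(1 / 4)) * (((M : ℝ) + (i + 3 / 2))⁻¹ * (a N (M + 1 + 1) - a N (M + 1) + (a N (M + 1) - a N M))) +
            (k : ℝ) ^ 2 / 2 * (((M : ℝ) + (i + 1))⁻¹ * (((M : ℝ) + (i + 3 / 2))⁻¹ * a N M))) =
          (2 * ((M : ℝ) + i) + 3) * a N (M + 1) - ((M : ℝ) + i + 2) * a N (M + 1 + 1)
            - (((M : ℝ) + i + 1) - (k : ℝ) ^ 2 / ((M : ℝ) + i + 1)) * a N M := by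
        rw [e5, e6]
        field_simp
        ring
      rw [hstep]
      linear_combination ih + a N (M + 1) * hr
  have hk := key M
  rw [hM M le_rfl, hM (M + 1) (by omega)] at hk
  have hs : ∑ n ∈ Finset.range M, (2 * ((n + i : ℕ) : ℝ) + 1) * a N n * legendreQ k (n + i) x =
      ∑ n ∈ Finset.range M, (2 * ((n + 1 + i : ℕ) : ℝ) + 1) * a N (n + 1) * legendreQ k (n + 1 + i) x := by
    have := Finset.sum_range_succ' (fun n => (2 * ((n + i : ℕ) : ℝ) + 1) * a N n * legendreQ k (n + i) x) M
    rw [Finset.sum_range_succ, hM M le_rfl, h0] at this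
    simpa using this
  rw [hs]
  linarith

/-- The `j`-fold iterate of the summation by parts. -/
noncomputable def legendreIter (k : ℕ) (a : ℕ → ℕ → ℝ) : ℕ → ℕ → ℕ → ℝ
  | 0 => a
  | j + 1 => legendreStep k j (legendreIter k a j)

lemma SuppIn.legendreIter {a : ℕ → ℕ → ℝ} (ha : SuppIn 0 a) (k j : ℕ) :
    SuppIn (2 * j) (legendreIter k a j) := by
  induction j with
  | zero => exact ha
  | succ j ih => exact ih.legendreStep k j

lemma IsSymbol.legendreIter {N₀ m : ℕ} {a : ℕ → ℕ → ℝ} (k j : ℕ)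
    (ha : IsSymbol N₀ (m + 2 * j) 0 a) :
    IsSymbol N₀ m (-(2 * j : ℕ)) (legendreIter k a j) := by
  induction j generalizing m with
  | zero => simpa [SphereEdge.legendreIter] using ha
  | succ j ih =>
    have := (ih (m := m + 2) (by rwa [show m + 2 + 2 * j = m + 2 * (j + 1) by ring])).legendreStep k j
    rw [SphereEdge.legendreIter]
    convert this using 1
    push_cast
    ring

lemma one_sub_pow_mul_sum_legendreQ (k j : ℕ) {a : ℕ → ℕ → ℝ} (ha : SuppIn 0 a) {N : ℕ}
    (hN : 8 * (j + 1) ≤ N) (x : ℝ) :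
    (1 - x) ^ j * ∑ n ∈ Finset.range (2 * N + 1), (2 * (n : ℝ) + 1) * a N n * legendreQ k n x =
      ∑ n ∈ Finset.range (2 * N + 1), (2 * ((n + j : ℕ) : ℝ) + 1) * legendreIter k a j N n *
        legendreQ k (n + j) x := by
  induction j with
  | zero => simp [legendreIter]
  | succ j ih =>
    rw [pow_succ', mul_assoc, ih (by omega)]
    have hs := ha.legendreIter k j
    exact one_sub_mul_sum_legendreQ k j _ N _ x (hs N 0 (by omega)) (hs N 1 (by omega))
      fun n hn => hs N n (by omega)

/-- After `j` steps there are `O(N)` terms, each with a weight `O(N)` and a coefficient `O(N ^ (-2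
j))`. -/
lemma one_sub_pow_mul_sum_legendreQ_le (k j : ℕ) {N₀ : ℕ} (hN₀ : 8 * (j + 1) ≤ N₀) {a : ℕ → ℕ → ℝ}
    (ha : SuppIn 0 a) (hs : IsSymbol N₀ (2 * j) 0 a) :
    ∃ C : ℝ, ∀ N, N₀ < N → ∀ x ∈ Icc (-1 : ℝ) 1,
      (1 - x) ^ j * |∑ n ∈ Finset.range (2 * N + 1), (2 * (n : ℝ) + 1) * a N n * legendreQ k n x| ≤
        C * (N : ℝ) ^ 2 * ((N : ℝ) ^ (2 * j))⁻¹ := by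
  have hs' := IsSymbol.legendreIter (m := 0) k j (by simpa using hs)
  obtain ⟨C, hC0, hC⟩ := hs'.bound_nonneg
  refine ⟨21 * C, fun N hN x hx => ?_⟩
  have h1 : (1 - x) ^ j = |(1 - x) ^ j| := (abs_of_nonneg (pow_nonneg (by linarith [hx.2]) _)).symm
  rw [h1, ← abs_mul, one_sub_pow_mul_sum_legendreQ k j ha (by omega)]
  have hN1 : (1 : ℝ) ≤ N := by exact_mod_cast (by omega : 1 ≤ N)
  have hjN : (j : ℝ) ≤ N := by exact_mod_cast (by omega : j ≤ N)
  calc |∑ n ∈ Finset.range (2 * N + 1), (2 * ((n + j : ℕ) : ℝ) + 1) * legendreIter k a j N n *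
        legendreQ k (n + j) x|
      ≤ ∑ n ∈ Finset.range (2 * N + 1), 7 * (N : ℝ) * (C * ((N : ℝ) ^ (2 * j))⁻¹) := by
        refine (Finset.abs_sum_le_sum_abs _ _).trans (Finset.sum_le_sum fun n hn => ?_)
        rw [Finset.mem_range] at hn
        have hn' : (n : ℝ) ≤ 2 * N := by exact_mod_cast (by omega : n ≤ 2 * N)
        rw [abs_mul, abs_mul]
        have e1 : |2 * ((n + j : ℕ) : ℝ) + 1| ≤ 7 * N := by
          rw [abs_of_nonneg (by positivity)]; push_cast; linarith
        have e2 : |legendreIter k a j N n| ≤ C * ((N : ℝ) ^ (2 * j))⁻¹ := by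
          -- Below `N / 4` the symbol bound says nothing, but there the iterated coefficients
          -- vanish, since `j` steps move the support down by only `2 j` and `N > 8 (j + 1)`.
          by_cases h : N ≤ 4 * n
          · have := hC N hN n h
            rwa [zpow_neg, zpow_natCast] at this
          · rw [ha.legendreIter k j N n (by omega), abs_zero]; positivity
        have e3 := abs_legendreQ_le k (n + j) hx
        calc _ ≤ 7 * (N : ℝ) * (C * ((N : ℝ) ^ (2 * j))⁻¹) * 1 := by gcongr
          _ = _ := mul_one _
    _ = (2 * N + 1) * (7 * (N : ℝ) * (C * ((N : ℝ) ^ (2 * j))⁻¹)) := by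
        rw [Finset.sum_const, Finset.card_range, nsmul_eq_mul]; push_cast; ring
    _ ≤ (3 * N) * (7 * (N : ℝ) * (C * ((N : ℝ) ^ (2 * j))⁻¹)) := by
        gcongr; linarith
    _ = _ := by ring

/-! ### The zonal case with an odd number of derivatives -/

lemma legendreQ_zero_eq (n : ℕ) (x : ℝ) : legendreQ 0 n x = legendreDeriv n 0 x := by
  rw [legendreQ, assocLegendreNat, legendreDeriv]
  have : (n.factorial : ℝ) ≠ 0 := by positivity
  simp [this]

lemma legendreDeriv_zero (k : ℕ) (x : ℝ) : legendreDeriv 0 (k + 1) x = 0 := by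
  rw [legendreDeriv, legendreP]
  simp

lemma legendreDeriv_one (x : ℝ) : legendreDeriv 1 0 x = x ∧ legendreDeriv 1 1 x = 1 ∧
    legendreDeriv 0 0 x = 1 := by
  refine ⟨?_, ?_, ?_⟩ <;> simp [legendreDeriv, legendreP] <;> ring

/-- The Christoffel-Darboux kernel `∑_{l < n} (2 l + 1) P_l(x)`. -/
noncomputable def legendreKernel (n : ℕ) (x : ℝ) : ℝ :=
  ∑ l ∈ Finset.range n, (2 * (l : ℝ) + 1) * legendreQ 0 l x

lemma legendreKernel_succ_eq (n : ℕ) (x : ℝ) :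
    legendreKernel (n + 1) x = legendreDeriv (n + 1) 1 x + legendreDeriv n 1 x := by
  induction n with
  | zero =>
    have := legendreDeriv_one x
    simp [legendreKernel, legendreQ_zero_eq, legendreDeriv_zero, this]
  | succ n ih =>
    rw [legendreKernel, Finset.sum_range_succ, ← legendreKernel, ih, legendreQ_zero_eq]
    have := legendreDeriv_succ_succ_sub n 0 x
    push_cast
    linarith

lemma one_sub_mul_legendreKernel (n : ℕ) (x : ℝ) :
    (1 - x) * legendreKernel (n + 1) x = (n + 1) * (legendreQ 0 n x - legendreQ 0 (n + 1) x) := by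
  induction n with
  | zero =>
    have := legendreDeriv_one x
    simp [legendreKernel, legendreQ_zero_eq, this]
  | succ n ih =>
    rw [legendreKernel, Finset.sum_range_succ, ← legendreKernel, mul_add, ih]
    have := legendreQ_recurrence 0 n x
    have h2 : (n : ℝ) + 2 ≠ 0 := by positivity
    simp at this
    push_cast
    linear_combination this

/-- On `[0, π/2]` the kernel is a sum of two derivatives of Legendre polynomials, each `O(n / sin
θ)` by Cauchy's estimate. On `[π/2, π]` the closed form for `(1 - x)` times the kernel applies, with
`1 - cos θ ≥ 1`. -/
lemma mul_abs_legendreKernel_le (n : ℕ) {θ : ℝ} (hθ : θ ∈ Icc 0 Real.pi) :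
    θ * |legendreKernel n (Real.cos θ)| ≤ 8 * (n + 1) := by
  rcases n with _ | n
  · simp [legendreKernel]
  have hπ := Real.pi_lt_four
  have hπ0 := Real.pi_pos
  rcases le_total θ (Real.pi / 2) with h | h
  · rcases hθ.1.eq_or_lt with h0 | h0
    · rw [← h0]; simp; positivity
    have hs : 0 < Real.sin θ := Real.sin_pos_of_pos_of_lt_pi h0 (by linarith)
    have hcs : Real.cos θ ^ 2 + Real.sin θ ^ 2 = 1 := Real.cos_sq_add_sin_sq θ
    have b1 := abs_pow_mul_legendreDeriv_le (n + 1) 1 hs hcs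
    have b2 := abs_pow_mul_legendreDeriv_le n 1 hs hcs
    have f1 : ((n + 1).factorial : ℝ) / n.factorial = n + 1 := by
      rw [Nat.factorial_succ]; push_cast; field_simp
    have f2 : ((n + 1 + 1).factorial : ℝ) / (n + 1).factorial = n + 2 := by
      rw [Nat.factorial_succ (n + 1)]; push_cast; field_simp; ring
    rw [f1, pow_one] at b2
    rw [f2, pow_one] at b1
    have hj : 2 / Real.pi * θ ≤ Real.sin θ := Real.mul_le_sin h0.le h
    have hj' : θ ≤ 2 * Real.sin θ := by
      rw [div_mul_eq_mul_div, div_le_iff₀ hπ0] at hj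
      nlinarith
    calc θ * |legendreKernel (n + 1) (Real.cos θ)|
        ≤ 2 * Real.sin θ * (|legendreDeriv (n + 1) 1 (Real.cos θ)| + |legendreDeriv n 1 (Real.cos θ)|) := by
          rw [legendreKernel_succ_eq]
          gcongr
          exact abs_add_le _ _
      _ ≤ 8 * ((n + 1 : ℕ) + 1) := by push_cast; linarith
  · have hc : Real.cos θ ≤ 0 := Real.cos_nonpos_of_pi_div_two_le_of_le h (by linarith [hθ.2])
    have hx : Real.cos θ ∈ Icc (-1 : ℝ) 1 := ⟨Real.neg_one_le_cos θ, Real.cos_le_one θ⟩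
    have e := one_sub_mul_legendreKernel n (Real.cos θ)
    have q1 := abs_legendreQ_le 0 n hx
    have q2 := abs_legendreQ_le 0 (n + 1) hx
    have : |legendreKernel (n + 1) (Real.cos θ)| ≤ (n + 1) * 2 := by
      calc |legendreKernel (n + 1) (Real.cos θ)|
          ≤ (1 - Real.cos θ) * |legendreKernel (n + 1) (Real.cos θ)| :=
            le_mul_of_one_le_left (abs_nonneg _) (by linarith)
        _ = |(1 - Real.cos θ) * legendreKernel (n + 1) (Real.cos θ)| := by
            rw [abs_mul, abs_of_nonneg (show 0 ≤ 1 - Real.cos θ by linarith)]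
        _ = (n + 1) * |legendreQ 0 n (Real.cos θ) - legendreQ 0 (n + 1) (Real.cos θ)| := by
            rw [e, abs_mul, abs_of_nonneg (by positivity)]
        _ ≤ (n + 1) * 2 := by
            gcongr
            exact (abs_sub _ _).trans (by linarith)
    push_cast
    have h4 : θ ≤ 4 := by linarith [hθ.2]
    have hn : (0 : ℝ) ≤ n := by positivity
    nlinarith [abs_nonneg (legendreKernel (n + 1) (Real.cos θ)), hθ.1]

/-- Abel summation: one difference of the coefficients gains `1 / N`, while the kernel costs only `1
/ θ` by `mul_abs_legendreKernel_le`. This is the half step that even powers of `θ` miss. -/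
lemma sum_mul_legendreQ_zero (b : ℕ → ℝ) (j M : ℕ) (x : ℝ) (h0 : b 0 = 0) (hM : b M = 0) :
    ∑ n ∈ Finset.range M, (2 * ((n + j : ℕ) : ℝ) + 1) * b n * legendreQ 0 (n + j) x =
      ∑ n ∈ Finset.range M, (b n - b (n + 1)) * legendreKernel (n + j + 1) x := by
  have key : ∀ M, ∑ n ∈ Finset.range M, (2 * ((n + j : ℕ) : ℝ) + 1) * b n * legendreQ 0 (n + j) x =
      ∑ n ∈ Finset.range M, (b n - b (n + 1)) * legendreKernel (n + j + 1) x +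
        b M * legendreKernel (M + j) x := by
    intro M
    induction M with
    | zero => simp [h0]
    | succ M ih =>
      rw [Finset.sum_range_succ, ih, Finset.sum_range_succ]
      have : legendreKernel (M + j + 1) x =
          legendreKernel (M + j) x + (2 * ((M + j : ℕ) : ℝ) + 1) * legendreQ 0 (M + j) x := by
        rw [legendreKernel, Finset.sum_range_succ, ← legendreKernel]
      rw [show M + 1 + j = M + j + 1 by omega, this]
      ring
  rw [key, hM]; ring

lemma one_sub_pow_mul_sum_legendreQ_zero_le (j : ℕ) {N₀ : ℕ} (hN₀ : 8 * (j + 1) ≤ N₀)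
    {a : ℕ → ℕ → ℝ} (ha : SuppIn 0 a) (hs : IsSymbol N₀ (2 * j + 1) 0 a) :
    ∃ C : ℝ, ∀ N, N₀ < N → ∀ θ ∈ Icc 0 Real.pi,
      θ * (1 - Real.cos θ) ^ j *
        |∑ n ∈ Finset.range (2 * N + 1), (2 * (n : ℝ) + 1) * a N n * legendreQ 0 n (Real.cos θ)| ≤
        C * (N : ℝ) ^ 2 * ((N : ℝ) ^ (2 * j + 1))⁻¹ := by
  have hs' := (IsSymbol.legendreIter (m := 1) 0 j (by rwa [add_comm])).diff
  obtain ⟨C, hC0, hC⟩ := hs'.bound_nonneg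
  refine ⟨144 * C, fun N hN θ hθ => ?_⟩
  have h1 : (1 - Real.cos θ) ^ j = |(1 - Real.cos θ) ^ j| :=
    (abs_of_nonneg (pow_nonneg (by linarith [Real.cos_le_one θ]) _)).symm
  have hsupp := ha.legendreIter 0 j
  rw [h1, mul_assoc, ← abs_mul, one_sub_pow_mul_sum_legendreQ 0 j ha (by omega),
    sum_mul_legendreQ_zero _ _ _ _ (hsupp N 0 (by omega)) (hsupp N _ (by omega))]
  have hN1 : (1 : ℝ) ≤ N := by exact_mod_cast (by omega : 1 ≤ N)
  have hjN : (j : ℝ) + 1 ≤ N := by exact_mod_cast (by omega : j + 1 ≤ N)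
  set b := legendreIter 0 a j N
  calc θ * |∑ n ∈ Finset.range (2 * N + 1), (b n - b (n + 1)) * legendreKernel (n + j + 1) (Real.cos θ)|
      ≤ θ * ∑ n ∈ Finset.range (2 * N + 1), |(b n - b (n + 1)) * legendreKernel (n + j + 1) (Real.cos θ)| :=
        mul_le_mul_of_nonneg_left (Finset.abs_sum_le_sum_abs _ _) hθ.1
    _ ≤ ∑ n ∈ Finset.range (2 * N + 1), 48 * C * N * ((N : ℝ) ^ (2 * j + 1))⁻¹ := by
        rw [Finset.mul_sum]
        refine Finset.sum_le_sum fun n hn => ?_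
        rw [Finset.mem_range] at hn
        have hn' : (n : ℝ) ≤ 2 * N := by exact_mod_cast (by omega : n ≤ 2 * N)
        have e1 : |b n - b (n + 1)| ≤ C * ((N : ℝ) ^ (2 * j + 1))⁻¹ := by
          by_cases h : N ≤ 4 * n
          · have := hC N hN n h
            rw [abs_sub_comm] at this
            rwa [show -((2 * j : ℕ) : ℤ) - 1 = -((2 * j + 1 : ℕ) : ℤ) by push_cast; ring, zpow_neg,
              zpow_natCast] at this
          · have z1 : b n = 0 := hsupp N n (by omega)
            have z2 : b (n + 1) = 0 := hsupp N (n + 1) (by omega)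
            rw [z1, z2]; simp; positivity
        have e2 := mul_abs_legendreKernel_le (n + j + 1) hθ
        push_cast at e2
        calc θ * |(b n - b (n + 1)) * legendreKernel (n + j + 1) (Real.cos θ)|
            = |b n - b (n + 1)| * (θ * |legendreKernel (n + j + 1) (Real.cos θ)|) := by
              rw [abs_mul]; ring
          _ ≤ C * ((N : ℝ) ^ (2 * j + 1))⁻¹ * (8 * (6 * N)) := by
              exact mul_le_mul e1 (by linarith) (mul_nonneg hθ.1 (abs_nonneg _)) (by positivity)
          _ = _ := by ring
    _ = (2 * N + 1) * (48 * C * N * ((N : ℝ) ^ (2 * j + 1))⁻¹) := by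
        rw [Finset.sum_const, Finset.card_range, nsmul_eq_mul]; push_cast; ring
    _ ≤ (3 * N) * (48 * C * N * ((N : ℝ) ^ (2 * j + 1))⁻¹) := by
        gcongr; linarith
    _ = _ := by ring

/-! ### The window and the sums over the degrees at fixed order -/

lemma exists_contDiff_extension {m : ℕ} {κ : ℝ → ℝ} (hκ : ContDiffOn ℝ m κ (Ici 0))
    (hsupp : ∀ t, 0 ≤ t → κ t ≠ 0 → t ∈ Icc (1 / 2 : ℝ) 2) :
    ∃ (f : ℝ → ℝ) (B : ℝ), ContDiff ℝ m f ∧ (∀ t, 0 ≤ t → f t = κ t) ∧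
      (∀ t, f t ≠ 0 → t ∈ Icc (1 / 2 : ℝ) 2) ∧ ∀ i ≤ m, ∀ t, |iteratedDeriv i f t| ≤ B := by
  set f : ℝ → ℝ := fun t => if 0 ≤ t then κ t else 0 with hf
  have hfs : ∀ t, f t ≠ 0 → t ∈ Icc (1 / 2 : ℝ) 2 := by
    intro t ht
    by_cases h : 0 ≤ t
    · simp only [hf, h, if_true] at ht; exact hsupp t h ht
    · simp [hf, h] at ht
  have hfc : ContDiff ℝ m f := by
    rw [contDiff_iff_contDiffAt]
    intro t
    rcases lt_or_ge 0 t with h | h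
    · have : f =ᶠ[𝓝 t] κ := by
        filter_upwards [lt_mem_nhds h] with s hs
        simp [hf, hs.le]
      exact (hκ.contDiffAt (Ici_mem_nhds h)).congr_of_eventuallyEq this
    · have : f =ᶠ[𝓝 t] fun _ => 0 := by
        filter_upwards [gt_mem_nhds (show t < 1 / 2 by linarith)] with s hs
        by_contra hne
        linarith [(hfs s hne).1]
      exact contDiffAt_const.congr_of_eventuallyEq this
  have hcs : HasCompactSupport f :=
    HasCompactSupport.of_support_subset_isCompact isCompact_Icc fun t ht => hfs t ht
  have hcs' : ∀ i, HasCompactSupport (iteratedDeriv i f) := by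
    intro i
    induction i with
    | zero => simpa using hcs
    | succ i ih => rw [iteratedDeriv_succ]; exact ih.deriv
  have hb : ∀ i, ∃ B, i ≤ m → ∀ t, |iteratedDeriv i f t| ≤ B := by
    intro i
    by_cases hi : i ≤ m
    · obtain ⟨B, hB⟩ := (hcs' i).exists_bound_of_continuous
        (hfc.continuous_iteratedDeriv i (by exact_mod_cast hi))
      exact ⟨B, fun _ t => hB t⟩
    · exact ⟨0, fun h => absurd h hi⟩
  choose B hB using hb
  refine ⟨f, ∑ i ∈ Finset.range (m + 1), |B i|, hfc, fun t ht => by simp [hf, ht], hfs, ?_⟩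
  intro i hi t
  refine (hB i hi t).trans ((le_abs_self _).trans ?_)
  exact Finset.single_le_sum (f := fun i => |B i|) (fun _ _ => abs_nonneg _)
    (Finset.mem_range.2 (by omega))

/-- The square root of `(n + k)! (n - k)! / n!²`. -/
noncomputable def legendreRatio (k n : ℕ) : ℝ :=
  √(∏ j ∈ Finset.range k, (1 + (k : ℝ) * ((n : ℝ) + ((j : ℝ) + 1 - k))⁻¹))

/-- The product form exhibits the ratio as a root of factors `1 + O(1 / n)`, so the change from the
`L²` to the sup normalization preserves symbols of order `0`. -/
lemma isSymbol_legendreRatio {N₀ k : ℕ} (h : 8 * k ≤ N₀) (m : ℕ) :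
    IsSymbol N₀ m 0 (fun _ n => legendreRatio k n) := by
  have hk : (8 : ℝ) * k ≤ N₀ := by exact_mod_cast h
  refine IsSymbol.sqrt ?_ ?_
  · refine IsSymbol.finset_prod (f := fun (j : ℕ) _ n => 1 + (k : ℝ) * ((n : ℝ) + ((j : ℝ) + 1 - k))⁻¹)
      _ fun j _ => ?_
    refine (IsSymbol.const 1).add ?_
    refine ((IsSymbol.inv_natCast_add ?_).const_mul (k : ℝ)).mono (by norm_num)
    have : (0 : ℝ) ≤ j := by positivity
    linarith
  · intro N hN n hn
    refine Finset.one_le_prod fun j _ => ?_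
    have h1 : (N₀ : ℝ) < N := by exact_mod_cast hN
    have h2 : (N : ℝ) ≤ 4 * n := by exact_mod_cast hn
    have : (0 : ℝ) ≤ j := by positivity
    have h3 : (0 : ℝ) < (n : ℝ) + ((j : ℝ) + 1 - k) := by linarith
    have : 0 ≤ (k : ℝ) * ((n : ℝ) + ((j : ℝ) + 1 - k))⁻¹ := by positivity
    linarith

lemma legendreRatio_le {k n : ℕ} (h : k ≤ n) : legendreRatio k n ≤ (1 + (k : ℝ)) ^ k := by
  have hkn : (k : ℝ) ≤ n := by exact_mod_cast h
  have h1 : ∏ j ∈ Finset.range k, (1 + (k : ℝ) * ((n : ℝ) + ((j : ℝ) + 1 - k))⁻¹) ≤ (1 + (k : ℝ)) ^ k := by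
    calc _ ≤ ∏ j ∈ Finset.range k, (1 + (k : ℝ)) := by
          refine Finset.prod_le_prod (fun j _ => ?_) (fun j _ => ?_)
          all_goals
            have hj : (0 : ℝ) ≤ j := by positivity
            have h3 : (1 : ℝ) ≤ (n : ℝ) + ((j : ℝ) + 1 - k) := by linarith
          · positivity
          · gcongr
            exact mul_le_of_le_one_right (by positivity) (inv_le_one_of_one_le₀ h3)
      _ = _ := by simp
  have h2 : (1 : ℝ) ≤ (1 + (k : ℝ)) ^ k := one_le_pow₀ (by linarith [(by positivity : (0 : ℝ) ≤ k)])
  rw [legendreRatio, Real.sqrt_le_left (by positivity)]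
  nlinarith

lemma factorial_add_eq_prod (m k : ℕ) :
    ((m + k).factorial : ℝ) = m.factorial * ∏ j ∈ Finset.range k, ((m : ℝ) + j + 1) := by
  induction k with
  | zero => simp
  | succ k ih =>
    rw [← add_assoc, Nat.factorial_succ, Finset.prod_range_succ, Nat.cast_mul, ih]
    push_cast; ring

lemma sqrt_mul_assocLegendreNat {k n : ℕ} (h : k ≤ n) (x : ℝ) :
    √(((n - k).factorial : ℝ) / (n + k).factorial) * assocLegendreNat n k x =
      legendreRatio k n * legendreQ k n x := by
  obtain ⟨m, rfl⟩ := Nat.exists_eq_add_of_le' h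
  rw [Nat.add_sub_cancel, legendreQ, ← mul_assoc]
  congr 1
  have hprod : ∏ j ∈ Finset.range k, (1 + (k : ℝ) * (((m + k : ℕ) : ℝ) + ((j : ℝ) + 1 - k))⁻¹) =
      (∏ j ∈ Finset.range k, (((m + k : ℕ) : ℝ) + j + 1)) / ∏ j ∈ Finset.range k, ((m : ℝ) + j + 1) := by
    rw [← Finset.prod_div_distrib]
    refine Finset.prod_congr rfl fun j _ => ?_
    have h1 : (m : ℝ) + j + 1 ≠ 0 := by positivity
    push_cast
    rw [show (m : ℝ) + k + ((j : ℝ) + 1 - k) = m + j + 1 by ring]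
    field_simp
    ring
  have f1 := factorial_add_eq_prod m k
  have f2 := factorial_add_eq_prod (m + k) k
  have p1 : (0 : ℝ) < m.factorial := by positivity
  have p2 : (0 : ℝ) < (m + k).factorial := by positivity
  have p3 : (0 : ℝ) < (m + k + k).factorial := by positivity
  have e1 : ∏ j ∈ Finset.range k, ((m : ℝ) + j + 1) = (m + k).factorial / m.factorial := by
    rw [f1]; field_simp
  have e2 : ∏ j ∈ Finset.range k, (((m + k : ℕ) : ℝ) + j + 1) =
      (m + k + k).factorial / (m + k).factorial := by
    rw [f2]; field_simp
  rw [legendreRatio, hprod, e1, e2, ← Real.sqrt_sq (show (0 : ℝ) ≤ (m + k).factorial / (m + k + k).factorial by positivity),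
    ← Real.sqrt_mul (by positivity)]
  congr 1
  field_simp

/-- The sum over the degrees in the wavelet, for a fixed order. -/
noncomputable def orderSum (f : ℝ → ℝ) (k N : ℕ) (x : ℝ) : ℝ :=
  ∑ n ∈ Finset.range (2 * N + 1), (2 * (n : ℝ) + 1) * f ((n : ℝ) / N) *
    (√(((n - k).factorial : ℝ) / (n + k).factorial) * assocLegendreNat n k x)

lemma suppIn_comp_div {f : ℝ → ℝ} (hf : ∀ t, f t ≠ 0 → t ∈ Icc (1 / 2 : ℝ) 2) (g : ℕ → ℝ) :
    SuppIn 0 (fun N n => f ((n : ℝ) / N) * g n) := by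
  intro N n h
  have : f ((n : ℝ) / N) = 0 := by
    by_contra hne
    have h1 := hf _ hne
    rcases Nat.eq_zero_or_pos N with h0 | h0
    · norm_num [h0] at h1
    have hN : (0 : ℝ) < N := by exact_mod_cast h0
    rw [mem_Icc, le_div_iff₀ hN, div_le_iff₀ hN] at h1
    rcases h with h | h
    · have : (2 : ℝ) * (n + 0) < N := by exact_mod_cast h
      linarith
    · have : (2 : ℝ) * N < n := by exact_mod_cast h
      linarith
  simp [this]

lemma orderSum_eq {f : ℝ → ℝ} (hf : ∀ t, f t ≠ 0 → t ∈ Icc (1 / 2 : ℝ) 2) {k N : ℕ}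
    (hN : 2 * k ≤ N) (x : ℝ) :
    orderSum f k N x = ∑ n ∈ Finset.range (2 * N + 1),
      (2 * (n : ℝ) + 1) * (f ((n : ℝ) / N) * legendreRatio k n) * legendreQ k n x := by
  refine Finset.sum_congr rfl fun n _ => ?_
  by_cases hkn : k ≤ n
  · rw [sqrt_mul_assocLegendreNat hkn]; ring
  -- For `n < k` the difference `n - k` is truncated, but `2 n < N` makes the window vanish.
  · have := suppIn_comp_div hf (fun _ => 1) N n (by omega)
    simp only [mul_one] at this
    simp [this]

lemma isSymbol_comp_div {f : ℝ → ℝ} {B : ℝ} {m N₀ k : ℕ} (hc : ContDiff ℝ m f)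
    (hB : ∀ i ≤ m, ∀ t, |iteratedDeriv i f t| ≤ B) (hk : 8 * k ≤ N₀) :
    IsSymbol N₀ m 0 (fun N n => f ((n : ℝ) / N) * legendreRatio k n) := by
  have := (isSymbol_of_bounded_deriv m (N₀ := N₀) (f := fun _ => f) (B := B) (r := 0)
    (fun _ => hc) (fun N _ i hi t => by simpa using hB i hi t)).mul (isSymbol_legendreRatio hk m)
  rwa [add_zero] at this

lemma sq_le_mul_one_sub_cos {θ : ℝ} (hθ : θ ∈ Icc 0 Real.pi) : θ ^ 2 ≤ 8 * (1 - Real.cos θ) := by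
  have h := Real.cos_le_one_sub_mul_cos_sq (x := θ) (by rw [abs_of_nonneg hθ.1]; exact hθ.2)
  have hπ := Real.pi_lt_four
  have hπ0 := Real.pi_pos
  have h2 : (1 : ℝ) / 8 ≤ 2 / Real.pi ^ 2 := by
    rw [div_le_div_iff₀ (by norm_num) (by positivity)]
    nlinarith
  nlinarith [mul_le_mul_of_nonneg_right h2 (sq_nonneg θ)]

lemma orderSum_even_le {f : ℝ → ℝ} {B : ℝ} (j k : ℕ) (hc : ContDiff ℝ (2 * j : ℕ) f)
    (hB : ∀ i ≤ 2 * j, ∀ t, |iteratedDeriv i f t| ≤ B)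
    (hf : ∀ t, f t ≠ 0 → t ∈ Icc (1 / 2 : ℝ) 2) :
    ∃ (C : ℝ) (N₀ : ℕ), ∀ N, N₀ < N → ∀ θ ∈ Icc 0 Real.pi,
      ((N : ℝ) * θ) ^ (2 * j) * |orderSum f k N (Real.cos θ)| ≤ C * (N : ℝ) ^ 2 := by
  obtain ⟨C, hC⟩ := one_sub_pow_mul_sum_legendreQ_le k j (N₀ := 8 * (j + 1 + k)) (by omega)
    (suppIn_comp_div hf (legendreRatio k)) (isSymbol_comp_div hc hB (by omega))
  refine ⟨8 ^ j * C, 8 * (j + 1 + k), fun N hN θ hθ => ?_⟩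
  have h := hC N hN (Real.cos θ) ⟨Real.neg_one_le_cos θ, Real.cos_le_one θ⟩
  rw [← orderSum_eq hf (by omega)] at h
  have hN0 : (0 : ℝ) < N := by exact_mod_cast (by omega : 0 < N)
  rw [← div_eq_mul_inv, le_div_iff₀ (by positivity)] at h
  have h1 : θ ^ (2 * j) ≤ 8 ^ j * (1 - Real.cos θ) ^ j := by
    rw [pow_mul, ← mul_pow]
    exact pow_le_pow_left₀ (by positivity) (sq_le_mul_one_sub_cos hθ) _
  calc ((N : ℝ) * θ) ^ (2 * j) * |orderSum f k N (Real.cos θ)|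
      = θ ^ (2 * j) * (|orderSum f k N (Real.cos θ)| * (N : ℝ) ^ (2 * j)) := by rw [mul_pow]; ring
    _ ≤ 8 ^ j * (1 - Real.cos θ) ^ j * (|orderSum f k N (Real.cos θ)| * (N : ℝ) ^ (2 * j)) := by gcongr
    _ = 8 ^ j * ((1 - Real.cos θ) ^ j * |orderSum f k N (Real.cos θ)| * (N : ℝ) ^ (2 * j)) := by ring
    _ ≤ 8 ^ j * (C * (N : ℝ) ^ 2) := by gcongr
    _ = _ := by ring

lemma orderSum_odd_le {f : ℝ → ℝ} {B : ℝ} (j : ℕ) (hc : ContDiff ℝ (2 * j + 1 : ℕ) f)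
    (hB : ∀ i ≤ 2 * j + 1, ∀ t, |iteratedDeriv i f t| ≤ B)
    (hf : ∀ t, f t ≠ 0 → t ∈ Icc (1 / 2 : ℝ) 2) :
    ∃ (C : ℝ) (N₀ : ℕ), ∀ N, N₀ < N → ∀ θ ∈ Icc 0 Real.pi,
      ((N : ℝ) * θ) ^ (2 * j + 1) * |orderSum f 0 N (Real.cos θ)| ≤ C * (N : ℝ) ^ 2 := by
  obtain ⟨C, hC⟩ := one_sub_pow_mul_sum_legendreQ_zero_le j (N₀ := 8 * (j + 1)) le_rfl
    (suppIn_comp_div hf (legendreRatio 0)) (isSymbol_comp_div hc hB (by omega))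
  refine ⟨8 ^ j * C, 8 * (j + 1), fun N hN θ hθ => ?_⟩
  have h := hC N hN θ hθ
  rw [← orderSum_eq hf (by omega)] at h
  have hN0 : (0 : ℝ) < N := by exact_mod_cast (by omega : 0 < N)
  rw [← div_eq_mul_inv, le_div_iff₀ (by positivity)] at h
  have h1 : θ ^ (2 * j) ≤ 8 ^ j * (1 - Real.cos θ) ^ j := by
    rw [pow_mul, ← mul_pow]
    exact pow_le_pow_left₀ (by positivity) (sq_le_mul_one_sub_cos hθ) _
  have h2 : 0 ≤ θ := hθ.1
  calc ((N : ℝ) * θ) ^ (2 * j + 1) * |orderSum f 0 N (Real.cos θ)|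
      = θ ^ (2 * j) * (θ * |orderSum f 0 N (Real.cos θ)| * (N : ℝ) ^ (2 * j + 1)) := by
        rw [mul_pow]; ring
    _ ≤ 8 ^ j * (1 - Real.cos θ) ^ j * (θ * |orderSum f 0 N (Real.cos θ)| * (N : ℝ) ^ (2 * j + 1)) := by
        gcongr
    _ = 8 ^ j * (θ * (1 - Real.cos θ) ^ j * |orderSum f 0 N (Real.cos θ)| * (N : ℝ) ^ (2 * j + 1)) := by
        ring
    _ ≤ 8 ^ j * (C * (N : ℝ) ^ 2) := by gcongr
    _ = _ := by ring

/-- For odd `m` and general order the even exponents `m + 1` and `0` are combined, which uses one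
derivative more than `m`; for `k = 0` the kernel estimate avoids this. -/
lemma orderSum_le {f : ℝ → ℝ} {B : ℝ} (m l k : ℕ) (hml : m ≤ l) (hl : m + 1 ≤ l ∨ k = 0)
    (hc : ContDiff ℝ l f) (hB : ∀ i ≤ l, ∀ t, |iteratedDeriv i f t| ≤ B)
    (hf : ∀ t, f t ≠ 0 → t ∈ Icc (1 / 2 : ℝ) 2) :
    ∃ (C : ℝ) (N₀ : ℕ), ∀ N, N₀ < N → ∀ θ ∈ Icc 0 Real.pi,
      ((N : ℝ) * θ) ^ m * |orderSum f k N (Real.cos θ)| ≤ C * (N : ℝ) ^ 2 := by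
  rcases Nat.even_or_odd' m with ⟨j, rfl | rfl⟩
  · exact orderSum_even_le j k (hc.of_le (by exact_mod_cast hml)) (fun i hi => hB i (hi.trans hml)) hf
  · rcases hl with hl | rfl
    · obtain ⟨C, N₀, hC⟩ := orderSum_even_le (j + 1) k (hc.of_le (by norm_cast))
        (fun i hi => hB i (hi.trans (by omega))) hf
      obtain ⟨D, N₁, hD⟩ := orderSum_even_le 0 k (hc.of_le (by norm_cast; omega))
        (fun i hi => hB i (hi.trans (by omega))) hf
      refine ⟨C + D, max N₀ N₁, fun N hN θ hθ => ?_⟩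
      have h1 := hC N (lt_of_le_of_lt (le_max_left _ _) hN) θ hθ
      have h2 := hD N (lt_of_le_of_lt (le_max_right _ _) hN) θ hθ
      set t := (N : ℝ) * θ
      have ht : 0 ≤ t := mul_nonneg (Nat.cast_nonneg _) hθ.1
      have h3 : t ^ (2 * j + 1) ≤ t ^ (2 * (j + 1)) + 1 := by
        rcases le_total t 1 with h | h
        · have := pow_le_one₀ ht h (n := 2 * j + 1)
          have : 0 ≤ t ^ (2 * (j + 1)) := by positivity
          linarith
        · have := pow_le_pow_right₀ h (show 2 * j + 1 ≤ 2 * (j + 1) by omega)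
          linarith
      rw [mul_zero, pow_zero, one_mul] at h2
      have := mul_le_mul_of_nonneg_right h3 (abs_nonneg (orderSum f k N (Real.cos θ)))
      linarith
    · exact orderSum_odd_le j (hc.of_le (by exact_mod_cast hml)) (fun i hi => hB i (hi.trans hml)) hf

/-! ### Localization of the wavelets -/

/-- The unimodular factor of the spherical harmonic of order `k`. -/
noncomputable def orderPhase (k : ℤ) (φ : ℝ) : ℂ :=
  (if 0 ≤ k then (-1) ^ k else 1) * Complex.exp (Complex.I * k * φ)

lemma norm_orderPhase (k : ℤ) (φ : ℝ) : ‖orderPhase k φ‖ = 1 := by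
  have : Complex.I * k * φ = ((k * φ : ℝ) : ℂ) * Complex.I := by push_cast; ring
  rw [orderPhase, norm_mul, this, Complex.norm_exp_ofReal_mul_I, mul_one]
  split_ifs <;> simp

lemma sphHarm_eq {n : ℕ} {k : ℤ} (hk : k.natAbs ≤ n) (θ φ : ℝ) :
    sphHarm n k θ φ = orderPhase k φ * ((√((2 * n + 1) / (4 * Real.pi)) *
      (√(((n - k.natAbs).factorial : ℝ) / (n + k.natAbs).factorial) *
        assocLegendreNat n k.natAbs (Real.cos θ)) : ℝ) : ℂ) := by
  have hsq : ∀ a b : ℝ, √((2 * (n : ℝ) + 1) / (4 * Real.pi) * (a / b)) =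
      √((2 * (n : ℝ) + 1) / (4 * Real.pi)) * √(a / b) := fun a b =>
    Real.sqrt_mul (by have := Real.pi_pos; positivity) _
  rcases le_or_gt 0 k with h | h
  · obtain ⟨j, rfl⟩ := Int.eq_ofNat_of_zero_le h
    rw [Int.natAbs_natCast] at hk ⊢
    have e1 : ((n : ℤ) - j).toNat = n - j := by omega
    have e2 : ((n : ℤ) + j).toNat = n + j := by omega
    rw [sphHarm, orderPhase, assocLegendre, if_pos h, if_pos h, e1, e2, hsq, Int.toNat_natCast]
    push_cast
    ring
  · obtain ⟨j, rfl⟩ : ∃ j : ℕ, k = -(j : ℤ) := ⟨k.natAbs, by omega⟩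
    rw [Int.natAbs_neg, Int.natAbs_natCast] at hk ⊢
    have e1 : ((n : ℤ) - -(j : ℤ)).toNat = n + j := by omega
    have e2 : ((n : ℤ) + -(j : ℤ)).toNat = n - j := by omega
    rw [sphHarm, orderPhase, assocLegendre, if_neg (by omega), if_neg (by omega), e1, e2, hsq, neg_neg,
      Int.toNat_natCast]
    have p1 : (0 : ℝ) < (n - j).factorial := by positivity
    have p2 : (0 : ℝ) < (n + j).factorial := by positivity
    have e3 : √(((n + j).factorial : ℝ) / (n - j).factorial) *
        (((n - j).factorial : ℝ) / (n + j).factorial) =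
        √(((n - j).factorial : ℝ) / (n + j).factorial) := by
      rw [Real.sqrt_div p2.le, Real.sqrt_div p1.le]
      have q1 := Real.sqrt_pos.2 p1
      have q2 := Real.sqrt_pos.2 p2
      have w1 := Real.sq_sqrt p1.le
      have w2 := Real.sq_sqrt p2.le
      field_simp
      rw [w1, w2]
      ring
    have e4 : ((-1 : ℂ) ^ (-(j : ℤ))) * ((-1 : ℂ) ^ (-(j : ℤ))) = 1 := by
      rw [← mul_zpow]; simp
    rw [← e3]
    push_cast
    linear_combination (Complex.exp (Complex.I * (-(j : ℂ)) * φ) *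
      (√((2 * (n : ℝ) + 1) / (4 * Real.pi)) : ℝ) * (√(((n + j).factorial : ℝ) / (n - j).factorial) : ℝ) *
      (((n - j).factorial : ℂ) / (n + j).factorial) * (assocLegendreNat n j (Real.cos θ) : ℝ)) * e4

/-- The normalization constant of the wavelets. -/
noncomputable def waveletConst : ℝ := √(1 / (8 * Real.pi ^ 2)) * √(1 / (4 * Real.pi))

lemma waveletConst_nonneg : 0 ≤ waveletConst := by unfold waveletConst; positivity

lemma waveletConst_le_one : waveletConst ≤ 1 := by
  have h := Real.pi_gt_three
  have h1 : √(1 / (8 * Real.pi ^ 2)) ≤ 1 := by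
    rw [Real.sqrt_le_left zero_le_one, one_pow]
    rw [div_le_one (by positivity)]; nlinarith
  have h2 : √(1 / (4 * Real.pi)) ≤ 1 := by
    rw [Real.sqrt_le_left zero_le_one, one_pow]
    rw [div_le_one (by positivity)]; nlinarith
  exact mul_le_one₀ h1 (by positivity) h2

lemma sqrt_mul_sqrt_eq (n : ℕ) :
    √((2 * (n : ℝ) + 1) / (8 * Real.pi ^ 2)) * √((2 * n + 1) / (4 * Real.pi)) =
      waveletConst * (2 * n + 1) := by
  rw [waveletConst, div_eq_mul_one_div, div_eq_mul_one_div (2 * (n : ℝ) + 1) (4 * Real.pi),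
    Real.sqrt_mul (by positivity), Real.sqrt_mul (by positivity)]
  have := Real.mul_self_sqrt (show (0 : ℝ) ≤ 2 * n + 1 by positivity)
  linear_combination (√(1 / (8 * Real.pi ^ 2)) * √(1 / (4 * Real.pi))) * this

lemma wavelet_term_eq {n : ℕ} {k : ℤ} (hk : k.natAbs ≤ n) (κ : ℝ) (d : ℂ) (θ φ : ℝ) :
    (√((2 * n + 1) / (8 * Real.pi ^ 2)) : ℝ) * (κ : ℂ) * d * sphHarm n k θ φ =
      (waveletConst : ℂ) * d * orderPhase k φ * (((2 * (n : ℝ) + 1) * κ *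
      (√(((n - k.natAbs).factorial : ℝ) / (n + k.natAbs).factorial) *
        assocLegendreNat n k.natAbs (Real.cos θ)) : ℝ) : ℂ) := by
  have h := congrArg (fun t : ℝ => (t : ℂ)) (sqrt_mul_sqrt_eq n)
  simp only [Complex.ofReal_mul] at h
  rw [sphHarm_eq hk]
  simp only [Complex.ofReal_mul]
  linear_combination (κ : ℂ) * d * orderPhase k φ *
    (((√(((n - k.natAbs).factorial : ℝ) / (n + k.natAbs).factorial) : ℝ) : ℂ) *
        ((assocLegendreNat n k.natAbs (Real.cos θ) : ℝ) : ℂ)) * h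

lemma norm_dirComp_le (K n : ℕ) (k : ℤ) : ‖dirComp K n k‖ ≤ 1 := by
  rw [dirComp]
  split_ifs with h1 h2 h3 h3
  all_goals try simp
  all_goals
    rw [abs_of_nonneg (by positivity), inv_mul_le_iff₀ (by positivity), mul_one,
      abs_of_nonneg (Real.sqrt_nonneg _), Real.sqrt_le_sqrt_iff (by positivity)]
    exact_mod_cast Nat.choose_le_two_pow _ _

lemma dirComp_eq_zero {K n : ℕ} {k : ℤ} (h : (K : ℤ) - 1 < |k|) : dirComp K n k = 0 := by
  rw [dirComp, if_neg (by omega)]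

/-- Beyond degree `K` the directionality no longer depends on `n`, so for large `N` it factors out
of the sum over the degrees and does not affect the differences. -/
lemma dirComp_eq_of_le {K n : ℕ} (h : K ≤ n) (k : ℤ) : dirComp K n k = dirComp K K k := by
  have : ∀ n, K ≤ n → dirP K n = K - 1 := by
    intro n hn
    rw [dirP]
    split_ifs <;> omega
  rw [dirComp, dirComp, this n h, this K le_rfl]

lemma waveletPolar_eq_sum_range {f : ℝ → ℝ} {κ : ℝ → ℝ} (hfκ : ∀ t, 0 ≤ t → f t = κ t)
    (hf : ∀ t, f t ≠ 0 → t ∈ Icc (1 / 2 : ℝ) 2) (K N : ℕ) (θ φ : ℝ) :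
    waveletPolar κ K N θ φ = ∑ n ∈ Finset.range (2 * N + 1), ∑ k ∈ Finset.Icc (-(n : ℤ)) n,
      (√((2 * n + 1) / (8 * Real.pi ^ 2)) : ℝ) * (f ((n : ℝ) / N) : ℝ) * dirComp K n k *
      sphHarm n k θ φ := by
  have e : ∀ n : ℕ, κ ((n : ℝ) / N) = f ((n : ℝ) / N) := fun n => (hfκ _ (by positivity)).symm
  simp only [waveletPolar, e]
  refine tsum_eq_sum fun n hn => ?_
  have := suppIn_comp_div hf (fun _ => 1) N n (Or.inr (by simpa using hn))
  simp only [mul_one] at this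
  simp [this]

/-- Valid for every `N ≥ 1`, unlike the decay estimates, and therefore able to absorb the finitely
many small `N`. -/
lemma norm_waveletPolar_le_sq {f : ℝ → ℝ} {κ : ℝ → ℝ} {B : ℝ} (hfκ : ∀ t, 0 ≤ t → f t = κ t)
    (hf : ∀ t, f t ≠ 0 → t ∈ Icc (1 / 2 : ℝ) 2) (hB : ∀ t, |f t| ≤ B) (K : ℕ) :
    ∃ C : ℝ, ∀ N : ℕ, 1 ≤ N → ∀ θ φ, ‖waveletPolar κ K N θ φ‖ ≤ C * (N : ℝ) ^ 2 := by
  have hB0 : 0 ≤ B := (abs_nonneg _).trans (hB 0)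
  set D : ℝ := (1 + (K : ℝ)) ^ K
  refine ⟨15 * (2 * K + 1) * (B * D), fun N hN θ φ => ?_⟩
  have hN1 : (1 : ℝ) ≤ N := by exact_mod_cast hN
  rw [waveletPolar_eq_sum_range hfκ hf]
  have hterm : ∀ n ∈ Finset.range (2 * N + 1), ‖∑ k ∈ Finset.Icc (-(n : ℤ)) n,
      (√((2 * n + 1) / (8 * Real.pi ^ 2)) : ℝ) * (f ((n : ℝ) / N) : ℝ) * dirComp K n k *
      sphHarm n k θ φ‖ ≤ (2 * K + 1) * (5 * N * (B * D)) := by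
    intro n hn
    rw [Finset.mem_range] at hn
    have hn' : (n : ℝ) ≤ 2 * N := by exact_mod_cast (by omega : n ≤ 2 * N)
    have hsub : Finset.Icc (-(n : ℤ)) n ∩ Finset.Icc (-(K : ℤ)) K ⊆ Finset.Icc (-(n : ℤ)) n :=
      Finset.inter_subset_left
    rw [← Finset.sum_subset hsub (fun k hk hk' => by
      have : (K : ℤ) - 1 < |k| := by
        simp only [Finset.mem_inter, Finset.mem_Icc, not_and] at hk hk'
        have := hk' hk
        rw [lt_abs]
        omega
      rw [dirComp_eq_zero this]; simp)]
    refine (norm_sum_le _ _).trans ?_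
    have hb : ∀ k ∈ Finset.Icc (-(n : ℤ)) n ∩ Finset.Icc (-(K : ℤ)) K,
        ‖(√((2 * n + 1) / (8 * Real.pi ^ 2)) : ℝ) * (f ((n : ℝ) / N) : ℝ) * dirComp K n k *
        sphHarm n k θ φ‖ ≤ 5 * N * (B * D) := by
      intro k hk
      simp only [Finset.mem_inter, Finset.mem_Icc] at hk
      have hkn : k.natAbs ≤ n := by omega
      have hkK : k.natAbs ≤ K := by omega
      rw [wavelet_term_eq hkn, norm_mul, norm_mul, norm_mul, norm_orderPhase, mul_one,
        Complex.norm_real, Complex.norm_real, Real.norm_of_nonneg waveletConst_nonneg, Real.norm_eq_abs,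
        sqrt_mul_assocLegendreNat hkn, abs_mul, abs_mul, abs_mul]
      have b1 : |2 * (n : ℝ) + 1| ≤ 5 * N := by rw [abs_of_nonneg (by positivity)]; linarith
      have b2 := hB ((n : ℝ) / N)
      have b3 : |legendreRatio k.natAbs n| ≤ D := by
        rw [abs_of_nonneg (show 0 ≤ legendreRatio k.natAbs n from Real.sqrt_nonneg _)]
        refine (legendreRatio_le hkn).trans ?_
        have h1 : (k.natAbs : ℝ) ≤ K := by exact_mod_cast hkK
        have h2 : (1 : ℝ) ≤ 1 + K := by linarith [(Nat.cast_nonneg K : (0 : ℝ) ≤ K)]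
        calc (1 + (k.natAbs : ℝ)) ^ k.natAbs ≤ (1 + (K : ℝ)) ^ k.natAbs := by gcongr
          _ ≤ (1 + (K : ℝ)) ^ K := pow_le_pow_right₀ h2 hkK
      have b4 := abs_legendreQ_le k.natAbs n (x := Real.cos θ)
        ⟨Real.neg_one_le_cos θ, Real.cos_le_one θ⟩
      have b5 := norm_dirComp_le K n k
      have b6 := waveletConst_le_one
      calc _ ≤ 1 * 1 * (5 * N * B * (D * 1)) := by
            have := waveletConst_nonneg
            gcongr
        _ = _ := by ring
    refine (Finset.sum_le_sum hb).trans ?_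
    rw [Finset.sum_const, nsmul_eq_mul]
    have hcard : ((Finset.Icc (-(n : ℤ)) n ∩ Finset.Icc (-(K : ℤ)) K).card : ℝ) ≤ 2 * K + 1 := by
      have := Finset.card_le_card (Finset.inter_subset_right (s₁ := Finset.Icc (-(n : ℤ)) n) (s₂ := Finset.Icc (-(K : ℤ)) K))
      rw [Int.card_Icc] at this
      exact_mod_cast (by omega : (Finset.Icc (-(n : ℤ)) n ∩ Finset.Icc (-(K : ℤ)) K).card ≤ 2 * K + 1)
    gcongr
  refine (norm_sum_le _ _).trans ((Finset.sum_le_sum hterm).trans ?_)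
  rw [Finset.sum_const, Finset.card_range, nsmul_eq_mul]
  calc ((2 * N + 1 : ℕ) : ℝ) * ((2 * K + 1) * (5 * N * (B * D)))
      ≤ (3 * N) * ((2 * K + 1) * (5 * N * (B * D))) := by
        have : ((2 * N + 1 : ℕ) : ℝ) ≤ 3 * N := by push_cast; linarith
        gcongr
    _ = _ := by ring

lemma waveletPolar_eq_sum_orderSum {f : ℝ → ℝ} {κ : ℝ → ℝ} (hfκ : ∀ t, 0 ≤ t → f t = κ t)
    (hf : ∀ t, f t ≠ 0 → t ∈ Icc (1 / 2 : ℝ) 2) {K N : ℕ} (hN : 2 * K ≤ N) (θ φ : ℝ) :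
    waveletPolar κ K N θ φ = ∑ k ∈ Finset.Icc (-((K : ℤ) - 1)) (K - 1),
      (waveletConst : ℂ) * dirComp K K k * orderPhase k φ *
        (orderSum f k.natAbs N (Real.cos θ) : ℝ) := by
  rw [waveletPolar_eq_sum_range hfκ hf]
  simp only [orderSum]
  push_cast
  simp only [Finset.mul_sum]
  rw [Finset.sum_comm]
  refine Finset.sum_congr rfl fun n _ => ?_
  by_cases h0 : f ((n : ℝ) / N) = 0
  · simp [h0]
  have hKn : K ≤ n := by
    by_contra hlt
    have := suppIn_comp_div hf (fun _ => 1) N n (Or.inl (by omega))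
    simp only [mul_one] at this
    exact h0 this
  have hsub : Finset.Icc (-((K : ℤ) - 1)) (K - 1) ⊆ Finset.Icc (-(n : ℤ)) n :=
    Finset.Icc_subset_Icc (by omega) (by omega)
  rw [← Finset.sum_subset hsub (fun k _ hk' => by
      have : (K : ℤ) - 1 < |k| := by
        simp only [Finset.mem_Icc] at hk'
        rw [lt_abs]
        omega
      rw [dirComp_eq_zero this]; simp)]
  refine Finset.sum_congr rfl fun k hk => ?_
  simp only [Finset.mem_Icc] at hk
  have := wavelet_term_eq (n := n) (k := k) (by omega) (f ((n : ℝ) / N)) (dirComp K n k) θ φ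
  push_cast at this
  rw [this, dirComp_eq_of_le hKn]

/-- Localization of the directional wavelets. -/
theorem exists_norm_waveletPolar_le {K m l : ℕ} (hml : m ≤ l) (hl : m + 1 ≤ l ∨ K = 1)
    {κ : ℝ → ℝ} (hκ : ContDiffOn ℝ l κ (Ici 0))
    (hsupp : ∀ t, 0 ≤ t → κ t ≠ 0 → t ∈ Icc (1 / 2 : ℝ) 2) :
    ∃ C : ℝ, 0 ≤ C ∧ ∀ N : ℕ, 1 ≤ N → ∀ θ ∈ Icc 0 Real.pi, ∀ φ,
      ‖waveletPolar κ K N θ φ‖ ≤ C * (N : ℝ) ^ 2 ∧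
      ((N : ℝ) * θ) ^ m * ‖waveletPolar κ K N θ φ‖ ≤ C * (N : ℝ) ^ 2 := by
  obtain ⟨f, B, hc, hfκ, hf, hB⟩ := exists_contDiff_extension hκ hsupp
  obtain ⟨C₁, hC₁⟩ := norm_waveletPolar_le_sq hfκ hf (B := B)
    (fun t => by simpa using hB 0 (Nat.zero_le _) t) K
  have hex : ∀ k : ℤ, ∃ (C : ℝ) (N₀ : ℕ), k ∈ Finset.Icc (-((K : ℤ) - 1)) (K - 1) →
      ∀ N, N₀ < N → ∀ θ ∈ Icc 0 Real.pi,
      ((N : ℝ) * θ) ^ m * |orderSum f k.natAbs N (Real.cos θ)| ≤ C * (N : ℝ) ^ 2 := by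
    intro k
    by_cases hk : k ∈ Finset.Icc (-((K : ℤ) - 1)) (K - 1)
    · obtain ⟨C, N₀, h⟩ := orderSum_le m l k.natAbs hml (hl.imp_right fun h => by
        subst h; simpa using hk) hc hB hf
      exact ⟨C, N₀, fun _ => h⟩
    · exact ⟨0, 0, fun h => absurd h hk⟩
  choose C₂ N₂ h₂ using hex
  set S := Finset.Icc (-((K : ℤ) - 1)) (K - 1)
  -- A common threshold: beyond it the degrees in the support are at least `K` and all the estimates
  -- for the separate orders hold.
  set N₃ := 2 * K + ∑ k ∈ S, N₂ k with hN₃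
  set C₄ := (N₃ * Real.pi) ^ m * |C₁|
  set C₅ := ∑ k ∈ S, |C₂ k|
  have hC₄ : 0 ≤ C₄ := by have := Real.pi_pos; positivity
  have hC₅ : 0 ≤ C₅ := Finset.sum_nonneg fun _ _ => abs_nonneg _
  refine ⟨|C₁| + C₄ + C₅, by positivity, fun N hN θ hθ φ => ?_⟩
  have hN2 : (0 : ℝ) ≤ (N : ℝ) ^ 2 := by positivity
  have hb1 : ‖waveletPolar κ K N θ φ‖ ≤ |C₁| * (N : ℝ) ^ 2 :=
    (hC₁ N hN θ φ).trans (by gcongr; exact le_abs_self _)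
  refine ⟨hb1.trans (by gcongr; linarith), ?_⟩
  have hθ0 := hθ.1
  by_cases hNN : N ≤ N₃
  · have h1 : (N : ℝ) * θ ≤ N₃ * Real.pi := by
      have := hθ.2
      gcongr
    calc ((N : ℝ) * θ) ^ m * ‖waveletPolar κ K N θ φ‖
        ≤ (N₃ * Real.pi) ^ m * (|C₁| * (N : ℝ) ^ 2) := by
          have := Real.pi_pos
          gcongr
      _ = C₄ * (N : ℝ) ^ 2 := by ring
      _ ≤ _ := by gcongr; linarith [abs_nonneg C₁]
  · rw [waveletPolar_eq_sum_orderSum hfκ hf (by omega)]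
    calc _ ≤ ((N : ℝ) * θ) ^ m * ∑ k ∈ S, |orderSum f k.natAbs N (Real.cos θ)| := by
          gcongr
          refine (norm_sum_le _ _).trans (Finset.sum_le_sum fun k _ => ?_)
          rw [norm_mul, norm_mul, norm_mul, norm_orderPhase, mul_one, Complex.norm_real,
            Complex.norm_real, Real.norm_of_nonneg waveletConst_nonneg, Real.norm_eq_abs]
          exact mul_le_of_le_one_left (abs_nonneg _)
            (mul_le_one₀ waveletConst_le_one (norm_nonneg _) (norm_dirComp_le _ _ _))
      _ = ∑ k ∈ S, ((N : ℝ) * θ) ^ m * |orderSum f k.natAbs N (Real.cos θ)| := Finset.mul_sum _ _ _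
      _ ≤ ∑ k ∈ S, |C₂ k| * (N : ℝ) ^ 2 := by
          refine Finset.sum_le_sum fun k hk => ?_
          have hlt : N₂ k < N := by
            have := Finset.single_le_sum (f := N₂) (fun _ _ => Nat.zero_le _) hk
            omega
          refine (h₂ k hk N hlt θ hθ).trans ?_
          gcongr
          exact le_abs_self _
      _ = C₅ * (N : ℝ) ^ 2 := (Finset.sum_mul _ _ _).symm
      _ ≤ _ := by gcongr; linarith [abs_nonneg C₁]

/-! ### Surface measure of balls and bands -/

/-- Fubini along `b 0`: the set lies over a rectangle of area `4 α β`, and a subset of the line has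
measure at most its diameter. -/
lemma volume_le_of_slices (b : OrthonormalBasis (Fin 3) ℝ E3) {S : Set E3} (hS : MeasurableSet S)
    {α β γ : ℝ} (hα : 0 ≤ α) (hγ : 0 ≤ γ)
    (h1 : ∀ Y ∈ S, |inner ℝ (b 1) Y| ≤ α) (h2 : ∀ Y ∈ S, |inner ℝ (b 2) Y| ≤ β)
    (h0 : ∀ Y ∈ S, ∀ Y' ∈ S, inner ℝ (b 1) Y = inner ℝ (b 1) Y' →
      inner ℝ (b 2) Y = inner ℝ (b 2) Y' → |inner ℝ (b 0) Y - inner ℝ (b 0) Y'| ≤ γ) :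
    volume S ≤ ENNReal.ofReal (4 * α * β * γ) := by
  have mp1 := b.measurePreserving_repr_symm
  have mp2 := (EuclideanSpace.volume_preserving_symm_measurableEquiv_toLp (Fin 3)).symm
  have mp3 := (volume_preserving_piFinSuccAbove (fun _ : Fin 3 => ℝ) 0).symm
  have mp := mp1.comp (mp2.comp mp3)
  set F : ℝ × (Fin 2 → ℝ) → E3 := _ with hF
  have mpF : MeasurePreserving F volume volume := mp
  have hcoord : ∀ p : ℝ × (Fin 2 → ℝ), inner ℝ (b 0) (F p) = p.1 ∧ inner ℝ (b 1) (F p) = p.2 0 ∧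
      inner ℝ (b 2) (F p) = p.2 1 := by
    intro p
    simp only [← b.repr_apply_apply]
    refine ⟨?_, ?_, ?_⟩
    · simp [hF]
    · simp [hF]
    · simp [hF]
      rfl
  rw [← mpF.measure_preimage hS.nullMeasurableSet, Measure.volume_eq_prod,
    Measure.prod_apply_symm (mpF.measurable hS)]
  set box : Set (Fin 2 → ℝ) := Icc ![-α, -β] ![α, β]
  have hslice : ∀ y : Fin 2 → ℝ, volume ((fun x => (x, y)) ⁻¹' (F ⁻¹' S)) ≤
      box.indicator (fun _ => ENNReal.ofReal γ) y := by
    intro y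
    by_cases hy : y ∈ box
    · rw [indicator_of_mem hy]
      refine (Real.volume_le_diam _).trans (Metric.ediam_le fun x hx x' hx' => ?_)
      have c := hcoord (x, y)
      have c' := hcoord (x', y)
      have := h0 _ hx _ hx' (by rw [c.2.1, c'.2.1]) (by rw [c.2.2, c'.2.2])
      rw [c.1, c'.1] at this
      rw [edist_dist]
      exact ENNReal.ofReal_le_ofReal this
    · rw [indicator_of_notMem hy]
      refine le_of_eq (measure_mono_null (t := ∅) (fun x hx => ?_) measure_empty)
      apply hy
      have c := hcoord (x, y)
      have e1 := abs_le.1 (c.2.1 ▸ h1 _ hx)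
      have e2 := abs_le.1 (c.2.2 ▸ h2 _ hx)
      constructor <;> intro i <;> fin_cases i <;> simp <;> linarith
  refine (lintegral_mono hslice).trans ?_
  rw [lintegral_indicator_const measurableSet_Icc, Real.volume_Icc_pi]
  simp only [Fin.prod_univ_two]
  rw [← ENNReal.ofReal_mul (by simp; linarith), ← ENNReal.ofReal_mul hγ]
  apply ENNReal.ofReal_le_ofReal
  simp
  apply le_of_eq
  ring

lemma exists_orthonormalBasis_extending {v : Fin 3 → E3} {s : Set (Fin 3)}
    (hv : Orthonormal ℝ (s.domRestrict v)) :
    ∃ b : OrthonormalBasis (Fin 3) ℝ E3, ∀ i ∈ s, b i = v i :=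
  hv.exists_orthonormalBasis_extension_of_card_eq (by simp)

/-- The surface measure is three times the volume of the cone over the set, so surface areas reduce
to volumes of solids. -/
lemma surf_le_of_cone {S : Set S2} (hS : MeasurableSet S) {S' : Set E3}
    (h : ∀ y ∈ S, ∀ ξ ∈ Ioo (0 : ℝ) 1, ξ • (y : E3) ∈ S') : surf S ≤ 3 * volume S' := by
  rw [surf, Measure.toSphere_apply' _ hS]
  simp only [finrank_euclideanSpace, Fintype.card_fin, Nat.cast_ofNat]
  gcongr
  rintro _ ⟨ξ, hξ, _, ⟨y, hy, rfl⟩, rfl⟩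
  exact h y hy ξ hξ

lemma S2.norm_eq (y : S2) : ‖(y : E3)‖ = 1 := by
  simp

lemma surf_closedBall_le {x : E3} (hx : ‖x‖ = 1) {t : ℝ} (ht : 0 ≤ t) :
    surf {y : S2 | ‖(y : E3) - x‖ ≤ t} ≤ ENNReal.ofReal (24 * t ^ 2) := by
  obtain ⟨b, hb⟩ := exists_orthonormalBasis_extending (v := fun _ => x) (s := {0}) (by
    constructor
    · intro i; simpa using hx
    · intro i j hij; exact absurd (Subsingleton.elim i j) hij)
  have hb0 : b 0 = x := hb 0 rfl
  have hm : MeasurableSet {y : S2 | ‖(y : E3) - x‖ ≤ t} :=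
    (isClosed_le (by fun_prop) continuous_const).measurableSet
  set S' : Set E3 := {Y | |inner ℝ (b 0) Y| ≤ 1 ∧ |inner ℝ (b 1) Y| ≤ t ∧ |inner ℝ (b 2) Y| ≤ t}
  have hS' : MeasurableSet S' := by
    apply IsClosed.measurableSet
    simp only [S', ofPred_and]
    refine IsClosed.inter ?_ (IsClosed.inter ?_ ?_) <;> exact isClosed_le (by fun_prop) (by fun_prop)
  refine (surf_le_of_cone hm (S' := S') ?_).trans ?_
  · intro y hy ξ hξ
    have hξ1 : |ξ| ≤ 1 := by rw [abs_of_pos hξ.1]; exact hξ.2.le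
    have hbd : ∀ i, |inner ℝ (b i) (ξ • (y : E3))| ≤ |inner ℝ (b i) (y : E3)| := by
      intro i
      rw [inner_smul_right, abs_mul]
      exact mul_le_of_le_one_left (abs_nonneg _) hξ1
    have hi : ∀ i : Fin 3, i ≠ 0 → |inner ℝ (b i) (y : E3)| ≤ t := by
      intro i hi
      have h0 : inner ℝ (b i) x = 0 := by rw [← hb0]; exact b.orthonormal.2 hi
      have : inner ℝ (b i) (y : E3) = inner ℝ (b i) ((y : E3) - x) := by rw [inner_sub_right, h0, sub_zero]
      rw [this]
      refine (abs_real_inner_le_norm _ _).trans ?_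
      rw [b.norm_eq_one, one_mul]
      exact hy
    refine ⟨(hbd 0).trans ?_, (hbd 1).trans (hi 1 (by decide)), (hbd 2).trans (hi 2 (by decide))⟩
    refine (abs_real_inner_le_norm _ _).trans ?_
    rw [b.norm_eq_one, one_mul, S2.norm_eq]
  · have := volume_le_of_slices b hS' ht (γ := 2) (by norm_num) (fun Y hY => hY.2.1)
      (fun Y hY => hY.2.2) (fun Y hY Y' hY' _ _ => by
        have := abs_le.1 hY.1
        have := abs_le.1 hY'.1
        rw [abs_le]; constructor <;> linarith)
    calc 3 * volume S' ≤ 3 * ENNReal.ofReal (4 * t * t * 2) := by gcongr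
      _ = ENNReal.ofReal (24 * t ^ 2) := by
        rw [show (3 : ENNReal) = ENNReal.ofReal 3 by simp, ← ENNReal.ofReal_mul (by norm_num)]
        congr 1; ring

/-- The cone over the band satisfies `|⟨z, Y⟩ - c ‖Y‖| ≤ h`. On a line parallel to `z` the norm is
1-Lipschitz, so the left-hand function grows at rate at least `1 - |c|`, and the slices have length
at most `2 h / (1 - |c|)`. -/
lemma surf_band_le {z T : E3} (hz : ‖z‖ = 1) (hT : ‖T‖ = 1) (hzT : inner ℝ z T = 0) {c h ρ : ℝ}
    (hc : |c| < 1) (hh : 0 ≤ h) (hρ : 0 ≤ ρ) :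
    surf {y : S2 | |inner ℝ z (y : E3) - c| ≤ h ∧ |inner ℝ T (y : E3)| ≤ ρ} ≤
      ENNReal.ofReal (24 * ρ * h / (1 - |c|)) := by
  obtain ⟨b, hb⟩ := exists_orthonormalBasis_extending (v := ![z, T, 0]) (s := {0, 1}) (by
    have hTz : inner ℝ T z = 0 := by rw [real_inner_comm]; exact hzT
    constructor
    · rintro ⟨i, rfl | rfl⟩ <;> simp [hz, hT]
    · rintro ⟨i, rfl | rfl⟩ ⟨j, rfl | rfl⟩ hij <;> simp_all)
  have hb0 : b 0 = z := hb 0 (by simp)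
  have hb1 : b 1 = T := hb 1 (by simp)
  have hc' : 0 < 1 - |c| := by linarith
  have hm : MeasurableSet {y : S2 | |inner ℝ z (y : E3) - c| ≤ h ∧ |inner ℝ T (y : E3)| ≤ ρ} := by
    apply IsClosed.measurableSet
    simp only [ofPred_and]
    refine IsClosed.inter ?_ ?_ <;> exact isClosed_le (by fun_prop) (by fun_prop)
  set S' : Set E3 := {Y | |inner ℝ (b 0) Y - c * ‖Y‖| ≤ h ∧ |inner ℝ (b 1) Y| ≤ ρ ∧
    |inner ℝ (b 2) Y| ≤ 1}
  have hS' : MeasurableSet S' := by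
    apply IsClosed.measurableSet
    simp only [S', ofPred_and]
    refine IsClosed.inter ?_ (IsClosed.inter ?_ ?_) <;> exact isClosed_le (by fun_prop) (by fun_prop)
  refine (surf_le_of_cone hm (S' := S') ?_).trans ?_
  · rintro y ⟨hy1, hy2⟩ ξ hξ
    have hξ1 : |ξ| ≤ 1 := by rw [abs_of_pos hξ.1]; exact hξ.2.le
    have hmul : ∀ {s t : ℝ}, |s| ≤ t → |ξ * s| ≤ t := by
      intro s t hst
      rw [abs_mul]
      exact (mul_le_of_le_one_left (abs_nonneg _) hξ1).trans hst
    refine ⟨?_, ?_, ?_⟩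
    · rw [norm_smul, S2.norm_eq, inner_smul_right, hb0, Real.norm_of_nonneg hξ.1.le,
        show ξ * inner ℝ z (y : E3) - c * (ξ * 1) = ξ * (inner ℝ z (y : E3) - c) by ring]
      exact hmul hy1
    · rw [inner_smul_right, hb1]; exact hmul hy2
    · rw [inner_smul_right]
      refine hmul ((abs_real_inner_le_norm _ _).trans ?_)
      rw [b.norm_eq_one, one_mul, S2.norm_eq]
  · have := volume_le_of_slices b hS' hρ (γ := 2 * h / (1 - |c|)) (by positivity)
      (fun Y hY => hY.2.1) (fun Y hY => hY.2.2) (fun Y hY Y' hY' e1 e2 => by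
        have hd : ‖Y - Y'‖ = |inner ℝ (b 0) Y - inner ℝ (b 0) Y'| := by
          have := b.sum_sq_norm_inner_right (Y - Y')
          simp only [Fin.sum_univ_three, inner_sub_right, e1, e2, sub_self, norm_zero] at this
          rw [← abs_norm, ← sq_eq_sq_iff_abs_eq_abs, ← this]
          simp
        have hn : |‖Y‖ - ‖Y'‖| ≤ |inner ℝ (b 0) Y - inner ℝ (b 0) Y'| :=
          hd ▸ abs_norm_sub_norm_le Y Y'
        have a1 := abs_le.1 hY.1
        have a2 := abs_le.1 hY'.1
        set Z := inner ℝ (b 0) Y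
        set Z' := inner ℝ (b 0) Y'
        have hcc : |c * (‖Y‖ - ‖Y'‖)| ≤ |c| * |Z - Z'| := by
          rw [abs_mul]; gcongr
        have hcc' := abs_le.1 hcc
        have : |Z - Z'| ≤ 2 * h + |c| * |Z - Z'| := by
          rw [abs_le]
          constructor <;> nlinarith [hcc'.1, hcc'.2, a1.1, a1.2, a2.1, a2.2]
        rw [le_div_iff₀ hc']
        linarith)
    calc 3 * volume S' ≤ 3 * ENNReal.ofReal (4 * ρ * 1 * (2 * h / (1 - |c|))) := by gcongr
      _ = ENNReal.ofReal (24 * ρ * h / (1 - |c|)) := by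
        rw [show (3 : ENNReal) = ENNReal.ofReal 3 by simp, ← ENNReal.ofReal_mul (by norm_num)]
        congr 1; ring

/-! ### Geodesic distance, tail integrals, and null curves -/

lemma inner_eq_cos_geoDist {x y : E3} (hx : ‖x‖ = 1) (hy : ‖y‖ = 1) :
    inner ℝ x y = Real.cos (geoDist x y) := by
  have h := abs_le.1 (abs_real_inner_le_norm x y)
  rw [hx, hy, mul_one] at h
  rw [geoDist, Real.cos_arccos h.1 h.2]

lemma norm_sub_sq_eq {x y : E3} (hx : ‖x‖ = 1) (hy : ‖y‖ = 1) :
    ‖x - y‖ ^ 2 = 2 - 2 * inner ℝ x y := by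
  rw [norm_sub_sq_real, hx, hy]; ring

lemma geoDist_nonneg (x y : E3) : 0 ≤ geoDist x y := Real.arccos_nonneg _

lemma geoDist_le_pi (x y : E3) : geoDist x y ≤ Real.pi := Real.arccos_le_pi _

lemma geoDist_comm (x y : E3) : geoDist x y = geoDist y x := by
  rw [geoDist, geoDist, real_inner_comm]

lemma norm_sub_le_geoDist {x y : E3} (hx : ‖x‖ = 1) (hy : ‖y‖ = 1) : ‖x - y‖ ≤ geoDist x y := by
  have h := norm_sub_sq_eq hx hy
  rw [inner_eq_cos_geoDist hx hy] at h
  have h2 := Real.one_sub_sq_div_two_le_cos (x := geoDist x y)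
  exact le_of_sq_le_sq (by linarith) (geoDist_nonneg _ _)

lemma geoDist_le_two_mul_norm_sub {x y : E3} (hx : ‖x‖ = 1) (hy : ‖y‖ = 1) :
    geoDist x y ≤ 2 * ‖x - y‖ := by
  have h := norm_sub_sq_eq hx hy
  rw [inner_eq_cos_geoDist hx hy] at h
  have h2 := Real.cos_le_one_sub_mul_cos_sq (x := geoDist x y)
    (by rw [abs_of_nonneg (geoDist_nonneg _ _)]; exact geoDist_le_pi _ _)
  have hπ := Real.pi_lt_four
  have hπ0 := Real.pi_pos
  have h3 : (1 : ℝ) / 8 ≤ 2 / Real.pi ^ 2 := by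
    rw [div_le_div_iff₀ (by norm_num) (by positivity)]
    nlinarith
  refine le_of_sq_le_sq ?_ (by positivity)
  nlinarith [mul_le_mul_of_nonneg_right h3 (sq_nonneg (geoDist x y))]

lemma geoDist_triangle {x y z : E3} (hx : ‖x‖ = 1) (hy : ‖y‖ = 1) (hz : ‖z‖ = 1) :
    geoDist x z ≤ geoDist x y + geoDist y z := by
  have h := InnerProductGeometry.angle_le_angle_add_angle x y z
  simpa [geoDist, InnerProductGeometry.angle, hx, hy, hz] using h

lemma measurable_geoDist (x : E3) : Measurable fun y : S2 => geoDist (y : E3) x := by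
  have : Continuous fun y : S2 => geoDist (y : E3) x := by
    unfold geoDist
    exact Real.continuous_arccos.comp (by fun_prop)
  exact this.measurable

lemma surf_geoDist_le {x : E3} (hx : ‖x‖ = 1) {t : ℝ} (ht : 0 ≤ t) :
    surf {y : S2 | geoDist (y : E3) x ≤ t} ≤ ENNReal.ofReal (24 * t ^ 2) :=
  (measure_mono fun y hy => (norm_sub_le_geoDist (S2.norm_eq y) hx).trans hy).trans
    (surf_closedBall_le hx ht)

/-- Dyadic decomposition of the integral of a negative power of the distance. -/
lemma lintegral_geoDist_inv_pow_le {x : E3} (hx : ‖x‖ = 1) {r : ℝ} (hr : 0 < r) {m : ℕ} (hm : 3 ≤ m) :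
    ∫⁻ y in {y : S2 | r ≤ geoDist (y : E3) x}, ENNReal.ofReal ((geoDist (y : E3) x ^ m)⁻¹) ∂surf ≤
      ENNReal.ofReal (192 * r ^ 2 * (r ^ m)⁻¹) := by
  set E : ℕ → Set S2 := fun j => {y | 2 ^ j * r ≤ geoDist (y : E3) x ∧ geoDist (y : E3) x ≤ 2 ^ (j + 1) * r}
  have hE : ∀ j, MeasurableSet (E j) := fun j =>
    (measurableSet_le measurable_const (measurable_geoDist x)).inter
      (measurableSet_le (measurable_geoDist x) measurable_const)
  have hcover : {y : S2 | r ≤ geoDist (y : E3) x} ⊆ ⋃ j, E j := by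
    intro y hy
    obtain ⟨j, h1, h2⟩ := exists_nat_pow_near (x := geoDist (y : E3) x / r) (y := 2)
      (by rw [le_div_iff₀ hr, one_mul]; exact hy) (by norm_num)
    rw [le_div_iff₀ hr] at h1
    rw [div_lt_iff₀ hr] at h2
    exact mem_iUnion.2 ⟨j, h1, h2.le⟩
  have hpiece : ∀ j, ∫⁻ y in E j, ENNReal.ofReal ((geoDist (y : E3) x ^ m)⁻¹) ∂surf ≤
      ENNReal.ofReal (96 * r ^ 2 * (r ^ m)⁻¹ * (1 / 2) ^ j) := by
    intro j
    have hjr : 0 < 2 ^ j * r := by positivity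
    calc ∫⁻ y in E j, ENNReal.ofReal ((geoDist (y : E3) x ^ m)⁻¹) ∂surf
        ≤ ∫⁻ _ in E j, ENNReal.ofReal (((2 ^ j * r) ^ m)⁻¹) ∂surf := by
          refine setLIntegral_mono measurable_const fun y hy => ENNReal.ofReal_le_ofReal ?_
          exact inv_anti₀ (by positivity) (pow_le_pow_left₀ hjr.le hy.1 _)
      _ = ENNReal.ofReal (((2 ^ j * r) ^ m)⁻¹) * surf (E j) := setLIntegral_const _ _
      _ ≤ ENNReal.ofReal (((2 ^ j * r) ^ m)⁻¹) * ENNReal.ofReal (24 * (2 ^ (j + 1) * r) ^ 2) := by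
          gcongr
          exact (measure_mono fun y hy => hy.2).trans (surf_geoDist_le hx (by positivity))
      _ = ENNReal.ofReal (((2 ^ j * r) ^ m)⁻¹ * (24 * (2 ^ (j + 1) * r) ^ 2)) :=
          (ENNReal.ofReal_mul (by positivity)).symm
      _ ≤ _ := by
          apply ENNReal.ofReal_le_ofReal
          -- The area of the `j`-th ring grows like `4 ^ j`, so `m ≥ 3` leaves a geometric factor `2
          -- ^ (-j)`.
          have h2 : ((2 : ℝ) ^ j) ^ 3 ≤ ((2 : ℝ) ^ j) ^ m :=
            pow_le_pow_right₀ (one_le_pow₀ (by norm_num)) hm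
          have h3 : (((2 : ℝ) ^ j) ^ m)⁻¹ * ((2 : ℝ) ^ j) ^ 2 ≤ (1 / 2) ^ j := by
            rw [inv_mul_le_iff₀ (by positivity), one_div, inv_pow]
            calc ((2 : ℝ) ^ j) ^ 2 = ((2 : ℝ) ^ j) ^ 3 * ((2 : ℝ) ^ j)⁻¹ := by field_simp
              _ ≤ _ := by gcongr
          calc ((2 ^ j * r) ^ m)⁻¹ * (24 * (2 ^ (j + 1) * r) ^ 2)
              = 96 * r ^ 2 * (r ^ m)⁻¹ * ((((2 : ℝ) ^ j) ^ m)⁻¹ * ((2 : ℝ) ^ j) ^ 2) := by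
                rw [mul_pow, mul_inv]; ring
            _ ≤ _ := by gcongr
  calc _ ≤ ∫⁻ y in ⋃ j, E j, ENNReal.ofReal ((geoDist (y : E3) x ^ m)⁻¹) ∂surf :=
        lintegral_mono_set hcover
    _ ≤ ∑' j, ∫⁻ y in E j, ENNReal.ofReal ((geoDist (y : E3) x ^ m)⁻¹) ∂surf := lintegral_iUnion_le _ _
    _ ≤ ∑' j : ℕ, ENNReal.ofReal (96 * r ^ 2 * (r ^ m)⁻¹ * (1 / 2) ^ j) := ENNReal.tsum_le_tsum hpiece
    _ = ENNReal.ofReal (∑' j : ℕ, 96 * r ^ 2 * (r ^ m)⁻¹ * (1 / 2) ^ j) :=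
        (ENNReal.ofReal_tsum_of_nonneg (fun _ => by positivity)
          (summable_geometric_two.mul_left _)).symm
    _ = _ := by
        rw [tsum_mul_left, tsum_geometric_two]
        congr 1; ring

/-- A Lipschitz curve on the sphere is a null set. -/
lemma surf_image_eq_zero {v : ℝ → E3} {L : ℝ} (hL : 0 < L) (hv : ∀ t ∈ Icc 0 L, ‖v t‖ = 1)
    (hlip : ∀ s ∈ Icc 0 L, ∀ t ∈ Icc 0 L, ‖v s - v t‖ ≤ |s - t|) :
    surf {y : S2 | (y : E3) ∈ v '' Icc 0 L} = 0 := by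
  -- Balls of radius `L / (n + 1)` about `n + 2` equally spaced points of the curve cover it, and
  -- their total area is `O(1 / n)`.
  have hbound : ∀ n : ℕ, surf {y : S2 | (y : E3) ∈ v '' Icc 0 L} ≤
      ENNReal.ofReal (48 * L ^ 2 * (1 / ((n : ℝ) + 1))) := by
    intro n
    set h : ℝ := L / (n + 1) with hh
    have hn : (0 : ℝ) < n + 1 := by positivity
    have hh0 : 0 < h := by positivity
    have hmem : ∀ i ∈ Finset.range (n + 2), (i : ℝ) * h ∈ Icc 0 L ∨ (n + 1 < i) := by
      intro i hi
      left
      have : (i : ℝ) ≤ n + 1 := by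
        have := Finset.mem_range.1 hi
        exact_mod_cast (by omega : i ≤ n + 1)
      refine ⟨by positivity, ?_⟩
      rw [hh, mul_div_assoc', div_le_iff₀ hn]
      nlinarith
    have hcov : {y : S2 | (y : E3) ∈ v '' Icc 0 L} ⊆
        ⋃ i ∈ Finset.range (n + 2), {y : S2 | ‖(y : E3) - v (i * h)‖ ≤ h} := by
      rintro y ⟨t, ht, hty⟩
      have hfl : ⌊t / h⌋₊ ∈ Finset.range (n + 2) := by
        rw [Finset.mem_range, Nat.floor_lt (div_nonneg ht.1 hh0.le), div_lt_iff₀ hh0, hh]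
        push_cast
        rw [mul_div_assoc', lt_div_iff₀ hn]
        nlinarith [ht.2]
      refine mem_biUnion hfl ?_
      have h1 := Nat.floor_le (div_nonneg ht.1 hh0.le)
      have h2 := Nat.lt_floor_add_one (t / h)
      rw [le_div_iff₀ hh0] at h1
      rw [div_lt_iff₀ hh0] at h2
      change ‖(y : E3) - v _‖ ≤ h
      rw [← hty]
      refine (hlip t ht _ ?_).trans ?_
      · exact ⟨by positivity, h1.trans ht.2⟩
      · rw [abs_le]; constructor <;> linarith
    calc _ ≤ surf (⋃ i ∈ Finset.range (n + 2), {y : S2 | ‖(y : E3) - v (i * h)‖ ≤ h}) :=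
          measure_mono hcov
      _ ≤ ∑ i ∈ Finset.range (n + 2), surf {y : S2 | ‖(y : E3) - v (i * h)‖ ≤ h} :=
          measure_biUnion_finset_le _ _
      _ ≤ ∑ i ∈ Finset.range (n + 2), ENNReal.ofReal (24 * h ^ 2) := by
          refine Finset.sum_le_sum fun i hi => surf_closedBall_le (hv _ ?_) hh0.le
          exact (hmem i hi).resolve_right (by have := Finset.mem_range.1 hi; omega)
      _ = ENNReal.ofReal ((n + 2 : ℕ) * (24 * h ^ 2)) := by
          rw [Finset.sum_const, Finset.card_range, nsmul_eq_mul,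
            ENNReal.ofReal_mul (p := ((n + 2 : ℕ) : ℝ)) (by positivity), ENNReal.ofReal_natCast]
      _ ≤ _ := by
          apply ENNReal.ofReal_le_ofReal
          rw [hh]
          push_cast
          rw [div_pow, mul_one_div, mul_div_assoc', mul_div_assoc', div_le_div_iff₀ (by positivity) hn]
          have : (0 : ℝ) ≤ n := by positivity
          have hL2 : 0 ≤ L ^ 2 := by positivity
          nlinarith [mul_nonneg hL2 this, mul_nonneg (mul_nonneg hL2 this) this]
  have hlim : Tendsto (fun n : ℕ => ENNReal.ofReal (48 * L ^ 2 * (1 / ((n : ℝ) + 1)))) atTop (𝓝 0) := by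
    have := (tendsto_one_div_add_atTop_nhds_zero_nat (𝕜 := ℝ)).const_mul (48 * L ^ 2)
    rw [mul_zero] at this
    have h2 := ENNReal.tendsto_ofReal this
    rwa [ENNReal.ofReal_zero] at h2
  exact le_antisymm (ge_of_tendsto' hlim hbound) (zero_le)

/-! ### Frames -/

/-- `e`, `T`, `n` is an orthonormal basis of three-space. -/
structure IsFrame (e T n : E3) : Prop where
  norm_e : ‖e‖ = 1
  norm_T : ‖T‖ = 1
  norm_n : ‖n‖ = 1
  e_T : inner ℝ e T = 0
  e_n : inner ℝ e n = 0
  T_n : inner ℝ T n = 0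

namespace IsFrame

variable {e T n : E3}

lemma T_e (h : IsFrame e T n) : inner ℝ T e = 0 := by rw [real_inner_comm]; exact h.e_T
lemma n_e (h : IsFrame e T n) : inner ℝ n e = 0 := by rw [real_inner_comm]; exact h.e_n
lemma n_T (h : IsFrame e T n) : inner ℝ n T = 0 := by rw [real_inner_comm]; exact h.T_n
lemma e_e (h : IsFrame e T n) : inner ℝ e e = 1 := by
  rw [real_inner_self_eq_norm_sq, h.norm_e]; norm_num

lemma exists_basis (h : IsFrame e T n) :
    ∃ b : OrthonormalBasis (Fin 3) ℝ E3, b 0 = e ∧ b 1 = T ∧ b 2 = n := by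
  obtain ⟨b, hb⟩ := exists_orthonormalBasis_extending (v := ![e, T, n]) (s := univ) (by
    constructor
    · rintro ⟨i, _⟩
      fin_cases i <;> simp [h.norm_e, h.norm_T, h.norm_n]
    · rintro ⟨i, _⟩ ⟨j, _⟩ hij
      fin_cases i <;> fin_cases j <;>
        simp [h.e_T, h.e_n, h.T_n, h.T_e, h.n_e, h.n_T] at hij ⊢)
  exact ⟨b, hb 0 trivial, hb 1 trivial, hb 2 trivial⟩

lemma eq_sum (h : IsFrame e T n) (y : E3) :
    y = inner ℝ y e • e + inner ℝ y T • T + inner ℝ y n • n := by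
  obtain ⟨b, rfl, rfl, rfl⟩ := h.exists_basis
  have := b.sum_repr' y
  rw [Fin.sum_univ_three] at this
  rw [real_inner_comm y (b 0), real_inner_comm y (b 1), real_inner_comm y (b 2)] at this
  exact this.symm

lemma inner_eq (h : IsFrame e T n) (y w : E3) :
    inner ℝ y w = inner ℝ y e * inner ℝ w e + inner ℝ y T * inner ℝ w T +
      inner ℝ y n * inner ℝ w n := by
  conv_lhs => rw [h.eq_sum y]
  rw [inner_add_left, inner_add_left, real_inner_smul_left, real_inner_smul_left,
    real_inner_smul_left, real_inner_comm w e, real_inner_comm w T, real_inner_comm w n]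

lemma norm_sq_eq (h : IsFrame e T n) (y : E3) :
    ‖y‖ ^ 2 = inner ℝ y e ^ 2 + inner ℝ y T ^ 2 + inner ℝ y n ^ 2 := by
  rw [← real_inner_self_eq_norm_sq, h.inner_eq]; ring

lemma ext (h : IsFrame e T n) {y w : E3} (h1 : inner ℝ y e = inner ℝ w e)
    (h2 : inner ℝ y T = inner ℝ w T) (h3 : inner ℝ y n = inner ℝ w n) : y = w := by
  rw [h.eq_sum y, h.eq_sum w, h1, h2, h3]

lemma comb (h : IsFrame e T n) (a b c : ℝ) :
    inner ℝ (a • e + b • T + c • n) e = a ∧ inner ℝ (a • e + b • T + c • n) T = b ∧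
      inner ℝ (a • e + b • T + c • n) n = c := by
  simp [inner_add_left, inner_smul_left, h.norm_e, h.norm_T, h.norm_n, h.e_T, h.e_n, h.T_n, h.T_e,
    h.n_e, h.n_T]

end IsFrame

lemma isFrame_cross {e T : E3} (he : ‖e‖ = 1) (hT : ‖T‖ = 1) (heT : inner ℝ e T = 0) :
    IsFrame e T (cross e T) := by
  have hen : inner ℝ e (cross e T) = 0 := by
    simp [cross, PiLp.inner_apply, Fin.sum_univ_three, crossProduct]; ring
  have hTn : inner ℝ T (cross e T) = 0 := by
    simp [cross, PiLp.inner_apply, Fin.sum_univ_three, crossProduct]; ring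
  refine ⟨he, hT, ?_, heT, hen, hTn⟩
  have h1 : ‖cross e T‖ ^ 2 = ‖e‖ ^ 2 * ‖T‖ ^ 2 - inner ℝ e T ^ 2 := by
    rw [EuclideanSpace.norm_sq_eq, EuclideanSpace.norm_sq_eq, EuclideanSpace.norm_sq_eq]
    simp [cross, PiLp.inner_apply, Fin.sum_univ_three, crossProduct]; ring
  rw [he, hT, heT] at h1
  have : ‖cross e T‖ ^ 2 = 1 ^ 2 := by rw [h1]; norm_num
  exact (pow_left_inj₀ (norm_nonneg _) zero_le_one two_ne_zero).1 this

/-! ### The boundary curve -/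

/-- Differentiation of a constant inner product. -/
lemma inner_deriv_eq_zero {a b : ℝ} (hab : a < b) {f g : ℝ → E3} {f' g' : E3} {t c : ℝ}
    (ht : t ∈ Icc a b) (hf : HasDerivWithinAt f f' (Icc a b) t)
    (hg : HasDerivWithinAt g g' (Icc a b) t) (hc : ∀ s ∈ Icc a b, inner ℝ (f s) (g s) = c) :
    inner ℝ (f t) g' + inner ℝ f' (g t) = 0 := by
  have h1 := hf.inner ℝ hg
  have h2 : HasDerivWithinAt (fun s => inner ℝ (f s) (g s)) 0 (Icc a b) t :=
    (hasDerivWithinAt_const t (Icc a b) c).congr hc (hc t ht)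
  exact (uniqueDiffOn_Icc hab t ht).eq_deriv _ h1 h2

lemma hasDerivWithinAt_curveDeriv {v : ℝ → E3} {a b : ℝ} (hab : a < b) {m : ℕ}
    (hv : ContDiffOn ℝ m v (Icc a b)) {k : ℕ} (hk : k < m) {t : ℝ} (ht : t ∈ Icc a b) :
    HasDerivWithinAt (curveDeriv v a b k) (curveDeriv v a b (k + 1) t) (Icc a b) t := by
  have h := hv.differentiableOn_iteratedDerivWithin (m := k) (by exact_mod_cast hk)
    (uniqueDiffOn_Icc hab)
  have := (h t ht).hasDerivWithinAt
  rw [← iteratedDerivWithin_succ] at this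
  exact this

lemma curveDeriv_zero (v : ℝ → E3) (a b : ℝ) : curveDeriv v a b 0 = v := by
  ext1 t; simp [curveDeriv]

namespace EdgeSetting

variable {A : Set S2} {v : ℝ → E3} {L a b δ : ℝ}

lemma norm_eq_one (h : EdgeSetting A v L a b δ) {t : ℝ} (ht : t ∈ Icc 0 L) : ‖v t‖ = 1 := by
  have : v t ∈ bdry A := h.bdry_eq ▸ mem_image_of_mem v ht
  obtain ⟨y, _, hy⟩ := this
  rw [← hy]; exact S2.norm_eq y

lemma Icc_subset (h : EdgeSetting A v L a b δ) : Icc a b ⊆ Icc 0 L :=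
  Icc_subset_Icc h.a_nonneg h.b_le

lemma lipschitz (h : EdgeSetting A v L a b δ) : ∀ s ∈ Icc 0 L, ∀ t ∈ Icc 0 L, ‖v s - v t‖ ≤ |s - t| := by
  have key : ∀ s ∈ Icc 0 L, ∀ t ∈ Icc 0 L, s ≤ t → ‖v s - v t‖ ≤ t - s := by
    intro s hs t ht hst
    have h1 := h.unit_speed hs ht
    have h2 := eVariationOn.edist_le v (s := Icc 0 L ∩ Icc s t) (x := s) (y := t)
      ⟨hs, le_rfl, hst⟩ ⟨ht, hst, le_rfl⟩
    rw [h1, edist_dist, dist_eq_norm] at h2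
    simpa using (ENNReal.ofReal_le_ofReal_iff (by simpa using hst)).1 h2
  intro s hs t ht
  rcases le_total s t with hst | hst
  · rw [abs_of_nonpos (by linarith)]; linarith [key s hs t ht hst]
  · rw [abs_of_nonneg (by linarith), norm_sub_rev]; exact key t ht s hs hst

lemma hasDeriv (h : EdgeSetting A v L a b δ) {k : ℕ} (hk : k < 3) {t : ℝ} (ht : t ∈ Icc a b) :
    HasDerivWithinAt (curveDeriv v a b k) (curveDeriv v a b (k + 1) t) (Icc a b) t :=
  hasDerivWithinAt_curveDeriv h.a_lt_b (m := 3) (by exact_mod_cast h.smooth) hk ht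

lemma hasDeriv_zero (h : EdgeSetting A v L a b δ) {t : ℝ} (ht : t ∈ Icc a b) :
    HasDerivWithinAt v (curveDeriv v a b 1 t) (Icc a b) t := by
  have := h.hasDeriv (k := 0) (by norm_num) ht
  rwa [curveDeriv_zero] at this

lemma continuousOn_curveDeriv (h : EdgeSetting A v L a b δ) {k : ℕ} (hk : k ≤ 3) :
    ContinuousOn (curveDeriv v a b k) (Icc a b) :=
  h.smooth.continuousOn_iteratedDerivWithin (by exact_mod_cast hk) (uniqueDiffOn_Icc h.a_lt_b)

lemma norm_deriv_le (h : EdgeSetting A v L a b δ) {t : ℝ} (ht : t ∈ Icc a b) :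
    ‖curveDeriv v a b 1 t‖ ≤ 1 := by
  have h1 := (hasDerivWithinAt_iff_tendsto_slope.1 (h.hasDeriv_zero ht)).norm
  have hne : (𝓝[Icc a b \ {t}] t).NeBot :=
    accPt_principal_iff_nhdsWithin.1 (uniqueDiffOn_Icc h.a_lt_b t ht).accPt
  refine le_of_tendsto h1 ?_
  filter_upwards [self_mem_nhdsWithin] with s hs
  have hst : 0 < |s - t| := abs_pos.2 (sub_ne_zero.2 hs.2)
  rw [slope_def_module, norm_smul, norm_inv, Real.norm_eq_abs, inv_mul_le_iff₀ hst, mul_one]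
  exact h.lipschitz s (h.Icc_subset hs.1) t (h.Icc_subset ht)

/-- Unit speed is a statement about the variation. Were the derivative shorter than some `c < 1` at
a point, it would be so on a small interval, whose image would then have length at most `c` times
that of the interval. -/
lemma norm_deriv (h : EdgeSetting A v L a b δ) {t : ℝ} (ht : t ∈ Icc a b) :
    ‖curveDeriv v a b 1 t‖ = 1 := by
  refine le_antisymm (h.norm_deriv_le ht) (not_lt.1 fun hlt => ?_)
  obtain ⟨c, hc1, hc2⟩ := exists_between hlt
  have hc0 : 0 ≤ c := (norm_nonneg _).trans hc1.le
  have hcont := (h.continuousOn_curveDeriv (k := 1) (by norm_num)).norm t ht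
  have hev : ∀ᶠ s in 𝓝[Icc a b] t, ‖curveDeriv v a b 1 s‖ < c := hcont.eventually (gt_mem_nhds hc1)
  rw [eventually_nhdsWithin_iff, Metric.eventually_nhds_iff] at hev
  obtain ⟨η, hη, hball⟩ := hev
  set x := max a (t - η / 2)
  set y := min b (t + η / 2)
  have hxy : x < y := by
    have := h.a_lt_b
    rw [max_lt_iff, lt_min_iff, lt_min_iff]
    refine ⟨⟨this, ?_⟩, ?_, ?_⟩ <;> linarith [ht.1, ht.2]
  have hsub : Icc x y ⊆ Icc a b := Icc_subset_Icc (le_max_left _ _) (min_le_left _ _)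
  have hlip : LipschitzOnWith c.toNNReal v (Icc x y) := by
    refine (convex_Icc x y).lipschitzOnWith_of_nnnorm_hasDerivWithin_le
      (f' := curveDeriv v a b 1) (fun s hs => (h.hasDeriv_zero (hsub hs)).mono hsub) fun s hs => ?_
    have : ‖curveDeriv v a b 1 s‖ < c := by
      refine hball ?_ (hsub hs)
      have h1 := (le_max_right a (t - η / 2)).trans hs.1
      have h2 := hs.2.trans (min_le_right b (t + η / 2))
      rw [Real.dist_eq, abs_lt]; constructor <;> linarith
    rw [← NNReal.coe_le_coe, Real.coe_toNNReal c hc0]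
    exact this.le
  have hvar := hlip.comp_eVariationOn_le (g := id) (mapsTo_id (Icc x y))
  have hx : x ∈ Icc 0 L := h.Icc_subset (hsub ⟨le_rfl, hxy.le⟩)
  have hy : y ∈ Icc 0 L := h.Icc_subset (hsub ⟨hxy.le, le_rfl⟩)
  have e1 := h.unit_speed hx hy
  have e2 : Icc 0 L ∩ Icc x y = Icc x y := inter_eq_right.2 (hsub.trans h.Icc_subset)
  rw [e2] at e1
  have e3 : eVariationOn (id : ℝ → ℝ) (Icc x y) ≤ ENNReal.ofReal (y - x) := by
    have := (monotone_id.monotoneOn (Icc x y)).eVariationOn_eq (f := (id : ℝ → ℝ))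
      (left_mem_Icc.2 hxy.le) (right_mem_Icc.2 hxy.le)
    rw [inter_self] at this
    exact this.le
  rw [Function.comp_id, e1] at hvar
  have e4 : ENNReal.ofReal ((1 : NNReal) * (y - x)) ≤ ENNReal.ofReal (c * (y - x)) := by
    refine hvar.trans ?_
    rw [ENNReal.ofReal_mul hc0]
    change ENNReal.ofReal c * _ ≤ _
    gcongr
  rw [ENNReal.ofReal_le_ofReal_iff (by have : 0 < y - x := by linarith
                                       positivity)] at e4
  simp at e4
  nlinarith

lemma inner_v_deriv (h : EdgeSetting A v L a b δ) {t : ℝ} (ht : t ∈ Icc a b) :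
    inner ℝ (v t) (curveDeriv v a b 1 t) = 0 := by
  have := inner_deriv_eq_zero h.a_lt_b ht (h.hasDeriv_zero ht) (h.hasDeriv_zero ht) (c := 1)
    fun s hs => by rw [real_inner_self_eq_norm_sq, h.norm_eq_one (h.Icc_subset hs)]; norm_num
  rw [real_inner_comm (v t) (curveDeriv v a b 1 t)] at this
  linarith

lemma inner_deriv_second (h : EdgeSetting A v L a b δ) {t : ℝ} (ht : t ∈ Icc a b) :
    inner ℝ (curveDeriv v a b 1 t) (curveDeriv v a b 2 t) = 0 := by
  have hd := h.hasDeriv (k := 1) (by norm_num) ht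
  have := inner_deriv_eq_zero h.a_lt_b ht hd hd (c := 1)
    fun s hs => by rw [real_inner_self_eq_norm_sq, h.norm_deriv hs]; norm_num
  rw [real_inner_comm (curveDeriv v a b 1 t) (curveDeriv v a b (1 + 1) t)] at this
  have e : (1 + 1 : ℕ) = 2 := rfl
  rw [e] at this
  linarith

lemma inner_v_second (h : EdgeSetting A v L a b δ) {t : ℝ} (ht : t ∈ Icc a b) :
    inner ℝ (v t) (curveDeriv v a b 2 t) = -1 := by
  have := inner_deriv_eq_zero h.a_lt_b ht (h.hasDeriv_zero ht) (h.hasDeriv (k := 1) (by norm_num) ht)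
    (c := 0) fun s hs => h.inner_v_deriv hs
  rw [real_inner_self_eq_norm_sq, h.norm_deriv ht] at this
  have e : (1 + 1 : ℕ) = 2 := rfl
  rw [e] at this
  linarith

lemma one_le_norm_second (h : EdgeSetting A v L a b δ) {t : ℝ} (ht : t ∈ Icc a b) :
    1 ≤ ‖curveDeriv v a b 2 t‖ := by
  have := abs_real_inner_le_norm (v t) (curveDeriv v a b 2 t)
  rw [h.inner_v_second ht, h.norm_eq_one (h.Icc_subset ht)] at this
  simpa using this

lemma isFrame (h : EdgeSetting A v L a b δ) {t : ℝ} (ht : t ∈ Icc a b) :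
    IsFrame (v t) (curveDeriv v a b 1 t) (cross (v t) (curveDeriv v a b 1 t)) :=
  isFrame_cross (h.norm_eq_one (h.Icc_subset ht)) (h.norm_deriv ht) (h.inner_v_deriv ht)

lemma phiStar_le (_h : EdgeSetting A v L a b δ) {t : ℝ} (ht : t ∈ Icc a b) :
    phiStar v a b ≤ Real.arcsin ‖curveDeriv v a b 2 t‖⁻¹ := by
  refine csInf_le ⟨0, ?_⟩ (mem_image_of_mem _ ht)
  rintro _ ⟨s, _, rfl⟩
  exact Real.arcsin_nonneg.2 (by positivity)

lemma phiStar_pos (h : EdgeSetting A v L a b δ) : 0 < phiStar v a b := by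
  obtain ⟨B, hB⟩ := isCompact_Icc.exists_bound_of_continuousOn
    (h.continuousOn_curveDeriv (k := 2) (by norm_num))
  have ha : a ∈ Icc a b := left_mem_Icc.2 h.a_lt_b.le
  have hB1 : 1 ≤ B := (h.one_le_norm_second ha).trans (hB a ha)
  have : Real.arcsin B⁻¹ ≤ phiStar v a b := by
    refine le_csInf ⟨_, mem_image_of_mem _ ha⟩ ?_
    rintro _ ⟨s, hs, rfl⟩
    apply Real.arcsin_le_arcsin
    exact inv_anti₀ (lt_of_lt_of_le one_pos (h.one_le_norm_second hs)) (hB s hs)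
  exact lt_of_lt_of_le (Real.arcsin_pos.2 (by positivity)) this

lemma phiStar_le_pi_div_two (h : EdgeSetting A v L a b δ) : phiStar v a b ≤ Real.pi / 2 :=
  (h.phiStar_le (left_mem_Icc.2 h.a_lt_b.le)).trans (Real.arcsin_le_pi_div_two _)

lemma sin_phiStar_le (h : EdgeSetting A v L a b δ) {t : ℝ} (ht : t ∈ Icc a b) :
    Real.sin (phiStar v a b) ≤ ‖curveDeriv v a b 2 t‖⁻¹ := by
  have h1 := h.one_le_norm_second ht
  have h2 : ‖curveDeriv v a b 2 t‖⁻¹ ≤ 1 := inv_le_one_of_one_le₀ h1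
  have h3 : (0 : ℝ) ≤ ‖curveDeriv v a b 2 t‖⁻¹ := by positivity
  rw [← Real.sin_arcsin (by linarith) h2]
  exact Real.sin_le_sin_of_le_of_le_pi_div_two (by linarith [h.phiStar_pos, Real.pi_pos])
    (Real.arcsin_le_pi_div_two _) (h.phiStar_le ht)

lemma norm_third_le (h : EdgeSetting A v L a b δ) {t : ℝ} (ht : t ∈ Icc a b) :
    ‖curveDeriv v a b 3 t‖ ≤ supThird v a b :=
  le_csSup (isCompact_Icc.bddAbove_image (h.continuousOn_curveDeriv (k := 3) le_rfl).norm)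
    (mem_image_of_mem _ ht)

lemma dDelta_le (_h : EdgeSetting A v L a b δ) :
    dDelta v L a b δ ≤ δ / 5 * Real.sin (phiStar v a b / 2) := min_le_left _ _

lemma dDelta_le_geoDist (_h : EdgeSetting A v L a b δ) {t s : ℝ} (ht : t ∈ Icc (a + δ) (b - δ))
    (hs : s ∈ Icc 0 L \ Ioo a b) : dDelta v L a b δ ≤ geoDist (v t) (v s) := by
  refine (min_le_right _ _).trans (csInf_le ⟨0, ?_⟩ (mem_image2_of_mem ht hs))
  rintro _ ⟨s, _, t, _, rfl⟩
  exact geoDist_nonneg _ _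

lemma mem_Ioo_of_mem (h : EdgeSetting A v L a b δ) {p : ℝ} (hp : p ∈ Icc (a + δ) (b - δ)) :
    p ∈ Ioo a b := ⟨by linarith [hp.1, h.δ_pos], by linarith [hp.2, h.δ_pos]⟩

lemma mem_Icc_of_mem (h : EdgeSetting A v L a b δ) {p : ℝ} (hp : p ∈ Icc (a + δ) (b - δ)) :
    p ∈ Icc a b := Ioo_subset_Icc_self (h.mem_Ioo_of_mem hp)

lemma surf_frontier (h : EdgeSetting A v L a b δ) : surf (frontier A) = 0 := by
  refine measure_mono_null (fun y hy => ?_)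
    (surf_image_eq_zero h.L_pos (fun t ht => h.norm_eq_one ht) h.lipschitz)
  change (y : E3) ∈ v '' Icc 0 L
  rw [← h.bdry_eq]
  exact mem_image_of_mem _ hy

end EdgeSetting

/-! ### Osculating caps -/

lemma mem_cap_iff {z y : S2} {φ : ℝ} (h0 : 0 ≤ φ) (hπ : φ ≤ Real.pi) :
    y ∈ cap z φ ↔ Real.cos φ < inner ℝ (y : E3) z := by
  rw [inner_eq_cos_geoDist (S2.norm_eq y) (S2.norm_eq z)]
  change geoDist y z < φ ↔ _
  constructor
  · intro h
    exact Real.cos_lt_cos_of_nonneg_of_le_pi (geoDist_nonneg _ _) hπ h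
  · intro h
    by_contra hle
    exact absurd (Real.cos_le_cos_of_nonneg_of_le_pi h0 (geoDist_le_pi _ _) (not_lt.1 hle)) (not_le.2 h)

/-- The point at signed distance `α` from `e` on the great circle through `e` in direction `n`. -/
noncomputable def arcPoint (e n : E3) (α : ℝ) : E3 := Real.cos α • e + Real.sin α • n

lemma IsFrame.inner_arcPoint {e T n : E3} (h : IsFrame e T n) (α : ℝ) :
    inner ℝ (arcPoint e n α) e = Real.cos α ∧ inner ℝ (arcPoint e n α) T = 0 ∧
      inner ℝ (arcPoint e n α) n = Real.sin α := by
  have : arcPoint e n α = Real.cos α • e + (0 : ℝ) • T + Real.sin α • n := by simp [arcPoint]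
  rw [this]
  exact h.comb _ _ _

lemma IsFrame.norm_arcPoint {e T n : E3} (h : IsFrame e T n) (α : ℝ) : ‖arcPoint e n α‖ = 1 := by
  have h1 := h.norm_sq_eq (arcPoint e n α)
  obtain ⟨e1, e2, e3⟩ := h.inner_arcPoint α
  rw [e1, e2, e3] at h1
  have : ‖arcPoint e n α‖ ^ 2 = 1 ^ 2 := by rw [h1]; linarith [Real.cos_sq_add_sin_sq α]
  exact (pow_left_inj₀ (norm_nonneg _) zero_le_one two_ne_zero).1 this

lemma IsFrame.inner_arcPoint_arcPoint {e T n : E3} (h : IsFrame e T n) (α β : ℝ) :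
    inner ℝ (arcPoint e n α) (arcPoint e n β) = Real.cos (α - β) := by
  obtain ⟨e1, e2, e3⟩ := h.inner_arcPoint α
  obtain ⟨f1, f2, f3⟩ := h.inner_arcPoint β
  rw [h.inner_eq, e1, e2, e3, f1, f2, f3, Real.cos_sub]
  ring

lemma IsFrame.eq_arcPoint {e T n : E3} (h : IsFrame e T n) {y : E3} (hy : ‖y‖ = 1)
    (hyT : inner ℝ y T = 0) :
    y = arcPoint e n (geoDist y e) ∨ y = arcPoint e n (-geoDist y e) := by
  have h1 := inner_eq_cos_geoDist hy h.norm_e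
  have h2 := h.norm_sq_eq y
  rw [hy, hyT, h1] at h2
  have h3 : inner ℝ y n ^ 2 = Real.sin (geoDist y e) ^ 2 := by
    linarith [Real.cos_sq_add_sin_sq (geoDist y e)]
  obtain ⟨e1, e2, e3⟩ := h.inner_arcPoint (geoDist y e)
  obtain ⟨f1, f2, f3⟩ := h.inner_arcPoint (-geoDist y e)
  rcases sq_eq_sq_iff_eq_or_eq_neg.1 h3 with h4 | h4
  · left
    exact h.ext (by rw [e1, h1]) (by rw [e2, hyT]) (by rw [e3, h4])
  · right
    exact h.ext (by rw [f1, h1, Real.cos_neg]) (by rw [f2, hyT]) (by rw [f3, h4, Real.sin_neg])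

namespace EdgeSetting

variable {A : Set S2} {v : ℝ → E3} {L a b δ p : ℝ}

/-- The unit normal to the left of the curve. -/
noncomputable def normal (v : ℝ → E3) (a b p : ℝ) : E3 := cross (v p) (curveDeriv v a b 1 p)

/-- The central projection of the tangent line in the normal direction: parameter `tan α`
corresponds to arc length `α`. The side conditions thereby become statements about angles. -/
lemma sidePoint_tan (h : EdgeSetting A v L a b δ) (hp : p ∈ Icc a b) {α : ℝ}
    (hα : α ∈ Ioo (-(Real.pi / 2)) (Real.pi / 2)) :
    sidePoint v a b p (Real.tan α) = arcPoint (v p) (normal v a b p) α := by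
  have hf := h.isFrame hp
  have hc : 0 < Real.cos α := Real.cos_pos_of_mem_Ioo hα
  have e1 : v p + Real.tan α • cross (v p) (curveDeriv v a b 1 p) =
      (Real.cos α)⁻¹ • arcPoint (v p) (normal v a b p) α := by
    rw [arcPoint, smul_add, smul_smul, smul_smul, inv_mul_cancel₀ hc.ne', one_smul, Real.tan_eq_sin_div_cos,
      normal, inv_mul_eq_div]
  rw [sidePoint]
  simp only [e1]
  rw [norm_smul, normal, hf.norm_arcPoint, mul_one, smul_smul, norm_inv, inv_inv, Real.norm_of_nonneg hc.le,
    mul_inv_cancel₀ hc.ne', one_smul]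

lemma tendsto_tan_right : Tendsto Real.tan (𝓝[>] 0) (𝓝[>] 0) := by
  refine tendsto_nhdsWithin_iff.2 ⟨?_, ?_⟩
  · have : ContinuousAt Real.tan 0 := Real.continuousAt_tan.2 (by simp)
    have h := this.tendsto
    rw [Real.tan_zero] at h
    exact h.mono_left nhdsWithin_le_nhds
  · have : ∀ᶠ α : ℝ in 𝓝[>] 0, α ∈ Ioo 0 (Real.pi / 2) :=
      Ioo_mem_nhdsGT (by positivity)
    filter_upwards [this] with α hα
    exact Real.tan_pos_of_pos_of_lt_pi_div_two hα.1 hα.2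

lemma eventually_arcPoint_mem (h : EdgeSetting A v L a b δ) (hp : p ∈ Icc a b) :
    ∀ᶠ α in 𝓝[>] (0 : ℝ), arcPoint (v p) (normal v a b p) α ∈ Subtype.val '' A := by
  have h1 := tendsto_tan_right.eventually (h.left_mem p hp)
  have h2 : ∀ᶠ α : ℝ in 𝓝[>] 0, α ∈ Ioo 0 (Real.pi / 2) := Ioo_mem_nhdsGT (by positivity)
  filter_upwards [h1, h2] with α hα hα'
  rwa [h.sidePoint_tan hp ⟨by linarith [hα'.1, Real.pi_pos], hα'.2⟩] at hα

lemma eventually_arcPoint_notMem (h : EdgeSetting A v L a b δ) (hp : p ∈ Ioo a b) :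
    ∀ᶠ α in 𝓝[>] (0 : ℝ), arcPoint (v p) (normal v a b p) (-α) ∉ Subtype.val '' A := by
  have hneg : Tendsto (fun α : ℝ => -α) (𝓝[>] 0) (𝓝[<] 0) := by
    have := tendsto_neg_nhdsGT (a := (0 : ℝ))
    rwa [neg_zero] at this
  have h1 := (hneg.comp tendsto_tan_right).eventually (h.right_notMem p hp)
  have h2 : ∀ᶠ α : ℝ in 𝓝[>] 0, α ∈ Ioo 0 (Real.pi / 2) := Ioo_mem_nhdsGT (by positivity)
  filter_upwards [h1, h2] with α hα hα'
  rw [Function.comp_apply, ← Real.tan_neg, h.sidePoint_tan (Ioo_subset_Icc_self hp)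
    ⟨by linarith [hα'.2], by linarith [hα'.1, Real.pi_pos]⟩] at hα
  exact hα

/-- The geodesic curvature. -/
noncomputable def geoCurv (v : ℝ → E3) (a b p : ℝ) : ℝ :=
  inner ℝ (curveDeriv v a b 2 p) (normal v a b p)

lemma isFrame' (h : EdgeSetting A v L a b δ) (hp : p ∈ Icc a b) :
    IsFrame (v p) (curveDeriv v a b 1 p) (normal v a b p) := h.isFrame hp

lemma inner_second (h : EdgeSetting A v L a b δ) (hp : p ∈ Icc a b) :
    inner ℝ (curveDeriv v a b 2 p) (v p) = -1 ∧
      inner ℝ (curveDeriv v a b 2 p) (curveDeriv v a b 1 p) = 0 := by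
  constructor
  · rw [real_inner_comm]; exact h.inner_v_second hp
  · rw [real_inner_comm]; exact h.inner_deriv_second hp

lemma norm_second_sq (h : EdgeSetting A v L a b δ) (hp : p ∈ Icc a b) :
    ‖curveDeriv v a b 2 p‖ ^ 2 = 1 + geoCurv v a b p ^ 2 := by
  rw [(h.isFrame' hp).norm_sq_eq, (h.inner_second hp).1, (h.inner_second hp).2, geoCurv]
  norm_num

/-- `cap z φ` osculates the curve at `v p` and lies on its left. -/
structure OscData (v : ℝ → E3) (a b p : ℝ) (z : S2) (φ : ℝ) : Prop where
  mem : φ ∈ Ioo 0 Real.pi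
  center : (z : E3) = arcPoint (v p) (normal v a b p) φ
  curv : Real.cos φ = geoCurv v a b p * Real.sin φ

lemma OscData.unique {z z' : S2} {φ φ' : ℝ} (h : OscData v a b p z φ) (h' : OscData v a b p z' φ') :
    z = z' ∧ φ = φ' := by
  have h1 : Real.sin (φ' - φ) = 0 := by
    rw [Real.sin_sub, h.curv, h'.curv]; ring
  have h2 : φ = φ' := by
    have := (Real.sin_eq_zero_iff_of_lt_of_lt (by linarith [h.mem.2, h'.mem.1])
      (by linarith [h.mem.1, h'.mem.2])).1 h1
    linarith
  refine ⟨Subtype.ext ?_, h2⟩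
  rw [h.center, h'.center, h2]

/-- With `k` the geodesic curvature, `cos φ = k sin φ` gives `(1 + k²) sin² φ = 1`, and `1 + k² =
‖v''‖²`. -/
lemma OscData.sin_eq (h : EdgeSetting A v L a b δ) (hp : p ∈ Icc a b) {z : S2} {φ : ℝ}
    (ho : OscData v a b p z φ) : Real.sin φ = ‖curveDeriv v a b 2 p‖⁻¹ := by
  have hs : 0 < Real.sin φ := Real.sin_pos_of_pos_of_lt_pi ho.mem.1 ho.mem.2
  have h1 := h.norm_second_sq hp
  have h2 := Real.cos_sq_add_sin_sq φ
  rw [ho.curv] at h2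
  have h3 : (‖curveDeriv v a b 2 p‖ * Real.sin φ) ^ 2 = 1 ^ 2 := by rw [mul_pow, h1]; linarith
  have h4 := (pow_left_inj₀ (by positivity) zero_le_one two_ne_zero).1 h3
  exact eq_inv_of_mul_eq_one_right h4

lemma exists_oscData (h : EdgeSetting A v L a b δ) (hp : p ∈ Icc a b) :
    ∃ (z : S2) (φ : ℝ), OscData v a b p z φ := by
  have hn := h.one_le_norm_second hp
  have hsq := h.norm_second_sq hp
  set k := geoCurv v a b p with hk
  set ν := ‖curveDeriv v a b 2 p‖
  have hν : 0 < ν := by linarith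
  have hlt : |k / ν| < 1 := by
    rw [abs_div, abs_of_pos hν, div_lt_one hν]
    exact abs_lt_of_sq_lt_sq (by rw [hsq]; linarith) hν.le
  have hlt' := abs_lt.1 hlt
  have hc : Real.cos (Real.arccos (k / ν)) = k / ν := Real.cos_arccos hlt'.1.le hlt'.2.le
  have hm : Real.arccos (k / ν) ∈ Ioo 0 Real.pi := by
    refine ⟨Real.arccos_pos.2 hlt'.2, lt_of_le_of_ne (Real.arccos_le_pi _) fun heq => ?_⟩
    rw [heq, Real.cos_pi] at hc
    linarith
  have hs : Real.sin (Real.arccos (k / ν)) = 1 / ν := by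
    rw [Real.sin_arccos]
    have : 1 - (k / ν) ^ 2 = (1 / ν) ^ 2 := by
      field_simp
      linarith
    rw [this, Real.sqrt_sq (by positivity)]
  refine ⟨⟨arcPoint (v p) (normal v a b p) (Real.arccos (k / ν)), by
    simpa using (h.isFrame' hp).norm_arcPoint _⟩, Real.arccos (k / ν), hm, rfl, ?_⟩
  rw [hc, hs, ← hk]
  ring

/-- Differentiating `⟨u, z⟩ = cos φ` twice at `0` makes `z` orthogonal to `v'` and `v''`. The first
fact leaves two candidates for the centre, the side condition selects the left one, and the second
fact fixes `cot φ`. -/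
lemma oscData_of_isOscCap (h : EdgeSetting A v L a b δ) (hp : p ∈ Ioo a b) {C : Set S2}
    (hC : IsOscCap A v a b p C) : ∃ (z : S2) (φ : ℝ), OscData v a b p z φ ∧ C = cap z φ := by
  obtain ⟨z, φ, hφ, rfl, ⟨u, ℓ, hℓ, hu, _, _, _, himg, hu0, hu1, hu2⟩, hmem⟩ := hC
  have hp' := Ioo_subset_Icc_self hp
  have hf := h.isFrame' hp'
  have hn := h.one_le_norm_second hp'
  have hℓ0 : 0 < ℓ := by
    rw [hℓ]; have := Real.pi_pos; have : 0 < ‖curveDeriv v a b 2 p‖ := by linarith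
    positivity
  have hlt : -ℓ < ℓ := by linarith
  have h0 : (0 : ℝ) ∈ Icc (-ℓ) ℓ := ⟨by linarith, hℓ0.le⟩
  have hconst : ∀ s ∈ Icc (-ℓ) ℓ, inner ℝ (u s) (z : E3) = Real.cos φ := by
    intro s hs
    obtain ⟨hy1, hy2⟩ : u s ∈ capCircle z φ := himg ▸ mem_image_of_mem u hs
    rw [inner_eq_cos_geoDist (by simpa using hy1) (S2.norm_eq z), hy2]
  have hd0 : ∀ s ∈ Icc (-ℓ) ℓ, HasDerivWithinAt u (curveDeriv u (-ℓ) ℓ 1 s) (Icc (-ℓ) ℓ) s := by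
    intro s hs
    have := hasDerivWithinAt_curveDeriv hlt (m := 2) (by exact_mod_cast hu) (k := 0) (by norm_num) hs
    rwa [curveDeriv_zero] at this
  have hz1 : ∀ s ∈ Icc (-ℓ) ℓ, inner ℝ (curveDeriv u (-ℓ) ℓ 1 s) (z : E3) = 0 := by
    intro s hs
    have := inner_deriv_eq_zero hlt hs (hd0 s hs) (hasDerivWithinAt_const s _ (z : E3)) hconst
    simpa using this
  have hz2 : inner ℝ (curveDeriv u (-ℓ) ℓ 2 0) (z : E3) = 0 := by
    have := inner_deriv_eq_zero hlt h0 (hasDerivWithinAt_curveDeriv hlt (m := 2) (by exact_mod_cast hu)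
      (k := 1) (by norm_num) h0) (hasDerivWithinAt_const 0 _ (z : E3)) hz1
    simpa using this
  have c1 : inner ℝ (z : E3) (v p) = Real.cos φ := by
    rw [real_inner_comm, ← hu0]; exact hconst 0 h0
  have c2 : inner ℝ (z : E3) (curveDeriv v a b 1 p) = 0 := by
    rw [real_inner_comm, ← hu1]; exact hz1 0 h0
  have c3 : inner ℝ (curveDeriv v a b 2 p) (z : E3) = 0 := by rw [← hu2]; exact hz2
  have hg : geoDist (z : E3) (v p) = φ := by
    rw [geoDist, c1, Real.arccos_cos hφ.1.le hφ.2.le]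
  have hs : 0 < Real.sin φ := Real.sin_pos_of_pos_of_lt_pi hφ.1 hφ.2
  have hcenter : (z : E3) = arcPoint (v p) (normal v a b p) φ := by
    rcases hf.eq_arcPoint (S2.norm_eq z) c2 with hz | hz
    · rwa [hg] at hz
    -- With the centre on the right, points of the cap near `v(p)` on the normal circle lie strictly
    -- on the right, where `A` has no points.
    · exfalso
      rw [hg] at hz
      have hev := h.eventually_arcPoint_notMem hp
      rw [eventually_nhdsWithin_iff, Metric.eventually_nhds_iff] at hev
      obtain ⟨η, hη, hball⟩ := hev
      obtain ⟨y, ⟨hyA, hyC⟩, hyT, hyd⟩ := hmem (min η (Real.pi - φ)) (lt_min hη (by linarith [hφ.2]))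
      rw [mem_cap_iff hφ.1.le hφ.2.le] at hyC
      have hγ0 := geoDist_nonneg (y : E3) (v p)
      have hγ1 := hyd.trans_le (min_le_left _ _)
      have hγ2 := hyd.trans_le (min_le_right _ _)
      set γ := geoDist (y : E3) (v p)
      rcases hf.eq_arcPoint (S2.norm_eq y) hyT with hy | hy
      · rw [hy, hz, hf.inner_arcPoint_arcPoint] at hyC
        have : Real.cos (γ - -φ) ≤ Real.cos φ :=
          Real.cos_le_cos_of_nonneg_of_le_pi hφ.1.le (by linarith) (by linarith)
        linarith
      -- The point `v(p)` itself lies on the bounding circle and is excluded because the cap is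
      -- open.
      · rcases hγ0.eq_or_lt with h00 | h00
        · have hy' : (y : E3) = arcPoint (v p) (normal v a b p) 0 := by
            rw [hy, show geoDist (y : E3) (v p) = 0 from h00.symm, neg_zero]
          rw [hy', hz, hf.inner_arcPoint_arcPoint] at hyC
          simp at hyC
        · refine hball (y := γ) ?_ h00 (hy ▸ mem_image_of_mem _ hyA)
          rw [Real.dist_eq, sub_zero, abs_of_pos h00]
          exact hγ1
  refine ⟨z, φ, ⟨hφ, hcenter, ?_⟩, rfl⟩
  obtain ⟨e1, e2, e3⟩ := hf.inner_arcPoint φ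
  rw [hcenter, hf.inner_eq, e1, e2, e3, (h.inner_second hp').1] at c3
  rw [geoCurv]
  linarith

lemma curveDeriv_eq_of_hasDerivAt {u u1 u2 : ℝ → E3} {c d : ℝ} (hcd : c < d)
    (h1 : ∀ t, HasDerivAt u (u1 t) t) (h2 : ∀ t, HasDerivAt u1 (u2 t) t) {t : ℝ} (ht : t ∈ Icc c d) :
    curveDeriv u c d 1 t = u1 t ∧ curveDeriv u c d 2 t = u2 t := by
  have hU := uniqueDiffOn_Icc hcd
  have e1 : ∀ t ∈ Icc c d, curveDeriv u c d 1 t = u1 t := by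
    intro t ht
    rw [curveDeriv, iteratedDerivWithin_one]
    exact (h1 t).hasDerivWithinAt.derivWithin (hU t ht)
  refine ⟨e1 t ht, ?_⟩
  rw [curveDeriv, iteratedDerivWithin_succ]
  have : HasDerivWithinAt (iteratedDerivWithin 1 u (Icc c d)) (u2 t) (Icc c d) t :=
    (h2 t).hasDerivWithinAt.congr e1 (e1 t ht)
  exact this.derivWithin (hU t ht)

/-- Arc-length parameterization of the circle with center `z` and opening angle `φ`. -/
noncomputable def circleParam (z e' T : E3) (φ t : ℝ) : E3 :=
  Real.cos φ • z + (Real.sin φ * Real.cos (t / Real.sin φ)) • e' +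
    (Real.sin φ * Real.sin (t / Real.sin φ)) • T

/-- The derivative of `circleParam`. -/
noncomputable def circleParam' (z e' T : E3) (φ t : ℝ) : E3 :=
  (0 : ℝ) • z + (-Real.sin (t / Real.sin φ)) • e' + Real.cos (t / Real.sin φ) • T

/-- The second derivative of `circleParam`. -/
noncomputable def circleParam'' (z e' T : E3) (φ t : ℝ) : E3 :=
  (0 : ℝ) • z + (-Real.cos (t / Real.sin φ) / Real.sin φ) • e' +
    (-Real.sin (t / Real.sin φ) / Real.sin φ) • T

lemma hasDerivAt_circleParam (z e' T : E3) {φ : ℝ} (hs : 0 < Real.sin φ) (t : ℝ) :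
    HasDerivAt (circleParam z e' T φ) (circleParam' z e' T φ t) t := by
  have hdiv : HasDerivAt (fun t => t / Real.sin φ) (1 / Real.sin φ) t :=
    (hasDerivAt_id t).div_const _
  have c1 := (((hdiv.cos).const_mul (Real.sin φ)).smul_const e').const_add (Real.cos φ • z)
  have c2 := ((hdiv.sin).const_mul (Real.sin φ)).smul_const T
  refine (c1.add c2).congr_deriv ?_
  rw [circleParam', zero_smul, zero_add]
  congr 2 <;> field_simp

lemma hasDerivAt_circleParam' (z e' T : E3) (φ t : ℝ) :
    HasDerivAt (circleParam' z e' T φ) (circleParam'' z e' T φ t) t := by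
  have hdiv : HasDerivAt (fun t => t / Real.sin φ) (1 / Real.sin φ) t :=
    (hasDerivAt_id t).div_const _
  have c1 := ((hdiv.sin.neg).smul_const e').const_add ((0 : ℝ) • z)
  have c2 := (hdiv.cos).smul_const T
  refine (c1.add c2).congr_deriv ?_
  rw [circleParam'', zero_smul, zero_add]
  congr 2 <;> ring

lemma norm_circleParam {z e' T : E3} (hF : IsFrame z e' T) (φ t : ℝ) :
    ‖circleParam z e' T φ t‖ = 1 := by
  obtain ⟨a1, a2, a3⟩ := hF.comb (Real.cos φ) (Real.sin φ * Real.cos (t / Real.sin φ))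
    (Real.sin φ * Real.sin (t / Real.sin φ))
  have : ‖circleParam z e' T φ t‖ ^ 2 = 1 ^ 2 := by
    rw [hF.norm_sq_eq, circleParam, a1, a2, a3]
    linear_combination Real.sin φ ^ 2 * Real.cos_sq_add_sin_sq (t / Real.sin φ) +
      Real.cos_sq_add_sin_sq φ
  exact (pow_left_inj₀ (norm_nonneg _) zero_le_one two_ne_zero).1 this

lemma norm_circleParam' {z e' T : E3} (hF : IsFrame z e' T) (φ t : ℝ) :
    ‖circleParam' z e' T φ t‖ = 1 := by
  obtain ⟨a1, a2, a3⟩ := hF.comb 0 (-Real.sin (t / Real.sin φ)) (Real.cos (t / Real.sin φ))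
  have : ‖circleParam' z e' T φ t‖ ^ 2 = 1 ^ 2 := by
    rw [hF.norm_sq_eq, circleParam', a1, a2, a3]
    linear_combination Real.cos_sq_add_sin_sq (t / Real.sin φ)
  exact (pow_left_inj₀ (norm_nonneg _) zero_le_one two_ne_zero).1 this

lemma injOn_circleParam {z e' T : E3} (hF : IsFrame z e' T) {φ : ℝ} (hs : 0 < Real.sin φ) :
    InjOn (circleParam z e' T φ) (Ico (-(Real.pi * Real.sin φ)) (Real.pi * Real.sin φ)) := by
  intro t ht s hs' hts
  obtain ⟨a1, a2, a3⟩ := hF.comb (Real.cos φ) (Real.sin φ * Real.cos (t / Real.sin φ))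
    (Real.sin φ * Real.sin (t / Real.sin φ))
  obtain ⟨b1, b2, b3⟩ := hF.comb (Real.cos φ) (Real.sin φ * Real.cos (s / Real.sin φ))
    (Real.sin φ * Real.sin (s / Real.sin φ))
  rw [circleParam, circleParam] at hts
  rw [hts, b2] at a2
  rw [hts, b3] at a3
  have r2 := mul_left_cancel₀ hs.ne' a2
  have r3 := mul_left_cancel₀ hs.ne' a3
  have hcos : Real.cos (t / Real.sin φ - s / Real.sin φ) = 1 := by
    rw [Real.cos_sub, r2, r3]
    linear_combination Real.cos_sq_add_sin_sq (t / Real.sin φ)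
  have hb : ∀ x ∈ Ico (-(Real.pi * Real.sin φ)) (Real.pi * Real.sin φ),
      -Real.pi ≤ x / Real.sin φ ∧ x / Real.sin φ < Real.pi := by
    intro x hx
    rw [le_div_iff₀ hs, div_lt_iff₀ hs]
    exact ⟨by linarith [hx.1], hx.2⟩
  have bt := hb t ht
  have bs := hb s hs'
  have := (Real.cos_eq_one_iff_of_lt_of_lt (by linarith [bt.1, bs.2]) (by linarith [bt.2, bs.1])).1 hcos
  have h3 : t / Real.sin φ = s / Real.sin φ := by linarith
  exact (div_left_inj' hs.ne').1 h3

lemma image_circleParam {z : S2} {e' T : E3} (hF : IsFrame (z : E3) e' T) {φ : ℝ}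
    (hφ : φ ∈ Ioo 0 Real.pi) :
    circleParam z e' T φ '' Icc (-(Real.pi * Real.sin φ)) (Real.pi * Real.sin φ) = capCircle z φ := by
  have hs : 0 < Real.sin φ := Real.sin_pos_of_pos_of_lt_pi hφ.1 hφ.2
  ext y
  constructor
  · rintro ⟨t, _, rfl⟩
    obtain ⟨a1, a2, a3⟩ := hF.comb (Real.cos φ) (Real.sin φ * Real.cos (t / Real.sin φ))
      (Real.sin φ * Real.sin (t / Real.sin φ))
    refine ⟨by simpa using norm_circleParam hF φ t, ?_⟩
    rw [geoDist, circleParam, a1, Real.arccos_cos hφ.1.le hφ.2.le]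
  · rintro ⟨hy1, hy2⟩
    have hy1' : ‖y‖ = 1 := by simpa using hy1
    have i1 : inner ℝ y (z : E3) = Real.cos φ := by
      rw [inner_eq_cos_geoDist hy1' (S2.norm_eq z), hy2]
    have i2 := hF.norm_sq_eq y
    rw [hy1', i1] at i2
    set w : ℂ := ⟨inner ℝ y e', inner ℝ y T⟩ with hw
    have hwn : ‖w‖ = Real.sin φ := by
      have : ‖w‖ ^ 2 = Real.sin φ ^ 2 := by
        rw [Complex.sq_norm, hw, Complex.normSq_mk]
        linear_combination -i2 - Real.cos_sq_add_sin_sq φ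
      exact (pow_left_inj₀ (norm_nonneg _) hs.le two_ne_zero).1 this
    have k1 := Complex.norm_mul_cos_arg w
    have k2 := Complex.norm_mul_sin_arg w
    rw [hwn] at k1 k2
    have hdv : Real.sin φ * Complex.arg w / Real.sin φ = Complex.arg w := by field_simp
    have g1 := mul_lt_mul_of_pos_left (Complex.neg_pi_lt_arg w) hs
    have g2 := mul_le_mul_of_nonneg_left (Complex.arg_le_pi w) hs.le
    obtain ⟨a1, a2, a3⟩ := hF.comb (Real.cos φ) (Real.sin φ * Real.cos (Complex.arg w))
      (Real.sin φ * Real.sin (Complex.arg w))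
    refine ⟨Real.sin φ * Complex.arg w, ⟨by linarith, by linarith⟩, ?_⟩
    refine hF.ext ?_ ?_ ?_ <;> rw [circleParam, hdv]
    · rw [a1, i1]
    · rw [a2, k1]
    · rw [a3, k2]

lemma OscData.isOscCap (h : EdgeSetting A v L a b δ) (hp : p ∈ Icc a b) {z : S2} {φ : ℝ}
    (ho : OscData v a b p z φ) : IsOscCap A v a b p (cap z φ) := by
  have hf := h.isFrame' hp
  have hs : 0 < Real.sin φ := Real.sin_pos_of_pos_of_lt_pi ho.mem.1 ho.mem.2
  have hsc := Real.cos_sq_add_sin_sq φ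
  have hπ := Real.pi_pos
  set e := v p with he
  set T := curveDeriv v a b 1 p with hT
  set n := normal v a b p with hn
  -- The unit vector orthogonal to the centre and to `T` that points towards `v(p) = cos φ z + sin φ
  -- e'`.
  obtain ⟨e', he'⟩ : ∃ e' : E3, e' = Real.sin φ • e + (0 : ℝ) • T + (-Real.cos φ) • n := ⟨_, rfl⟩
  obtain ⟨d1, d2, d3⟩ := hf.comb (Real.sin φ) 0 (-Real.cos φ)
  rw [← he'] at d1 d2 d3
  obtain ⟨z1, z2, z3⟩ := hf.inner_arcPoint φ
  have hcen := ho.center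
  rw [← he, ← hn] at hcen
  rw [← hcen] at z1 z2 z3
  have hF : IsFrame (z : E3) e' T := by
    refine ⟨S2.norm_eq z, ?_, hf.norm_T, ?_, z2, d2⟩
    · have : ‖e'‖ ^ 2 = 1 ^ 2 := by
        rw [hf.norm_sq_eq, d1, d2, d3]; linarith
      exact (pow_left_inj₀ (norm_nonneg _) zero_le_one two_ne_zero).1 this
    · rw [hf.inner_eq, d1, d2, d3, z1, z2, z3]; ring
  have hsin := OscData.sin_eq h hp ho
  have hℓ0 : 0 < Real.pi * Real.sin φ := by positivity
  have hlt : -(Real.pi * Real.sin φ) < Real.pi * Real.sin φ := by linarith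
  have h0 : (0 : ℝ) ∈ Icc (-(Real.pi * Real.sin φ)) (Real.pi * Real.sin φ) := ⟨by linarith, hℓ0.le⟩
  have hder := fun {t : ℝ} (ht : t ∈ Icc (-(Real.pi * Real.sin φ)) (Real.pi * Real.sin φ)) =>
    curveDeriv_eq_of_hasDerivAt hlt (hasDerivAt_circleParam (z : E3) e' T hs)
      (hasDerivAt_circleParam' (z : E3) e' T φ) ht
  refine ⟨z, φ, ho.mem, rfl, ⟨circleParam z e' T φ, Real.pi * Real.sin φ, by rw [hsin], ?_, ?_, ?_,
    injOn_circleParam hF hs, image_circleParam hF ho.mem, ?_, ?_, ?_⟩, ?_⟩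
  · have : ContDiff ℝ 2 (circleParam z e' T φ) := by
      unfold circleParam
      fun_prop
    exact this.contDiffOn
  · intro t ht
    rw [(hder ht).1]
    exact norm_circleParam' hF φ t
  · have : Real.pi * Real.sin φ / Real.sin φ = Real.pi := by field_simp
    simp only [circleParam, neg_div, this, Real.cos_neg, Real.sin_neg, Real.sin_pi, neg_zero]
  · have hu0 : circleParam (z : E3) e' T φ 0 = Real.cos φ • (z : E3) + Real.sin φ • e' := by
      simp [circleParam]
    rw [hu0, ← he]
    refine hf.ext ?_ ?_ ?_ <;> rw [inner_add_left, real_inner_smul_left, real_inner_smul_left]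
    · rw [z1, d1, hf.e_e]; linarith
    · rw [z2, d2, hf.e_T]; ring
    · rw [z3, d3, hf.e_n]; ring
  · rw [(hder h0).1, ← hT]
    simp [circleParam']
  · have hu2 : circleParam'' (z : E3) e' T φ 0 = (-1 / Real.sin φ) • e' := by
      simp [circleParam'']
    have hk := ho.curv
    rw [(hder h0).2, hu2]
    refine hf.ext ?_ ?_ ?_ <;> rw [real_inner_smul_left]
    · rw [d1, (h.inner_second hp).1]
      field_simp
    · rw [d2, (h.inner_second hp).2, mul_zero]
    · rw [d3, hk, geoCurv, ← hn]
      field_simp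
  · intro ε hε
    -- The required point of `A` is taken on the inner normal at an angle below both `φ` and `ε`.
    have h1 := h.eventually_arcPoint_mem hp
    have h2 : ∀ᶠ α : ℝ in 𝓝[>] 0, α ∈ Ioo 0 (min φ ε) := Ioo_mem_nhdsGT (lt_min ho.mem.1 hε)
    obtain ⟨α, ⟨y, hyA, hy⟩, hα0, hα1⟩ := (h1.and h2).exists
    have hαφ := hα1.trans_le (min_le_left _ _)
    have hαε := hα1.trans_le (min_le_right _ _)
    obtain ⟨a1, a2, a3⟩ := hf.inner_arcPoint α
    refine ⟨y, ⟨hyA, ?_⟩, ?_, ?_⟩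
    · rw [mem_cap_iff ho.mem.1.le ho.mem.2.le, hy, hcen, hf.inner_arcPoint_arcPoint,
        ← Real.cos_neg (α - φ)]
      exact Real.cos_lt_cos_of_nonneg_of_le_pi (by linarith) ho.mem.2.le (by linarith)
    · rw [hy]; exact a2
    · change Real.arccos (inner ℝ (y : E3) e) < ε
      rw [hy, a1, Real.arccos_cos hα0.le (by linarith [ho.mem.2])]
      exact hαε

lemma existsUnique_isOscCap (h : EdgeSetting A v L a b δ) (hp : p ∈ Ioo a b) :
    ∃! C : Set S2, IsOscCap A v a b p C := by
  obtain ⟨z, φ, ho⟩ := h.exists_oscData (Ioo_subset_Icc_self hp)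
  refine ⟨cap z φ, OscData.isOscCap h (Ioo_subset_Icc_self hp) ho, fun C hC => ?_⟩
  obtain ⟨z', φ', ho', rfl⟩ := h.oscData_of_isOscCap hp hC
  obtain ⟨rfl, rfl⟩ := ho.unique ho'
  rfl

end EdgeSetting

/-! ### Connected sets avoiding the boundary -/

/-- The cap is the radial projection of the cone `c ‖Y‖ < ⟨Y, x⟩`, which is convex for `c ≥ 0` and
omits the origin. -/
lemma isPreconnected_openCap (x : E3) {c : ℝ} (hc : 0 ≤ c) :
    IsPreconnected {y : E3 | ‖y‖ = 1 ∧ c < inner ℝ y x} := by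
  set K : Set E3 := {Y | c * ‖Y‖ < inner ℝ Y x} with hK
  have hconv : Convex ℝ K := by
    intro Y hY Y' hY' s t hs ht hst
    change c * ‖Y‖ < inner ℝ Y x at hY
    change c * ‖Y'‖ < inner ℝ Y' x at hY'
    change c * ‖s • Y + t • Y'‖ < inner ℝ (s • Y + t • Y') x
    rw [inner_add_left, real_inner_smul_left, real_inner_smul_left]
    have h1 : ‖s • Y + t • Y'‖ ≤ s * ‖Y‖ + t * ‖Y'‖ := by
      refine (norm_add_le _ _).trans (le_of_eq ?_)
      rw [norm_smul, norm_smul, Real.norm_of_nonneg hs, Real.norm_of_nonneg ht]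
    have h2 := mul_le_mul_of_nonneg_left h1 hc
    rcases hs.eq_or_lt with h0 | h0
    · subst h0
      have : t = 1 := by linarith
      subst this
      nlinarith
    · nlinarith [mul_lt_mul_of_pos_left hY h0, mul_le_mul_of_nonneg_left hY'.le ht]
  have hne : ∀ Y ∈ K, ‖Y‖ ≠ 0 := by
    intro Y hY h0
    rw [norm_eq_zero] at h0
    subst h0
    simp [hK] at hY
  have himg : {y : E3 | ‖y‖ = 1 ∧ c < inner ℝ y x} = (fun Y : E3 => ‖Y‖⁻¹ • Y) '' K := by
    ext y
    constructor
    · rintro ⟨h1, h2⟩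
      refine ⟨y, ?_, by simp [h1]⟩
      change c * ‖y‖ < _
      rwa [h1, mul_one]
    · rintro ⟨Y, hY, rfl⟩
      have hpos : 0 < ‖Y‖ := lt_of_le_of_ne (norm_nonneg _) (hne Y hY).symm
      refine ⟨by simp [norm_smul, hne Y hY], ?_⟩
      change c * ‖Y‖ < inner ℝ Y x at hY
      rw [real_inner_smul_left, lt_inv_mul_iff₀ hpos, mul_comm]
      exact hY
  rw [himg]
  refine hconv.isPreconnected.image _ ?_
  exact (continuousOn_id.norm.inv₀ hne).smul continuousOn_id

/-- Off its frontier the sphere splits into the disjoint open sets `interior A` and `(closure A)ᶜ`.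
The base point is a vector of three-space so that points given by formulas can be used directly. -/
lemma mem_of_isPreconnected {A : Set S2} {S : Set E3} (hS : IsPreconnected S)
    (hS1 : ∀ y ∈ S, ‖y‖ = 1) (hdisj : ∀ y ∈ S, y ∉ bdry A) {y₀ : E3} (hy₀ : y₀ ∈ S) {y : S2}
    (hy : (y : E3) ∈ S) : y ∈ A ↔ y₀ ∈ Subtype.val '' A := by
  have himg : Subtype.val '' (Subtype.val ⁻¹' S : Set S2) = S := by
    ext w
    constructor
    · rintro ⟨w, hw, rfl⟩; exact hw
    · intro hw; exact ⟨⟨w, by simpa using hS1 w hw⟩, hw, rfl⟩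
  have hpre : IsPreconnected (Subtype.val ⁻¹' S : Set S2) := by
    rw [← Topology.IsInducing.subtypeVal.isPreconnected_image, himg]
    exact hS
  have hfr : ∀ w ∈ (Subtype.val ⁻¹' S : Set S2), w ∉ frontier A := fun w hw hwf =>
    hdisj w hw (mem_image_of_mem _ hwf)
  have hcov : (Subtype.val ⁻¹' S : Set S2) ⊆ interior A ∪ (closure A)ᶜ := by
    intro w hw
    by_contra hcon
    rw [mem_union, not_or, notMem_compl_iff] at hcon
    exact hfr w hw ⟨hcon.2, hcon.1⟩
  have hdj : Disjoint (interior A) (closure A)ᶜ :=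
    disjoint_compl_right_iff_subset.2 (interior_subset.trans subset_closure)
  set w₀ : S2 := ⟨y₀, by simpa using hS1 y₀ hy₀⟩
  have hw₀ : w₀ ∈ (Subtype.val ⁻¹' S : Set S2) := hy₀
  have hiff : y₀ ∈ Subtype.val '' A ↔ w₀ ∈ A := by
    constructor
    · rintro ⟨w, hw, hwy⟩
      have : w = w₀ := Subtype.ext hwy
      exact this ▸ hw
    · intro hw; exact ⟨w₀, hw, rfl⟩
  rw [hiff]
  rcases hcov hw₀ with h | h
  · have := hpre.subset_left_of_subset_union isOpen_interior isClosed_closure.isOpen_compl hdj hcov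
      ⟨w₀, hw₀, h⟩
    exact iff_of_true (interior_subset (this hy)) (interior_subset h)
  · have := hpre.subset_right_of_subset_union isOpen_interior isClosed_closure.isOpen_compl hdj hcov
      ⟨w₀, hw₀, h⟩
    exact iff_of_false (fun hyA => this hy (subset_closure hyA)) (fun hwA => h (subset_closure hwA))

/-! ### Nearest points and centres away from the edge -/

namespace EdgeSetting

variable {A : Set S2} {v : ℝ → E3} {L a b δ p : ℝ}

lemma OscData.angle_mem (h : EdgeSetting A v L a b δ) (hp : p ∈ Icc a b) {z : S2} {φ : ℝ}
    (ho : OscData v a b p z φ) :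
    phiStar v a b ≤ φ ∧ φ ≤ Real.pi - phiStar v a b := by
  have h1 := h.sin_phiStar_le hp
  rw [← OscData.sin_eq h hp ho] at h1
  have h2 := h.phiStar_pos
  have h3 := h.phiStar_le_pi_div_two
  constructor
  · by_contra hlt
    have := Real.sin_lt_sin_of_lt_of_le_pi_div_two (by linarith [ho.mem.1]) h3 (not_le.1 hlt)
    linarith
  · by_contra hlt
    have := Real.sin_lt_sin_of_lt_of_le_pi_div_two (x := Real.pi - φ) (by linarith [ho.mem.2]) h3
      (by linarith [not_le.1 hlt])
    rw [Real.sin_pi_sub] at this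
    linarith

lemma geoDist_le_of_nearest (h : EdgeSetting A v L a b δ) {x : S2}
    (hx : geoDistSet x (bdry A) = geoDist x (v p)) {s : ℝ} (hs : s ∈ Icc 0 L) :
    geoDist x (v p) ≤ geoDist x (v s) := by
  rw [← hx]
  refine csInf_le ⟨0, ?_⟩ (mem_image_of_mem _ (h.bdry_eq ▸ mem_image_of_mem v hs))
  rintro _ ⟨y, _, rfl⟩
  exact geoDist_nonneg _ _

/-- At a nearest boundary point `⟨x, v⟩` is locally maximal, so its derivative vanishes; hence `x`
lies on the normal great circle at `v(p)`. -/
lemma inner_tangent_eq_zero (h : EdgeSetting A v L a b δ) (hp : p ∈ Ioo a b) {x : S2}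
    (hx : geoDistSet x (bdry A) = geoDist x (v p)) :
    inner ℝ (x : E3) (curveDeriv v a b 1 p) = 0 := by
  have hp' := Ioo_subset_Icc_self hp
  have hd : HasDerivAt v (curveDeriv v a b 1 p) p :=
    (h.hasDeriv_zero hp').hasDerivAt (Icc_mem_nhds hp.1 hp.2)
  have hd2 := (hasDerivAt_const p (x : E3)).inner ℝ hd
  have hmax : IsLocalMax (fun s => inner ℝ (x : E3) (v s)) p := by
    filter_upwards [Icc_mem_nhds hp.1 hp.2] with s hs
    have hs' := h.Icc_subset hs
    rw [inner_eq_cos_geoDist (S2.norm_eq x) (h.norm_eq_one hs'),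
      inner_eq_cos_geoDist (S2.norm_eq x) (h.norm_eq_one (h.Icc_subset hp'))]
    exact Real.cos_le_cos_of_nonneg_of_le_pi (geoDist_nonneg _ _) (geoDist_le_pi _ _)
      (h.geoDist_le_of_nearest hx hs')
  have := hmax.hasDerivAt_eq_zero hd2
  simpa using this

/-- Away from the curve, `A` and the osculating cap coincide on small balls. -/
lemma mem_iff_mem_cap_of_far (h : EdgeSetting A v L a b δ) (hp : p ∈ Ioo a b) {z : S2} {φ : ℝ}
    (ho : OscData v a b p z φ) {x : S2} (hx : geoDistSet x (bdry A) = geoDist x (v p))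
    (hxφ : geoDist x (v p) ≤ phiStar v a b / 4) {r : ℝ} (hr : 0 < r) (hrt : r ≤ geoDist x (v p))
    {y : S2} (hy : geoDist (y : E3) x < r) : y ∈ A ↔ y ∈ cap z φ := by
  have hp' := Ioo_subset_Icc_self hp
  have hf := h.isFrame' hp'
  have hφ := OscData.angle_mem h hp' ho
  have hφs := h.phiStar_pos
  have hφs2 := h.phiStar_le_pi_div_two
  have hπ := Real.pi_pos
  set t := geoDist (x : E3) (v p) with ht
  have ht0 : 0 < t := by linarith
  have hct : 0 ≤ Real.cos t := Real.cos_nonneg_of_neg_pi_div_two_le_of_le (by linarith) (by linarith)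
  have hpre := isPreconnected_openCap (x : E3) hct
  -- The open ball about `x` whose radius is the distance to the boundary. It contains the normal
  -- points near `v(p)` on the side of `x`, whose membership in `A` is known.
  have hdisj : ∀ w ∈ {y : E3 | ‖y‖ = 1 ∧ Real.cos t < inner ℝ y (x : E3)}, w ∉ bdry A := by
    rintro w ⟨hw1, hw2⟩ hwA
    rw [h.bdry_eq] at hwA
    obtain ⟨s, hs, rfl⟩ := hwA
    have h1 := h.geoDist_le_of_nearest hx hs
    rw [inner_eq_cos_geoDist hw1 (S2.norm_eq x), geoDist_comm] at hw2
    have := Real.cos_le_cos_of_nonneg_of_le_pi ht0.le (geoDist_le_pi _ _) h1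
    linarith
  have hyS : (y : E3) ∈ {y : E3 | ‖y‖ = 1 ∧ Real.cos t < inner ℝ y (x : E3)} := by
    refine ⟨S2.norm_eq y, ?_⟩
    rw [inner_eq_cos_geoDist (S2.norm_eq y) (S2.norm_eq x)]
    exact Real.cos_lt_cos_of_nonneg_of_le_pi (geoDist_nonneg _ _) (by linarith) (by linarith)
  have hev : ∀ᶠ α : ℝ in 𝓝[>] 0, α ∈ Ioo 0 t := Ioo_mem_nhdsGT ht0
  rcases hf.eq_arcPoint (S2.norm_eq x) (h.inner_tangent_eq_zero hp hx) with hxe | hxe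
  · obtain ⟨α, hαA, hα0, hαt⟩ := ((h.eventually_arcPoint_mem hp').and hev).exists
    have hαS : arcPoint (v p) (normal v a b p) α ∈ {y : E3 | ‖y‖ = 1 ∧ Real.cos t < inner ℝ y (x : E3)} := by
      refine ⟨hf.norm_arcPoint α, ?_⟩
      rw [hxe, hf.inner_arcPoint_arcPoint, ← Real.cos_neg (α - _)]
      exact Real.cos_lt_cos_of_nonneg_of_le_pi (by linarith) (by linarith) (by linarith)
    refine iff_of_true ((mem_of_isPreconnected hpre (fun w hw => hw.1) hdisj hαS hyS).2 hαA) ?_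
    -- The points `x`, `v(p)` and the centre lie on one great circle, so distances add; `t ≤ φ* / 4`
    -- and `φ* ≤ φ ≤ π - φ*` keep the angles in `[0, π]`.
    have hxz : geoDist (x : E3) z = φ - t := by
      rw [geoDist, ho.center, hxe, hf.inner_arcPoint_arcPoint, ← Real.cos_neg, Real.arccos_cos]
      · ring
      · linarith
      · linarith
    have := geoDist_triangle (S2.norm_eq y) (S2.norm_eq x) (S2.norm_eq z)
    change geoDist (y : E3) z < φ
    linarith
  · obtain ⟨α, hαA, hα0, hαt⟩ := ((h.eventually_arcPoint_notMem hp).and hev).exists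
    have hαS : arcPoint (v p) (normal v a b p) (-α) ∈ {y : E3 | ‖y‖ = 1 ∧ Real.cos t < inner ℝ y (x : E3)} := by
      refine ⟨hf.norm_arcPoint _, ?_⟩
      rw [hxe, hf.inner_arcPoint_arcPoint]
      exact Real.cos_lt_cos_of_nonneg_of_le_pi (by linarith) (by linarith) (by linarith)
    refine iff_of_false (fun hyA =>
      hαA ((mem_of_isPreconnected hpre (fun w hw => hw.1) hdisj hαS hyS).1 hyA)) ?_
    have hxz : geoDist (x : E3) z = φ + t := by
      rw [geoDist, ho.center, hxe, hf.inner_arcPoint_arcPoint, ← Real.cos_neg, Real.arccos_cos]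
      · ring
      · linarith [ho.mem.1]
      · linarith
    have := geoDist_triangle (S2.norm_eq x) (S2.norm_eq y) (S2.norm_eq z)
    rw [geoDist_comm (x : E3) y] at this
    change ¬ geoDist (y : E3) z < φ
    linarith

/-! ### The curve near a point -/

/-- The unit tangents differ by at most `1 / 4`, so their inner products are at least `1 - (1/4)² /
2 = 31 / 32`. The tangential coordinate is thus a global parameter of the segment over `[a, b]`. -/
lemma tangent_growth (h : EdgeSetting A v L a b δ) (hp : p ∈ Icc a b) {s t : ℝ} (hs : s ∈ Icc a b)
    (ht : t ∈ Icc a b) (hst : s ≤ t) :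
    31 / 32 * (t - s) ≤ inner ℝ (v t) (curveDeriv v a b 1 p) - inner ℝ (v s) (curveDeriv v a b 1 p) := by
  have hderiv : ∀ u ∈ Ioo a b, HasDerivAt (fun s => inner ℝ (v s) (curveDeriv v a b 1 p))
      (inner ℝ (curveDeriv v a b 1 u) (curveDeriv v a b 1 p)) u := by
    intro u hu
    have hd : HasDerivAt v (curveDeriv v a b 1 u) u :=
      (h.hasDeriv_zero (Ioo_subset_Icc_self hu)).hasDerivAt (Icc_mem_nhds hu.1 hu.2)
    simpa using hd.inner ℝ (hasDerivAt_const u (curveDeriv v a b 1 p))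
  have hcont : ContinuousOn v (Icc a b) := h.smooth.continuousOn
  refine (convex_Icc a b).mul_sub_le_image_sub_of_le_deriv (hcont.inner continuousOn_const) ?_ ?_
    s hs t ht hst
  · rw [interior_Icc]
    exact fun u hu => (hderiv u hu).differentiableAt.differentiableWithinAt
  · rw [interior_Icc]
    intro u hu
    rw [(hderiv u hu).deriv]
    have h1 := h.dir_close u (Ioo_subset_Icc_self hu) p hp
    have h2 : ‖curveDeriv v a b 1 u - curveDeriv v a b 1 p‖ ≤ 1 / 4 := by
      have := sq_nonneg (1 + Real.cos (phiStar v a b))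
      linarith
    have h3 := norm_sub_sq_eq (h.norm_deriv (Ioo_subset_Icc_self hu)) (h.norm_deriv hp)
    nlinarith [norm_nonneg (curveDeriv v a b 1 u - curveDeriv v a b 1 p)]

lemma eq_of_inner_tangent_eq (h : EdgeSetting A v L a b δ) (hp : p ∈ Icc a b) {s t : ℝ}
    (hs : s ∈ Icc a b) (ht : t ∈ Icc a b)
    (hst : inner ℝ (v s) (curveDeriv v a b 1 p) = inner ℝ (v t) (curveDeriv v a b 1 p)) : s = t := by
  rcases le_total s t with hle | hle
  · linarith [h.tangent_growth hp hs ht hle]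
  · linarith [h.tangent_growth hp ht hs hle]

/-- The curve and its osculating circle agree up to third order. -/
lemma abs_inner_center_sub_le (h : EdgeSetting A v L a b δ) (hp : p ∈ Icc a b) {z : S2} {φ : ℝ}
    (ho : OscData v a b p z φ) {η : ℝ} (hη : 0 ≤ η) (hsub : Icc (p - η) (p + η) ⊆ Icc a b) {s : ℝ}
    (hs : s ∈ Icc (p - η) (p + η)) :
    |inner ℝ (v s) (z : E3) - Real.cos φ| ≤ supThird v a b * η ^ 3 := by
  have hf := h.isFrame' hp
  obtain ⟨z1, z2, z3⟩ := hf.inner_arcPoint φ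
  rw [← ho.center] at z1 z2 z3
  have hpm : p ∈ Icc (p - η) (p + η) := ⟨by linarith, by linarith⟩
  have hM0 : 0 ≤ supThird v a b := (norm_nonneg _).trans (h.norm_third_le hp)
  set g : ℕ → ℝ → ℝ := fun k s => inner ℝ (curveDeriv v a b k s) (z : E3) with hg
  -- Each use of the mean value inequality gains a factor `η`. Osculation means that the first and
  -- second derivatives of the height `⟨v, z⟩` vanish at `p`, so three uses give `η ^ 3`.
  have improve : ∀ k < 3, ∀ B : ℝ, (∀ s ∈ Icc (p - η) (p + η), |g (k + 1) s| ≤ B) → 0 ≤ B →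
      ∀ s ∈ Icc (p - η) (p + η), |g k s - g k p| ≤ B * η := by
    intro k hk B hB hB0 s hs
    have hd : ∀ s ∈ Icc (p - η) (p + η), HasDerivWithinAt (g k) (g (k + 1) s) (Icc (p - η) (p + η)) s := by
      intro s hs
      have := ((h.hasDeriv hk (hsub hs)).mono hsub).inner ℝ (hasDerivWithinAt_const s _ (z : E3))
      simpa using this
    have := (convex_Icc (p - η) (p + η)).norm_image_sub_le_of_norm_hasDerivWithin_le hd
      (fun s hs => hB s hs) hpm hs
    refine this.trans ?_
    gcongr
    rw [Real.norm_eq_abs, abs_le]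
    constructor <;> linarith [hs.1, hs.2]
  have b3 : ∀ s ∈ Icc (p - η) (p + η), |g 3 s| ≤ supThird v a b := by
    intro s hs
    refine (abs_real_inner_le_norm _ _).trans ?_
    rw [S2.norm_eq, mul_one]
    exact h.norm_third_le (hsub hs)
  have g2p : g 2 p = 0 := by
    simp only [hg]
    rw [hf.inner_eq, z1, z2, z3, (h.inner_second hp).1, ho.curv, geoCurv]
    ring
  have g1p : g 1 p = 0 := by
    simp only [hg]
    rw [real_inner_comm]; exact z2
  have g0p : g 0 p = Real.cos φ := by
    simp only [hg, curveDeriv_zero]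
    rw [real_inner_comm]; exact z1
  have b2 : ∀ s ∈ Icc (p - η) (p + η), |g 2 s| ≤ supThird v a b * η := by
    intro s hs
    have := improve 2 (by norm_num) _ b3 hM0 s hs
    rwa [g2p, sub_zero] at this
  have b1 : ∀ s ∈ Icc (p - η) (p + η), |g 1 s| ≤ supThird v a b * η * η := by
    intro s hs
    have := improve 1 (by norm_num) _ b2 (by positivity) s hs
    rwa [g1p, sub_zero] at this
  have := improve 0 (by norm_num) _ b1 (by positivity) s hs
  rw [g0p] at this
  simp only [hg, curveDeriv_zero] at this
  calc _ ≤ supThird v a b * η * η * η := this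
    _ = _ := by ring

end EdgeSetting

/-! ### The two sides of the curve and the band around the osculating circle -/

/-- The point of the hemisphere around `e` with tangential coordinates `τ`, `σ`. -/
noncomputable def hemiPoint (e T n : E3) (τ σ : ℝ) : E3 := √(1 - τ ^ 2 - σ ^ 2) • e + τ • T + σ • n

namespace IsFrame

variable {e T n : E3}

lemma inner_hemiPoint (h : IsFrame e T n) (τ σ : ℝ) :
    inner ℝ (hemiPoint e T n τ σ) e = √(1 - τ ^ 2 - σ ^ 2) ∧ inner ℝ (hemiPoint e T n τ σ) T = τ ∧
      inner ℝ (hemiPoint e T n τ σ) n = σ := h.comb _ _ _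

lemma norm_hemiPoint (h : IsFrame e T n) {τ σ : ℝ} (hτσ : τ ^ 2 + σ ^ 2 ≤ 1) :
    ‖hemiPoint e T n τ σ‖ = 1 := by
  have h1 := h.norm_sq_eq (hemiPoint e T n τ σ)
  obtain ⟨e1, e2, e3⟩ := h.inner_hemiPoint τ σ
  rw [e1, e2, e3, Real.sq_sqrt (by linarith)] at h1
  have : ‖hemiPoint e T n τ σ‖ ^ 2 = 1 ^ 2 := by rw [h1]; ring
  exact (pow_left_inj₀ (norm_nonneg _) zero_le_one two_ne_zero).1 this

lemma eq_hemiPoint (h : IsFrame e T n) {y : E3} (hy : ‖y‖ = 1) (hye : 0 ≤ inner ℝ y e) :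
    y = hemiPoint e T n (inner ℝ y T) (inner ℝ y n) := by
  obtain ⟨e1, e2, e3⟩ := h.inner_hemiPoint (inner ℝ y T) (inner ℝ y n)
  have h1 := h.norm_sq_eq y
  rw [hy] at h1
  refine h.ext ?_ e2.symm e3.symm
  rw [e1, show 1 - inner ℝ y T ^ 2 - inner ℝ y n ^ 2 = inner ℝ y e ^ 2 by linarith, Real.sqrt_sq hye]

lemma coord_bounds (h : IsFrame e T n) {y : E3} (hy : ‖y‖ = 1) {ρ : ℝ} (hρ : ‖y - e‖ ≤ ρ) :
    |inner ℝ y T| ≤ ρ ∧ |inner ℝ y n| ≤ ρ ∧ 1 - ρ ^ 2 / 2 ≤ inner ℝ y e := by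
  refine ⟨?_, ?_, ?_⟩
  · have := abs_real_inner_le_norm (y - e) T
    rw [inner_sub_left, h.e_T, sub_zero, h.norm_T, mul_one] at this
    exact this.trans hρ
  · have := abs_real_inner_le_norm (y - e) n
    rw [inner_sub_left, h.e_n, sub_zero, h.norm_n, mul_one] at this
    exact this.trans hρ
  · have := norm_sub_sq_eq hy h.norm_e
    have h2 : ‖y - e‖ ^ 2 ≤ ρ ^ 2 := pow_le_pow_left₀ (norm_nonneg _) hρ 2
    linarith

end IsFrame

namespace EdgeSetting

variable {A : Set S2} {v : ℝ → E3} {L a b δ p r : ℝ}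

lemma dDelta_le_of_sin (h : EdgeSetting A v L a b δ) :
    5 * dDelta v L a b δ ≤ Real.sin (phiStar v a b / 2) ∧ dDelta v L a b δ ≤ δ / 5 := by
  have h1 := h.dDelta_le
  have h2 := h.phiStar_pos
  have h3 := h.phiStar_le_pi_div_two
  have h4 : 0 ≤ Real.sin (phiStar v a b / 2) :=
    Real.sin_nonneg_of_nonneg_of_le_pi (by linarith) (by linarith [Real.pi_pos])
  have h5 := Real.sin_le_one (phiStar v a b / 2)
  have h6 := h.δ_pos
  have h7 := h.δ_le_one
  constructor <;> nlinarith

/-- Near `v p`, the part of the sphere on one side of the curve lies in `A` or in its complement. -/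
lemma mem_iff_arcPoint_mem (h : EdgeSetting A v L a b δ) (hp : p ∈ Icc (a + δ) (b - δ)) (hr : 0 < r)
    (hrd : 20 * r ≤ dDelta v L a b δ) {ζ : ℝ} (hζ : ζ = 1 ∨ ζ = -1) {α : ℝ} (hα : α ∈ Ioo 0 r)
    {y : S2} (hy : ‖(y : E3) - v p‖ ≤ 2 * r) {s : ℝ} (hs : s ∈ Icc (p - 3 * r) (p + 3 * r))
    (hsy : inner ℝ (v s) (curveDeriv v a b 1 p) = inner ℝ (y : E3) (curveDeriv v a b 1 p))
    (hσ : 0 < ζ * (inner ℝ (y : E3) (normal v a b p) - inner ℝ (v s) (normal v a b p))) :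
    y ∈ A ↔ arcPoint (v p) (normal v a b p) (ζ * α) ∈ Subtype.val '' A := by
  obtain ⟨hd1, hd2⟩ := h.dDelta_le_of_sin
  have hδ1 := h.δ_le_one
  have hr1 : r ≤ 1 / 100 := by linarith
  have hsub : Icc (p - 3 * r) (p + 3 * r) ⊆ Icc a b := by
    refine Icc_subset_Icc ?_ ?_ <;> linarith [hp.1, hp.2]
  have hp' := h.mem_Icc_of_mem hp
  have hf := h.isFrame' hp'
  have hζ2 : ζ ^ 2 = 1 := by rcases hζ with rfl | rfl <;> norm_num
  set e := v p with he
  set T := curveDeriv v a b 1 p with hT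
  set n := normal v a b p with hn
  have hcurve : ∀ s ∈ Icc (p - 3 * r) (p + 3 * r), |inner ℝ (v s) T| ≤ 3 * r ∧
      |inner ℝ (v s) n| ≤ 3 * r := by
    intro s hs
    have h1 := h.lipschitz s (h.Icc_subset (hsub hs)) p (h.Icc_subset hp')
    have h2 : |s - p| ≤ 3 * r := abs_le.2 ⟨by linarith [hs.1], by linarith [hs.2]⟩
    have := hf.coord_bounds (h.norm_eq_one (h.Icc_subset (hsub hs))) (h1.trans h2)
    exact ⟨this.1, this.2.1⟩
  -- The region on one side of the curve is parameterized by the curve parameter and by the fraction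
  -- of the way from the curve to the level `±4 r`. Fraction `0`, the curve itself, is left out; the
  -- curve stays below level `3 r`.
  set σ' : ℝ × ℝ → ℝ := fun q => (1 - q.2) * inner ℝ (v q.1) n + q.2 * (ζ * (4 * r)) with hσ'
  set G : ℝ × ℝ → E3 := fun q => hemiPoint e T n (inner ℝ (v q.1) T) (σ' q) with hG
  set D : Set (ℝ × ℝ) := Icc (p - 3 * r) (p + 3 * r) ×ˢ Ioc 0 1 with hD
  have hvc : ContinuousOn (fun q : ℝ × ℝ => v q.1) D :=
    (h.smooth.continuousOn.mono hsub).comp continuousOn_fst (fun q hq => hq.1)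
  have hσ'c : ContinuousOn σ' D :=
    ((continuousOn_const.sub continuousOn_snd).mul (hvc.inner continuousOn_const)).add
      (continuousOn_snd.mul continuousOn_const)
  have hτc : ContinuousOn (fun q : ℝ × ℝ => inner ℝ (v q.1) T) D := hvc.inner continuousOn_const
  have hGc : ContinuousOn G D := by
    have hw : ContinuousOn (fun q => √(1 - inner ℝ (v q.1) T ^ 2 - σ' q ^ 2)) D :=
      ((continuousOn_const.sub (hτc.pow 2)).sub (hσ'c.pow 2)).sqrt
    exact ((hw.smul continuousOn_const).add (hτc.smul continuousOn_const)).add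
      (hσ'c.smul continuousOn_const)
  have hpre : IsPreconnected (G '' D) :=
    (((convex_Icc _ _).prod (convex_Ioc _ _)).isPreconnected).image G hGc
  have hζr : |ζ * (4 * r)| = 4 * r := by
    rw [abs_mul, show |ζ| = 1 by rcases hζ with rfl | rfl <;> norm_num, one_mul, abs_of_pos (by positivity)]
  have hσ'b : ∀ q ∈ D, |σ' q| ≤ 4 * r := by
    rintro q ⟨hq1, hq2⟩
    have h1 := (hcurve q.1 hq1).2
    calc |σ' q| ≤ |(1 - q.2) * inner ℝ (v q.1) n| + |q.2 * (ζ * (4 * r))| := abs_add_le _ _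
      _ = (1 - q.2) * |inner ℝ (v q.1) n| + q.2 * (4 * r) := by
        rw [abs_mul, abs_mul, hζr, abs_of_pos hq2.1, abs_of_nonneg (by linarith [hq2.2])]
      _ ≤ (1 - q.2) * (4 * r) + q.2 * (4 * r) := by
        gcongr
        · linarith [hq2.2]
        · linarith
      _ = 4 * r := by ring
  have hsq : ∀ q ∈ D, inner ℝ (v q.1) T ^ 2 + σ' q ^ 2 ≤ 25 * r ^ 2 := by
    intro q hq
    have h1 := sq_le_sq' (abs_le.1 (hcurve q.1 hq.1).1).1 (abs_le.1 (hcurve q.1 hq.1).1).2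
    have h2 := sq_le_sq' (abs_le.1 (hσ'b q hq)).1 (abs_le.1 (hσ'b q hq)).2
    linarith
  have hr25 : 25 * r ^ 2 ≤ 1 := by nlinarith
  have hnorm : ∀ w ∈ G '' D, ‖w‖ = 1 := by
    rintro _ ⟨q, hq, rfl⟩
    exact hf.norm_hemiPoint ((hsq q hq).trans hr25)
  have hdisj : ∀ w ∈ G '' D, w ∉ bdry A := by
    rintro _ ⟨q, hq, rfl⟩ hwA
    rw [h.bdry_eq] at hwA
    obtain ⟨u, hu, hue⟩ := hwA
    obtain ⟨g1, g2, g3⟩ := hf.inner_hemiPoint (inner ℝ (v q.1) T) (σ' q)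
    -- The tangential coordinates have squared length at most `9 r² + 16 r²`, which gives a chord
    -- below `10 r` and a geodesic distance below `20 r`. This is the source of `20 r ≤ d_δ`.
    have hclose : geoDist (v p) (v u) < 20 * r := by
      have h1 := norm_sub_sq_eq (h.norm_eq_one hu) hf.norm_e
      rw [hue, hG, g1] at h1
      have h2 : 1 - 25 * r ^ 2 ≤ √(1 - inner ℝ (v q.1) T ^ 2 - σ' q ^ 2) := by
        refine Real.le_sqrt_of_sq_le ?_
        have := hsq q hq
        nlinarith [sq_nonneg r]
      have h3 := geoDist_le_two_mul_norm_sub (h.norm_eq_one hu) hf.norm_e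
      rw [geoDist_comm, hue] at h3
      rw [hue]
      have h4 : ‖hemiPoint e T n (inner ℝ (v q.1) T) (σ' q) - e‖ < 10 * r := by
        refine lt_of_pow_lt_pow_left₀ 2 (by positivity) ?_
        have h1' : ‖hemiPoint e T n (inner ℝ (v q.1) T) (σ' q) - e‖ ^ 2 =
            2 - 2 * √(1 - inner ℝ (v q.1) T ^ 2 - σ' q ^ 2) := h1
        nlinarith [pow_pos hr 2]
      have h4' : ‖G q - e‖ < 10 * r := h4
      have h3' : geoDist (v p) (G q) ≤ 2 * ‖G q - e‖ := h3
      linarith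
    -- By the definition of `d_δ` no other part of the boundary comes this close, so only the
    -- regular segment has to be ruled out, and there the tangential coordinate determines the
    -- parameter.
    have huI : u ∈ Ioo a b := by
      by_contra hcon
      linarith [h.dDelta_le_geoDist hp ⟨hu, hcon⟩]
    have hus : u = q.1 := by
      refine h.eq_of_inner_tangent_eq hp' (Ioo_subset_Icc_self huI) (hsub hq.1) ?_
      rw [hue]; exact g2
    change inner ℝ (G q) n = σ' q at g3
    rw [← hue, hus] at g3
    have h1 : q.2 * (ζ * (4 * r) - inner ℝ (v q.1) n) = 0 := by
      have : σ' q = (1 - q.2) * inner ℝ (v q.1) n + q.2 * (ζ * (4 * r)) := rfl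
      linarith
    rcases mul_eq_zero.1 h1 with h2 | h2
    · exact hq.2.1.ne' h2
    · have := (hcurve q.1 hq.1).2
      rw [show inner ℝ (v q.1) n = ζ * (4 * r) by linarith, hζr] at this
      linarith
  -- The reference point on the normal has curve parameter `p` and fraction `sin α / (4 r)`.
  have hbase : arcPoint e n (ζ * α) ∈ G '' D := by
    have hsin := Real.sin_pos_of_pos_of_lt_pi hα.1 (by linarith [hα.2, Real.pi_gt_three])
    have hsin' := Real.sin_lt hα.1
    refine ⟨(p, Real.sin α / (4 * r)), ⟨⟨by linarith, by linarith⟩, by positivity, ?_⟩, ?_⟩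
    · rw [div_le_one (by positivity)]; linarith [hα.2]
    · have hs0 : Real.sin (ζ * α) = ζ * Real.sin α := by
        rcases hζ with rfl | rfl <;> simp
      have hc0 : Real.cos (ζ * α) = Real.cos α := by
        rcases hζ with rfl | rfl <;> simp
      have hcn : 0 ≤ Real.cos α :=
        Real.cos_nonneg_of_neg_pi_div_two_le_of_le (by linarith [hα.1, Real.pi_pos])
          (by linarith [hα.2, Real.pi_gt_three])
      obtain ⟨a1, a2, a3⟩ := hf.inner_arcPoint (ζ * α)
      rw [hf.eq_hemiPoint (hf.norm_arcPoint (ζ * α)) (by rw [a1, hc0]; exact hcn), a2, a3, hs0]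
      have e1 : inner ℝ (v (p, Real.sin α / (4 * r)).1) T = 0 := hf.e_T
      have e2 : σ' (p, Real.sin α / (4 * r)) = ζ * Real.sin α := by
        have : inner ℝ (v p) n = 0 := hf.e_n
        simp only [hσ', this]
        field_simp
        ring
      simp only [hG]
      rw [e2, ← he, hf.e_T]
  have hymem : (y : E3) ∈ G '' D := by
    obtain ⟨y1, y2, y3⟩ := hf.coord_bounds (S2.norm_eq y) hy
    have hs3 := (hcurve s hs).2
    set σy : ℝ := inner ℝ (y : E3) n with hσy
    set σs : ℝ := inner ℝ (v s) n with hσs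
    have hden : 0 < ζ * (ζ * (4 * r) - σs) := by
      have h1 : ζ * (ζ * (4 * r) - σs) = 4 * r - ζ * σs := by linear_combination (4 * r) * hζ2
      rw [h1]
      have : ζ * σs ≤ |σs| := by
        rcases hζ with rfl | rfl
        · rw [one_mul]; exact le_abs_self _
        · rw [neg_one_mul]; exact neg_le_abs _
      linarith
    have hden' : ζ * (4 * r) - σs ≠ 0 := by
      intro h0; rw [h0, mul_zero] at hden; exact lt_irrefl _ hden
    have hζ0 : ζ ≠ 0 := by rcases hζ with rfl | rfl <;> norm_num
    have hlam : (σy - σs) / (ζ * (4 * r) - σs) = ζ * (σy - σs) / (ζ * (ζ * (4 * r) - σs)) := by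
      rw [mul_div_mul_left _ _ hζ0]
    refine ⟨(s, (σy - σs) / (ζ * (4 * r) - σs)), ⟨hs, ?_, ?_⟩, ?_⟩
    · rw [hlam]; positivity
    · change (σy - σs) / (ζ * (4 * r) - σs) ≤ 1
      rw [hlam, div_le_one hden]
      have : ζ * σy ≤ |σy| := by
        rcases hζ with rfl | rfl
        · rw [one_mul]; exact le_abs_self _
        · rw [neg_one_mul]; exact neg_le_abs _
      have h2 : ζ * (ζ * (4 * r)) = 4 * r := by linear_combination (4 * r) * hζ2
      rw [mul_sub, mul_sub, h2]
      linarith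
    · rw [hf.eq_hemiPoint (S2.norm_eq y) (by nlinarith)]
      have e2 : σ' (s, (σy - σs) / (ζ * (4 * r) - σs)) = σy := by
        simp only [hσ']
        rw [← hσs]
        linear_combination div_mul_cancel₀ (σy - σs) hden'
      simp only [hG]
      rw [e2, hsy]
  exact mem_of_isPreconnected hpre hnorm hdisj hbase hymem

lemma Icc_sub_subset (h : EdgeSetting A v L a b δ) (hp : p ∈ Icc (a + δ) (b - δ))
    (hrd : 20 * r ≤ dDelta v L a b δ) : Icc (p - 3 * r) (p + 3 * r) ⊆ Icc a b := by
  have h1 := h.dDelta_le_of_sin.2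
  refine Icc_subset_Icc ?_ ?_ <;> linarith [hp.1, hp.2, h.δ_pos]

/-- Intermediate value theorem: over a parameter length `3 r` the tangential coordinate moves by at
least `93 r / 32 > 2 r` to either side. -/
lemma exists_inner_tangent_eq (h : EdgeSetting A v L a b δ) (hp : p ∈ Icc (a + δ) (b - δ)) (hr : 0 < r)
    (hrd : 20 * r ≤ dDelta v L a b δ) {c : ℝ} (hc : |c| ≤ 2 * r) :
    ∃ s ∈ Icc (p - 3 * r) (p + 3 * r), inner ℝ (v s) (curveDeriv v a b 1 p) = c := by
  have hsub := h.Icc_sub_subset hp hrd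
  have hp' := h.mem_Icc_of_mem hp
  have hτp : inner ℝ (v p) (curveDeriv v a b 1 p) = 0 := (h.isFrame' hp').e_T
  have hcont : ContinuousOn (fun s => inner ℝ (v s) (curveDeriv v a b 1 p))
      (Icc (p - 3 * r) (p + 3 * r)) :=
    (h.smooth.continuousOn.mono hsub).inner continuousOn_const
  refine intermediate_value_Icc (by linarith) hcont ⟨?_, ?_⟩
  · have := h.tangent_growth hp' (hsub ⟨le_rfl, by linarith⟩) hp' (by linarith : p - 3 * r ≤ p)
    rw [hτp] at this
    linarith [(abs_le.1 hc).1]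
  · have := h.tangent_growth hp' hp' (hsub ⟨by linarith, le_rfl⟩) (by linarith : p ≤ p + 3 * r)
    rw [hτp] at this
    linarith [(abs_le.1 hc).2]

/-- On a line of constant tangential coordinate, the height over the plane of the osculating circle
is strictly increasing in the normal coordinate. -/
lemma exists_inner_center_sub_eq (h : EdgeSetting A v L a b δ) (hp : p ∈ Icc (a + δ) (b - δ))
    {z : S2} {φ : ℝ} (ho : OscData v a b p z φ) (hr : 0 < r) (hrd : 20 * r ≤ dDelta v L a b δ)
    {y y' : E3} (hy1 : ‖y‖ = 1) (hy1' : ‖y'‖ = 1) (hy : ‖y - v p‖ ≤ 3 * r) (hy' : ‖y' - v p‖ ≤ 3 * r)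
    (hyy : inner ℝ y' (curveDeriv v a b 1 p) = inner ℝ y (curveDeriv v a b 1 p)) :
    ∃ c : ℝ, 0 < c ∧ inner ℝ y (z : E3) - inner ℝ y' (z : E3) =
      (inner ℝ y (normal v a b p) - inner ℝ y' (normal v a b p)) * c := by
  obtain ⟨hd1, hd2⟩ := h.dDelta_le_of_sin
  have hr1 : r ≤ 1 / 100 := by linarith [h.δ_le_one]
  have hp' := h.mem_Icc_of_mem hp
  have hf := h.isFrame' hp'
  obtain ⟨y1, y2, y3⟩ := hf.coord_bounds hy1 hy
  obtain ⟨s1, s2, s3⟩ := hf.coord_bounds hy1' hy'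
  obtain ⟨z1, z2, z3⟩ := hf.inner_arcPoint φ
  rw [← ho.center] at z1 z2 z3
  have hFy := hf.inner_eq y z
  have hFs := hf.inner_eq y' z
  have hny := hf.norm_sq_eq y
  have hns := hf.norm_sq_eq y'
  rw [hy1] at hny
  rw [hy1', hyy] at hns
  rw [z1, z2, z3] at hFy hFs
  set w : ℝ := inner ℝ y (v p)
  set ws : ℝ := inner ℝ y' (v p)
  set σ : ℝ := inner ℝ y (normal v a b p)
  set σs : ℝ := inner ℝ y' (normal v a b p)
  -- From `20 r ≤ d_δ`, `5 d_δ ≤ sin(φ* / 2)` and `sin(φ* / 2) ≤ sin φ* ≤ sin φ`.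
  have hsin : 100 * r ≤ Real.sin φ := by
    have e1 := h.sin_phiStar_le hp'
    have e2 := OscData.sin_eq h hp' ho
    have e3 : Real.sin (phiStar v a b / 2) ≤ Real.sin (phiStar v a b) :=
      Real.sin_le_sin_of_le_of_le_pi_div_two (by linarith [h.phiStar_pos, Real.pi_pos])
        h.phiStar_le_pi_div_two (by linarith [h.phiStar_pos])
    linarith
  have hW : 1 ≤ w + ws := by nlinarith
  have hbr : 0 < Real.sin φ * (w + ws) - Real.cos φ * (σ + σs) := by
    have e1 : |Real.cos φ * (σ + σs)| ≤ 1 * (6 * r) := by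
      rw [abs_mul]
      refine mul_le_mul (Real.abs_cos_le_one _) ?_ (abs_nonneg _) zero_le_one
      exact (abs_add_le _ _).trans (by linarith)
    have e2 : Real.sin φ * 1 ≤ Real.sin φ * (w + ws) :=
      mul_le_mul_of_nonneg_left hW (by linarith)
    linarith [le_abs_self (Real.cos φ * (σ + σs))]
  -- Equal tangential coordinates and unit norms give `w² - ws² = σs² - σ²`, which expresses `w -
  -- ws` through `σ - σs`. The sine term dominates because `|σ + σs| ≤ 6 r` is small against `sin
  -- φ`.
  refine ⟨(Real.sin φ * (w + ws) - Real.cos φ * (σ + σs)) / (w + ws), by positivity, ?_⟩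
  rw [hFy, hFs, mul_div_assoc', eq_div_iff (by positivity)]
  linear_combination Real.cos φ * (hns - hny)

/-- Near the curve, `A` and the osculating cap differ only in a thin band. -/
lemma mem_iff_mem_cap_or_band (h : EdgeSetting A v L a b δ) (hp : p ∈ Icc (a + δ) (b - δ))
    {z : S2} {φ : ℝ} (ho : OscData v a b p z φ) (hr : 0 < r) (hrd : 20 * r ≤ dDelta v L a b δ)
    {y : S2} (hy : ‖(y : E3) - v p‖ ≤ 2 * r) :
    (y ∈ A ↔ y ∈ cap z φ) ∨ (|inner ℝ (z : E3) y - Real.cos φ| ≤ supThird v a b * (3 * r) ^ 3 ∧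
      |inner ℝ (curveDeriv v a b 1 p) (y : E3)| ≤ 2 * r) := by
  have hsub := h.Icc_sub_subset hp hrd
  have hp' := h.mem_Icc_of_mem hp
  have hpo := h.mem_Ioo_of_mem hp
  obtain ⟨y1, -, -⟩ := (h.isFrame' hp').coord_bounds (S2.norm_eq y) hy
  -- `y` is compared with the curve point of the same tangential coordinate. The order of their
  -- normal coordinates decides membership in `A` and also orders their heights, while the height of
  -- the curve point is `cos φ` up to the cubic error.
  obtain ⟨s, hs, hsy⟩ := h.exists_inner_tangent_eq hp hr hrd y1
  have hvs := h.norm_eq_one (h.Icc_subset (hsub hs))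
  have hsp : ‖v s - v p‖ ≤ 3 * r :=
    (h.lipschitz s (h.Icc_subset (hsub hs)) p (h.Icc_subset hp')).trans
      (abs_le.2 ⟨by linarith [hs.1], by linarith [hs.2]⟩)
  have hF := abs_le.1 (h.abs_inner_center_sub_le hp' ho (by positivity) hsub hs)
  have hcap : y ∈ cap z φ ↔ Real.cos φ < inner ℝ (y : E3) z := mem_cap_iff ho.mem.1.le ho.mem.2.le
  obtain ⟨c, hc0, hc⟩ := h.exists_inner_center_sub_eq hp ho hr hrd (S2.norm_eq y) hvs
    (hy.trans (by linarith)) hsp hsy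
  rw [real_inner_comm (y : E3) (z : E3), real_inner_comm (y : E3) (curveDeriv v a b 1 p)]
  have hA := fun (ζ : ℝ) (hζ : ζ = 1 ∨ ζ = -1) (α : ℝ) (hα : α ∈ Ioo 0 r) =>
    h.mem_iff_arcPoint_mem hp hr hrd hζ hα hy hs hsy
  generalize inner ℝ (v s) (z : E3) = Fs at *
  generalize inner ℝ (y : E3) (z : E3) = F at *
  generalize inner ℝ (y : E3) (normal v a b p) = σ at *
  generalize inner ℝ (v s) (normal v a b p) = σs at *
  have hα : ∀ᶠ α : ℝ in 𝓝[>] 0, α ∈ Ioo 0 r := Ioo_mem_nhdsGT hr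
  rcases lt_trichotomy σ σs with hlt | heq | hgt
  · obtain ⟨α, hα1, hα2⟩ := ((h.eventually_arcPoint_notMem hpo).and hα).exists
    have hyA : y ∉ A := by
      rw [hA (-1) (Or.inr rfl) α hα2 (by linarith), neg_one_mul]; exact hα1
    have hle := mul_neg_of_neg_of_pos (sub_neg.2 hlt) hc0
    by_cases hcF : Real.cos φ < F
    -- Here `y` is outside `A` but inside the cap, so its height lies between `cos φ` and the height
    -- of the curve point.
    · refine Or.inr ⟨?_, y1⟩
      rw [abs_of_pos (by linarith)]
      linarith [hF.2]
    · exact Or.inl (iff_of_false hyA (fun hyc => hcF (hcap.1 hyc)))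
  · refine Or.inr ⟨?_, y1⟩
    rw [heq, sub_self, zero_mul] at hc
    rw [show F = Fs by linarith]
    exact abs_le.2 hF
  · obtain ⟨α, hα1, hα2⟩ := ((h.eventually_arcPoint_mem hp').and hα).exists
    have hyA : y ∈ A := by
      rw [hA 1 (Or.inl rfl) α hα2 (by linarith), one_mul]; exact hα1
    have hle := mul_pos (sub_pos.2 hgt) hc0
    by_cases hcF : Real.cos φ < F
    · exact Or.inl (iff_of_true hyA (hcap.2 hcF))
    · refine Or.inr ⟨?_, y1⟩
      rw [abs_of_nonpos (by linarith)]
      linarith [hF.1]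

end EdgeSetting

/-! ### The rotated wavelet -/

lemma rotMatrix_inv {x r : E3} (hx : ‖x‖ = 1) (hr : ‖r‖ = 1) (hxr : inner ℝ x r = 0) :
    (rotMatrix x r)⁻¹ = (rotMatrix x r)ᵀ := by
  have h := (rotMatrix_spec x r hx hr hxr).1
  rw [Matrix.mem_specialOrthogonalGroup_iff, Matrix.mem_orthogonalGroup_iff'] at h
  exact Matrix.inv_eq_left_inv h.1

/-- The inverse rotation is the transpose, so the colatitude of the rotated point is its distance
from `x`; the direction `r` affects only the longitude, in which the localization bound is uniform.
-/
lemma rotOp_wavelet {x r : E3} (hx : ‖x‖ = 1) (hr : ‖r‖ = 1) (hxr : inner ℝ x r = 0) (κ : ℝ → ℝ)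
    (K N : ℕ) (y : E3) :
    rotOp x r (wavelet κ K N) y =
      waveletPolar κ K N (geoDist y x) (Complex.arg ⟨inner ℝ y r, inner ℝ y (cross x r)⟩) := by
  have key : ∀ (i : Fin 3) (w : E3), (∀ j, (rotMatrix x r) j i = w j) →
      ((rotMatrix x r)ᵀ *ᵥ y.ofLp) i = inner ℝ y w := by
    intro i w hw
    simp [Matrix.mulVec, dotProduct, hw, PiLp.inner_apply]
  rw [rotOp, wavelet, rotMatrix_inv hx hr hxr]
  change waveletPolar κ K N (Real.arccos (((rotMatrix x r)ᵀ *ᵥ y.ofLp) 2))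
    (Complex.arg ⟨((rotMatrix x r)ᵀ *ᵥ y.ofLp) 0, ((rotMatrix x r)ᵀ *ᵥ y.ofLp) 1⟩) = _
  rw [key 0 r (fun j => rfl), key 1 (cross x r) (fun j => rfl), key 2 x (fun j => rfl), geoDist]

lemma measurable_assocLegendre (n : ℕ) (k : ℤ) : Measurable (assocLegendre n k) := by
  have h : ∀ k, Measurable (assocLegendreNat n k) := fun k => by
    refine Continuous.measurable ?_
    unfold assocLegendreNat
    exact ((by fun_prop : Continuous fun x : ℝ => √(1 - x ^ 2)).pow k).mul (Polynomial.continuous _)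
  by_cases hk : 0 ≤ k
  · have : assocLegendre n k = assocLegendreNat n k.toNat := by
      ext x; simp [assocLegendre, hk]
    rw [this]; exact h _
  · have : assocLegendre n k = fun x => (-1) ^ k * ((((n : ℤ) + k).toNat.factorial : ℝ) /
        (((n : ℤ) - k).toNat.factorial : ℝ)) * assocLegendreNat n (-k).toNat x := by
      ext x; simp [assocLegendre, hk]
    rw [this]; exact (h _).const_mul _

lemma measurable_waveletPolar {f κ : ℝ → ℝ} (hfκ : ∀ t, 0 ≤ t → f t = κ t)
    (hf : ∀ t, f t ≠ 0 → t ∈ Icc (1 / 2 : ℝ) 2) (K N : ℕ) :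
    Measurable fun q : ℝ × ℝ => waveletPolar κ K N q.1 q.2 := by
  simp only [waveletPolar_eq_sum_range hfκ hf]
  refine Finset.measurable_sum _ fun n _ => Finset.measurable_sum _ fun k _ => Measurable.const_mul ?_ _
  unfold sphHarm
  refine Measurable.mul (Measurable.const_mul ?_ _) ?_
  · exact Complex.measurable_ofReal.comp
      ((measurable_assocLegendre n k).comp (Real.measurable_cos.comp measurable_fst))
  · fun_prop

lemma measurable_rotOp_wavelet {f κ : ℝ → ℝ} (hfκ : ∀ t, 0 ≤ t → f t = κ t)
    (hf : ∀ t, f t ≠ 0 → t ∈ Icc (1 / 2 : ℝ) 2) (K N : ℕ) {x r : E3} (hx : ‖x‖ = 1) (hr : ‖r‖ = 1)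
    (hxr : inner ℝ x r = 0) : Measurable fun y : S2 => rotOp x r (wavelet κ K N) y := by
  have h1 : Measurable fun y : S2 => inner ℝ (y : E3) r :=
    (by fun_prop : Continuous _).measurable
  have h2 : Measurable fun y : S2 => inner ℝ (y : E3) (cross x r) :=
    (by fun_prop : Continuous _).measurable
  have h3 : Measurable fun y : S2 =>
      Complex.arg ((inner ℝ (y : E3) r : ℝ) + (inner ℝ (y : E3) (cross x r) : ℝ) * Complex.I) :=
    Complex.measurable_arg.comp ((Complex.measurable_ofReal.comp h1).add
      ((Complex.measurable_ofReal.comp h2).mul_const _))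
  have h4 := (measurable_waveletPolar hfκ hf K N).comp ((measurable_geoDist x).prodMk h3)
  refine (congrArg Measurable (funext fun y => ?_)).mp h4
  rw [rotOp_wavelet hx hr hxr, Complex.mk_eq_add_mul_I, Function.comp_apply]

instance : IsFiniteMeasure surf := by unfold surf; infer_instance

lemma measurableSet_cap (z : S2) (φ : ℝ) : MeasurableSet (cap z φ) :=
  measurableSet_lt (measurable_geoDist z) measurable_const

/-! ### Integrals of functions supported far from a point or in a band -/

lemma norm_integral_le_of_band {F : S2 → ℂ} {x z T : E3} (hx : ‖x‖ = 1) (hz : ‖z‖ = 1) (hT : ‖T‖ = 1)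
    (hzT : inner ℝ z T = 0) {c h ρ r C₁ C₂ : ℝ} (hc : |c| < 1) (hh : 0 ≤ h) (hρ : 0 ≤ ρ) (hr : 0 < r)
    (hC₁ : 0 ≤ C₁) (hC₂ : 0 ≤ C₂) {m : ℕ} (hm : 3 ≤ m)
    (hF : ∀ y : S2, F y ≠ 0 → r ≤ geoDist (y : E3) x ∨
      (|inner ℝ z (y : E3) - c| ≤ h ∧ |inner ℝ T (y : E3)| ≤ ρ))
    (h1 : ∀ y, ‖F y‖ ≤ C₁) (h2 : ∀ y : S2, geoDist (y : E3) x ^ m * ‖F y‖ ≤ C₂) :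
    ‖∫ y, F y ∂surf‖ ≤ C₁ * (24 * ρ * h / (1 - |c|)) + C₂ * (192 * r ^ 2 * (r ^ m)⁻¹) := by
  set B : Set S2 := {y | |inner ℝ z (y : E3) - c| ≤ h ∧ |inner ℝ T (y : E3)| ≤ ρ} with hB
  set D : Set S2 := {y | r ≤ geoDist (y : E3) x} with hD
  have hBm : MeasurableSet B := by
    have h1 : IsClosed {y : S2 | |inner ℝ z (y : E3) - c| ≤ h} := isClosed_le (by fun_prop) (by fun_prop)
    have h2 : IsClosed {y : S2 | |inner ℝ T (y : E3)| ≤ ρ} := isClosed_le (by fun_prop) (by fun_prop)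
    exact (h1.inter h2).measurableSet
  have hDm : MeasurableSet D := measurableSet_le measurable_const (measurable_geoDist x)
  have hc' : 0 < 1 - |c| := by linarith
  -- The sup bound is used on the band and the decay outside the `r`-ball; the integrand vanishes
  -- elsewhere.
  have hpt : ∀ y, ‖F y‖ₑ ≤ B.indicator (fun _ => ENNReal.ofReal C₁) y +
      D.indicator (fun y : S2 => ENNReal.ofReal C₂ * ENNReal.ofReal ((geoDist (y : E3) x ^ m)⁻¹)) y := by
    intro y
    by_cases h0 : F y = 0
    · simp [h0]
    rcases hF y h0 with hy | hy
    · rw [indicator_of_mem (show y ∈ D from hy)]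
      refine le_add_left ?_
      rw [← ENNReal.ofReal_mul hC₂, ← ofReal_norm]
      refine ENNReal.ofReal_le_ofReal ?_
      have hpos : 0 < geoDist (y : E3) x ^ m := pow_pos (hr.trans_le hy) m
      rw [← div_eq_mul_inv, le_div_iff₀ hpos, mul_comm]
      exact h2 y
    · rw [indicator_of_mem (show y ∈ B from hy)]
      refine le_add_right ?_
      rw [← ofReal_norm]
      exact ENNReal.ofReal_le_ofReal (h1 y)
  have key : ‖∫ y, F y ∂surf‖ₑ ≤
      ENNReal.ofReal (C₁ * (24 * ρ * h / (1 - |c|)) + C₂ * (192 * r ^ 2 * (r ^ m)⁻¹)) := by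
    calc ‖∫ y, F y ∂surf‖ₑ ≤ ∫⁻ y, ‖F y‖ₑ ∂surf := enorm_integral_le_lintegral_enorm _
      _ ≤ ∫⁻ y, (B.indicator (fun _ => ENNReal.ofReal C₁) y + D.indicator (fun y : S2 =>
          ENNReal.ofReal C₂ * ENNReal.ofReal ((geoDist (y : E3) x ^ m)⁻¹)) y) ∂surf := lintegral_mono hpt
      _ = ENNReal.ofReal C₁ * surf B + ENNReal.ofReal C₂ *
          ∫⁻ y in D, ENNReal.ofReal ((geoDist (y : E3) x ^ m)⁻¹) ∂surf := by
        rw [lintegral_add_left (measurable_const.indicator hBm), lintegral_indicator hBm,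
          lintegral_indicator hDm, setLIntegral_const, lintegral_const_mul' _ _ ENNReal.ofReal_ne_top]
      _ ≤ ENNReal.ofReal C₁ * ENNReal.ofReal (24 * ρ * h / (1 - |c|)) +
          ENNReal.ofReal C₂ * ENNReal.ofReal (192 * r ^ 2 * (r ^ m)⁻¹) := by
        gcongr
        · exact surf_band_le hz hT hzT hc hh hρ
        · exact lintegral_geoDist_inv_pow_le hx hr hm
      _ = _ := by
        rw [← ENNReal.ofReal_mul hC₁, ← ENNReal.ofReal_mul hC₂, ← ENNReal.ofReal_add] <;> positivity
  rw [← ofReal_norm] at key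
  exact (ENNReal.ofReal_le_ofReal_iff (by positivity)).1 key

/-! ### Assembly of the estimate -/

namespace EdgeSetting

variable {A : Set S2} {v : ℝ → E3} {L a b δ p r : ℝ}

lemma supThird_nonneg (h : EdgeSetting A v L a b δ) : 0 ≤ supThird v a b :=
  (norm_nonneg _).trans (h.norm_third_le (left_mem_Icc.2 h.a_lt_b.le))

lemma mem_iff_mem_cap_or (h : EdgeSetting A v L a b δ) (hp : p ∈ Icc (a + δ) (b - δ)) {z : S2} {φ : ℝ}
    (ho : OscData v a b p z φ) {x : S2} (hx : geoDistSet x (bdry A) = geoDist x (v p))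
    (hxφ : geoDist x (v p) ≤ phiStar v a b / 4) (hr : 0 < r) (hrd : 20 * r ≤ dDelta v L a b δ)
    {y : S2} (hy : geoDist (y : E3) x < r) :
    (y ∈ A ↔ y ∈ cap z φ) ∨ (|inner ℝ (z : E3) y - Real.cos φ| ≤ supThird v a b * (3 * r) ^ 3 ∧
      |inner ℝ (curveDeriv v a b 1 p) (y : E3)| ≤ 2 * r) := by
  rcases le_or_gt r (geoDist (x : E3) (v p)) with hle | hlt
  · exact Or.inl (h.mem_iff_mem_cap_of_far (h.mem_Ioo_of_mem hp) ho hx hxφ hr hle hy)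
  · refine h.mem_iff_mem_cap_or_band hp ho hr hrd ?_
    have hv := h.norm_eq_one (h.Icc_subset (h.mem_Icc_of_mem hp))
    have h1 := norm_sub_le_geoDist (S2.norm_eq y) hv
    have h2 := geoDist_triangle (S2.norm_eq y) (S2.norm_eq x) hv
    linarith

/-- Keeps the constant `1 / (1 - |cos φ|)` of the band estimate under control by `φ*` alone. -/
lemma abs_cos_le (h : EdgeSetting A v L a b δ) (hp : p ∈ Icc a b) {z : S2} {φ : ℝ}
    (ho : OscData v a b p z φ) :
    |Real.cos φ| ≤ Real.cos (phiStar v a b) ∧ Real.cos (phiStar v a b) < 1 := by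
  obtain ⟨h1, h2⟩ := OscData.angle_mem h hp ho
  have h3 := h.phiStar_pos
  have h4 := h.phiStar_le_pi_div_two
  have h5 := Real.pi_pos
  refine ⟨abs_le.2 ⟨?_, ?_⟩, ?_⟩
  · rw [← Real.cos_pi_sub]
    exact Real.cos_le_cos_of_nonneg_of_le_pi ho.mem.1.le (by linarith) h2
  · exact Real.cos_le_cos_of_nonneg_of_le_pi h3.le ho.mem.2.le h1
  · rw [← Real.cos_zero]
    exact Real.cos_lt_cos_of_nonneg_of_le_pi_div_two le_rfl h4 h3

end EdgeSetting

lemma coeffIntegrand_eq_zero {A C : Set S2} {κ : ℝ → ℝ} {K N : ℕ} {x r : E3} {y : S2}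
    (h : y ∈ A ↔ y ∈ C) : coeffIntegrand A C κ K N x r y = 0 := by
  by_cases hA : y ∈ A
  · simp [coeffIntegrand, hA, h.1 hA]
  · have hC : y ∉ C := fun hC => hA (h.2 hC)
    simp [coeffIntegrand, hA, hC]

lemma norm_coeffIntegrand_le {A C : Set S2} {κ : ℝ → ℝ} {K N : ℕ} {x r : E3} {y : S2} :
    ‖coeffIntegrand A C κ K N x r y‖ ≤ ‖rotOp x r (wavelet κ K N) y‖ := by
  rw [coeffIntegrand, norm_mul, RCLike.norm_conj]
  refine mul_le_of_le_one_left (norm_nonneg _) ?_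
  by_cases hA : y ∈ A <;> by_cases hC : y ∈ C <;> simp [hA, hC]

lemma integrable_coeffIntegrand {A C : Set S2} (hA : NullMeasurableSet A surf) (hC : MeasurableSet C)
    {κ : ℝ → ℝ} {K N : ℕ} {x r : E3} (hm : Measurable fun y : S2 => rotOp x r (wavelet κ K N) y) {B : ℝ}
    (hB : ∀ y : S2, ‖rotOp x r (wavelet κ K N) y‖ ≤ B) :
    Integrable (coeffIntegrand A C κ K N x r) surf := by
  refine Integrable.of_bound ?_ B (ae_of_all _ fun y => norm_coeffIntegrand_le.trans (hB y))
  refine AEStronglyMeasurable.mul (AEStronglyMeasurable.sub ?_ ?_) ?_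
  · exact aestronglyMeasurable_const.indicator₀ hA
  · exact aestronglyMeasurable_const.indicator hC
  · exact (Complex.continuous_conj.measurable.comp hm).aestronglyMeasurable

/-- The scales of the band and of the tail, in terms of powers of `N`. -/
lemma rpow_scale_le {N : ℕ} (hN : 1 ≤ N) {ε : ℝ} {m : ℕ} (hm : 2 * ε ≤ (1 - ε) * m) {r : ℝ}
    (hr : r = (N : ℝ) ^ (-ε) / 10) :
    (N : ℝ) ^ 2 * r ^ 4 ≤ (N : ℝ) ^ (2 - 4 * ε) ∧
      (N : ℝ) ^ 2 * ((N : ℝ) ^ m)⁻¹ * (r ^ 2 * (r ^ m)⁻¹) ≤ 10 ^ m * (N : ℝ) ^ (2 - 4 * ε) := by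
  have hN1 : (1 : ℝ) ≤ N := by exact_mod_cast hN
  have hN0 : (0 : ℝ) < N := by linarith
  set n : ℝ := (N : ℝ) ^ (-ε) with hn
  have hn0 : 0 < n := Real.rpow_pos_of_pos hN0 _
  have e2 : (N : ℝ) ^ 2 = (N : ℝ) ^ (2 : ℝ) := by norm_cast
  have en : ∀ k : ℕ, n ^ k = (N : ℝ) ^ (-ε * k) := fun k => by
    rw [hn, Real.rpow_mul hN0.le, Real.rpow_natCast]
  constructor
  · have : (N : ℝ) ^ (2 - 4 * ε) = (N : ℝ) ^ 2 * n ^ 4 := by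
      rw [e2, en, ← Real.rpow_add hN0]; congr 1; push_cast; ring
    rw [this, hr, div_pow]
    gcongr
    exact div_le_self (by positivity) (by norm_num)
  · have h1 : (N : ℝ) ^ 2 * ((N : ℝ) ^ m)⁻¹ * (r ^ 2 * (r ^ m)⁻¹) =
        10 ^ m / 100 * ((N : ℝ) ^ 2 * n ^ 2 * (n ^ m)⁻¹ * ((N : ℝ) ^ m)⁻¹) := by
      rw [hr, div_pow, div_pow]; field_simp; norm_num
    have h2 : (N : ℝ) ^ 2 * n ^ 2 * (n ^ m)⁻¹ * ((N : ℝ) ^ m)⁻¹ =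
        (N : ℝ) ^ (2 - 2 * ε - (1 - ε) * m) := by
      rw [e2, en, en, ← Real.rpow_natCast (N : ℝ) m, ← Real.rpow_neg hN0.le, ← Real.rpow_neg hN0.le,
        ← Real.rpow_add hN0, ← Real.rpow_add hN0, ← Real.rpow_add hN0]
      congr 1; push_cast; ring
    rw [h1, h2]
    -- The comparison of exponents is the hypothesis `2 ε ≤ (1 - ε) m`.
    have h3 : (N : ℝ) ^ (2 - 2 * ε - (1 - ε) * m) ≤ (N : ℝ) ^ (2 - 4 * ε) :=
      Real.rpow_le_rpow_of_exponent_le hN1 (by linarith)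
    have h4 : (10 : ℝ) ^ m / 100 ≤ 10 ^ m := div_le_self (by positivity) (by norm_num)
    gcongr

end SphereEdge

theorem lemma4 (K : ℕ) (hK : 1 ≤ K) (ε : ℝ) (hε : ε ∈ Ico (3 / 5 : ℝ) 1)
    (q : ℕ) (hq : (K : ℝ) - 3 + 2 / (1 - ε) ≤ q)
    (κ : ℝ → ℝ)
    (hκ_smooth : ContDiffOn ℝ ((3 * q - 1 : ℕ) : WithTop ℕ∞) κ (Ici 0) ∨
      (K = 1 ∧ ContDiffOn ℝ (q : WithTop ℕ∞) κ (Ici 0)))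
    (hκ_ne : ∃ t, 0 ≤ t ∧ κ t ≠ 0)
    (hκ_supp : ∀ t, 0 ≤ t → κ t ≠ 0 → t ∈ Icc (1 / 2 : ℝ) 2)
    (φs : ℝ) :
    ∃ c : ℝ, 0 < c ∧
      ∀ (A : Set S2) (v : ℝ → E3) (L a b δ : ℝ), EdgeSetting A v L a b δ → phiStar v a b = φs →
      ∀ x ∈ edgeNhd A v a b δ, ∀ p ∈ Icc (a + δ) (b - δ),
      geoDistSet x (bdry A) = geoDist x (v p) →
      (∃! C : Set S2, IsOscCap A v a b p C) ∧
      ∀ C : Set S2, IsOscCap A v a b p C →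
      ∀ r : E3, ‖r‖ = 1 → inner ℝ (x : E3) r = 0 →
      ∀ N : ℕ, 1 ≤ N → (N : ℝ) ^ (-ε) < dDelta v L a b δ / 2 →
        Integrable (coeffIntegrand A C κ K N x r) surf ∧
        ‖∫ y, coeffIntegrand A C κ K N x r y ∂surf‖ ≤
          c * (supThird v a b + 1) * (N : ℝ) ^ (2 - 4 * ε) := by
  have hε1 : 0 < 1 - ε := by linarith [hε.2]
  have h5 : 5 ≤ 2 / (1 - ε) := by rw [le_div_iff₀ hε1]; linarith [hε.1]
  have hqK : K + 2 ≤ q := by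
    have : ((K + 2 : ℕ) : ℝ) ≤ q := by push_cast; linarith
    exact_mod_cast this
  -- The decay exponent. The lower bound on `q` gives `m ≥ 2 / (1 - ε) - 2 = 2 ε / (1 - ε)`, and `ε
  -- ≥ 3 / 5` gives `m ≥ 3`, as needed for the tail integral.
  obtain ⟨m, hm⟩ : ∃ m, q + 1 = m + K := ⟨q + 1 - K, by omega⟩
  have hm3 : 3 ≤ m := by omega
  have hmε : 2 * ε ≤ (1 - ε) * m := by
    have e1 : (q : ℝ) + 1 = m + K := by exact_mod_cast hm
    have e2 : 2 / (1 - ε) ≤ m + 2 := by linarith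
    rw [div_le_iff₀ hε1] at e2
    linarith
  have hκ : ContDiffOn ℝ (q : WithTop ℕ∞) κ (Ici 0) := by
    rcases hκ_smooth with hs | ⟨_, hs⟩
    · exact hs.of_le (by exact_mod_cast (by omega : q ≤ 3 * q - 1))
    · exact hs
  obtain ⟨Cw, hCw, hw⟩ := exists_norm_waveletPolar_le (K := K) (m := m) (l := q) (by omega) (by omega) hκ
    hκ_supp
  obtain ⟨f, -, -, hfκ, hf, -⟩ := exists_contDiff_extension hκ hκ_supp
  have hcos : 0 ≤ 1 - Real.cos φs := by linarith [Real.cos_le_one φs]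
  -- `1296 = 24 · 2 · 27` comes from the band of length `2 ρ` and height `M (3 ρ) ^ 3`, and `192 ·
  -- 10 ^ m` from the tail with `ρ = N ^ (-ε) / 10`; the added `1` only ensures positivity.
  refine ⟨Cw * (1296 / (1 - Real.cos φs) + 192 * 10 ^ m) + 1, by positivity, ?_⟩
  rintro A v L a b δ h rfl x ⟨hx1, hx2⟩ p hp hxp
  have hp' := h.mem_Icc_of_mem hp
  refine ⟨h.existsUnique_isOscCap (h.mem_Ioo_of_mem hp), ?_⟩
  intro C hC r hr hxr N hN hNd
  obtain ⟨z, φ, ho, rfl⟩ := h.oscData_of_isOscCap (h.mem_Ioo_of_mem hp) hC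
  obtain ⟨hcφ, hc1⟩ := h.abs_cos_le hp' ho
  have hxn := S2.norm_eq x
  have hN1 : (1 : ℝ) ≤ N := by exact_mod_cast hN
  have hw' : ∀ y : S2, ‖rotOp x r (wavelet κ K N) y‖ ≤ Cw * (N : ℝ) ^ 2 ∧
      (N * geoDist (y : E3) x) ^ m * ‖rotOp x r (wavelet κ K N) y‖ ≤ Cw * (N : ℝ) ^ 2 := by
    intro y
    rw [rotOp_wavelet hxn hr hxr]
    exact hw N hN _ ⟨geoDist_nonneg _ _, geoDist_le_pi _ _⟩ _
  refine ⟨integrable_coeffIntegrand (nullMeasurableSet_of_null_frontier h.surf_frontier)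
    (measurableSet_cap z φ) (measurable_rotOp_wavelet hfκ hf K N hxn hr hxr) (fun y => (hw' y).1), ?_⟩
  -- With this radius `20 ρ = 2 N ^ (-ε) < d_δ`, which is what the geometric lemmas require.
  obtain ⟨ρ, hρ⟩ : ∃ ρ, ρ = (N : ℝ) ^ (-ε) / 10 := ⟨_, rfl⟩
  have hρ0 : 0 < ρ := by rw [hρ]; positivity
  have hM := h.supThird_nonneg
  have hzT : inner ℝ (z : E3) (curveDeriv v a b 1 p) = 0 := by
    rw [ho.center]; exact ((h.isFrame' hp').inner_arcPoint φ).2.1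
  have hint := norm_integral_le_of_band (F := coeffIntegrand A (cap z φ) κ K N x r) hxn (S2.norm_eq z)
    (h.norm_deriv hp') hzT (c := Real.cos φ) (h := supThird v a b * (3 * ρ) ^ 3) (ρ := 2 * ρ) (r := ρ)
    (C₁ := Cw * (N : ℝ) ^ 2) (C₂ := Cw * (N : ℝ) ^ 2 * ((N : ℝ) ^ m)⁻¹) (hcφ.trans_lt hc1)
    (by positivity) (by positivity) hρ0 (by positivity) (by positivity) hm3
    (fun y hy => by
      by_contra hcon
      rw [not_or, not_le] at hcon
      refine hy (coeffIntegrand_eq_zero ?_)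
      exact (h.mem_iff_mem_cap_or hp ho hxp (hxp ▸ hx2) hρ0 (by linarith) hcon.1).resolve_right hcon.2)
    (fun y => norm_coeffIntegrand_le.trans (hw' y).1)
    (fun y => by
      rw [← div_eq_mul_inv, le_div_iff₀ (by positivity)]
      refine le_trans (le_of_eq ?_) ((mul_le_mul_of_nonneg_left
        (norm_coeffIntegrand_le (A := A) (C := cap z φ) (κ := κ) (K := K) (N := N) (x := x) (r := r) (y := y))
        (by have := geoDist_nonneg (y : E3) x; positivity)).trans (hw' y).2)
      ring)
  obtain ⟨s1, s2⟩ := rpow_scale_le hN hmε hρ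
  refine hint.trans ?_
  set P : ℝ := (N : ℝ) ^ (2 - 4 * ε)
  have hP : 0 ≤ P := by positivity
  set M := supThird v a b
  set γ := Real.cos (phiStar v a b)
  have hγ : 0 < 1 - γ := by linarith
  have t1 : Cw * (N : ℝ) ^ 2 * (24 * (2 * ρ) * (M * (3 * ρ) ^ 3) / (1 - |Real.cos φ|)) ≤
      Cw * (1296 / (1 - γ)) * (M + 1) * P := by
    calc _ = Cw * (1296 / (1 - |Real.cos φ|)) * M * ((N : ℝ) ^ 2 * ρ ^ 4) := by ring
      _ ≤ _ := by
        gcongr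
        linarith
  have t2 : Cw * (N : ℝ) ^ 2 * ((N : ℝ) ^ m)⁻¹ * (192 * ρ ^ 2 * (ρ ^ m)⁻¹) ≤
      Cw * (192 * 10 ^ m) * (M + 1) * P := by
    calc _ = Cw * 192 * ((N : ℝ) ^ 2 * ((N : ℝ) ^ m)⁻¹ * (ρ ^ 2 * (ρ ^ m)⁻¹)) := by ring
      _ ≤ Cw * 192 * (10 ^ m * P) := by gcongr
      _ = Cw * (192 * 10 ^ m) * 1 * P := by ring
      _ ≤ _ := by
        gcongr
        linarith
  have t3 : 0 ≤ (M + 1) * P := by positivity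
  linarith
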